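/- Setting. Let $H,\widehat H$ be finite-dimensional complex Hilbert spaces, $H_0=H\oplus\widehat H$, $\mathbf H=H_0\oplus H=H\oplus\widehat H\oplus H$, let $[\mathcal K,\mathcal K']$ be the space of linear operators from $\mathcal K$ to $\mathcal K'$, $[\mathcal K]=[\mathcal K,\mathcal K]$, and let $J\in[\mathbf H]$, $J\{y_0,\widehat y,y_1\}=\{-y_1,i\widehat y,y_0\}$. Inner products are linear in the first argument, and $\operatorname{Im}X=(X-X^*)/(2i)$. Let $\mathcal I=[a,b\rangle$, $-\infty<a<b\le\infty$ (a finite $b$ may or may not belong to $\mathcal I$), and let $B,\Delta:\mathcal I\to[\mathbf H]$ be measurable, integrable on each segment $[a,\beta]\subset\mathcal I$, with $B(t)=B(t)^*$ and $\Delta(t)\ge0$ a.e. Assume that the system $Jy'-B(t)y=\Delta(t)f(t)$ is definite: if $\lambda\in\mathbb C$, $y$ is locally absolutely continuous with $Jy'-By=\lambda\Delta y$ a.e. on $\mathcal I$, and $\Delta y=0$ a.e., then $y=0$ on $\mathcal I$. Let $\mathcal L^2_\Delta(\mathcal I)$ be the semi-Hilbert space of measurable $f:\mathcal I\to\mathbf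 H$ with $\int_{\mathcal I}(\Delta f,f)\,dt<\infty$ and $L^2_\Delta(\mathcal I)$ its Hilbert quotient. The maximal relation $\mathcal T_{\max}$ consists of all pairs $\{y,f\}\in(\mathcal L^2_\Delta(\mathcal I))^2$ with $y$ locally absolutely continuous and $Jy'-By=\Delta f$ a.e. For $y,z\in\operatorname{dom}\mathcal T_{\max}$ put $[y,z]_b=\lim_{t\uparrow b}(Jy(t),z(t))$. Let $T_{\min}$ be the image in $(L^2_\Delta(\mathcal I))^2$ of the set of all $\{y,f\}\in\mathcal T_{\max}$ with $y(a)=0$ and $[y,z]_b=0$ for all $z\in\operatorname{dom}\mathcal T_{\max}$, and let $n_\pm=\dim\ker(T_{\min}^*-\lambda)$, $\lambda\in\mathbb C_\pm$, be its deficiency indices (for definiteness, at $\lambda=\pm i$). Assume $n_-\le n_+$. Let $\widetilde U\in[\mathbf H]$ satisfy $\widetilde U^*J\widetilde U=J$ and write $\widetilde Uy(a)=\{\Gamma_{0a}y,\widehat\Gamma_ay,\Gamma_{1a}y\}\in H\oplus\widehat H\oplus H$. Let $\widetilde{\mathcal H}_b$ be a finite-dimensional Hilbert space, $\mathcal H_b\subset\widetilde{\mathcal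 H}_b$ a subspace, $P^\perp$ the orthoprojector of $\widetilde{\mathcal H}_b$ onto $\widetilde{\mathcal H}_b\ominus\mathcal H_b$, and let $\Gamma_b=(\Gamma_{0b},\widehat\Gamma_b,\Gamma_{1b})^\top:\operatorname{dom}\mathcal T_{\max}\to\widetilde{\mathcal H}_b\oplus\widehat H\oplus\mathcal H_b$ be a surjective linear mapping with $$[y,z]_b=(\Gamma_{0b}y,\Gamma_{1b}z)-(\Gamma_{1b}y,\Gamma_{0b}z)+i(P^\perp\Gamma_{0b}y,P^\perp\Gamma_{0b}z)+i(\widehat\Gamma_by,\widehat\Gamma_bz),\qquad y,z\in\operatorname{dom}\mathcal T_{\max}.$$ A boundary parameter $\tau$ consists of holomorphic operator functions $C_0(\lambda)\in[\widetilde{\mathcal H}_b]$, $C_1(\lambda)\in[\mathcal H_b,\widetilde{\mathcal H}_b]$ on $\mathbb C_+$ and $D_0(\lambda)\in[\widetilde{\mathcal H}_b,\mathcal H_b]$, $D_1(\lambda)\in[\mathcal H_b]$ on $\mathbb C_-$ such that, with the block forms $C_0=(C_{01},C_{02})$ and $D_0=(D_{01},D_{02})$ relative to $\widetilde{\mathcal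 H}_b=\mathcal H_b\oplus(\widetilde{\mathcal H}_b\ominus\mathcal H_b)$ and $P$ the orthoprojector of $\widetilde{\mathcal H}_b$ onto $\mathcal H_b$: $2\operatorname{Im}(C_1C_{01}^*)+C_{02}C_{02}^*\ge0$ on $\mathbb C_+$; $2\operatorname{Im}(D_1D_{01}^*)+D_{02}D_{02}^*\le0$ on $\mathbb C_-$; $C_1(\lambda)D_{01}^*(\overline\lambda)-C_{01}(\lambda)D_1^*(\overline\lambda)+iC_{02}(\lambda)D_{02}^*(\overline\lambda)=0$ for $\lambda\in\mathbb C_+$; $C_0(\lambda)-iC_1(\lambda)P$ is invertible for $\lambda\in\mathbb C_+$ and $D_{01}(\lambda)+iD_1(\lambda)$ is invertible for $\lambda\in\mathbb C_-$. For $\lambda\in\mathbb C\setminus\mathbb R$ let $v_\tau(\cdot,\lambda):\mathcal I\to[H_0,\mathbf H]$ be the function such that, for every $h_0\in H_0$, $y=v_\tau(\cdot,\lambda)h_0$ is a locally absolutely continuous solution of $Jy'-By=\lambda\Delta y$ lying in $\mathcal L^2_\Delta(\mathcal I)$ and satisfying $$\Gamma_{1a}y=-P_Hh_0,\qquad i(\widehat\Gamma_a-\widehat\Gamma_b)y=P_{\widehat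 H}h_0,$$ $C_0(\lambda)\Gamma_{0b}y+C_1(\lambda)\Gamma_{1b}y=0$ if $\lambda\in\mathbb C_+$, and $D_0(\lambda)\Gamma_{0b}y+D_1(\lambda)\Gamma_{1b}y=0$ if $\lambda\in\mathbb C_-$. The $m$-function $m_\tau:\mathbb C\setminus\mathbb R\to[H_0]$ is defined by $m_\tau(\lambda)h_0=(\Gamma_{0a}+\widehat\Gamma_a)(v_\tau(\cdot,\lambda)h_0)+\tfrac i2P_{\widehat H}h_0$. Proposition. For every boundary parameter $\tau$ and every $\lambda\in\mathbb C\setminus\mathbb R$ the function $v_\tau(\cdot,\lambda)$ exists and is unique, so that $m_\tau$ is well defined, and $m_\tau$ is a Nevanlinna operator function: it is holomorphic on $\mathbb C\setminus\mathbb R$, $\operatorname{Im}\lambda\cdot\operatorname{Im}m_\tau(\lambda)\ge0$ and $m_\tau(\lambda)^*=m_\tau(\overline\lambda)$. Moreover, for all $\lambda\in\mathbb C_+$ the integral below exists and $$(\operatorname{Im}\lambda)^{-1}\operatorname{Im}m_\tau(\lambda)\ \ge\ \int_{\mathcal I}v_\tau^*(t,\lambda)\Delta(t)v_\tau(t,\lambda)\,dt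 .$$ If in addition $n_+=n_-$, then this holds for all $\lambda\in\mathbb C\setminus\mathbb R$. -/

import Mathlib

open MeasureTheory Filter Topology
open scoped ComplexStarModule

noncomputable section

/-- Finite-dimensional normed spaces over `ℂ` are complete (so that Hilbert-space adjoints exist). -/
instance completeSpace_of_finiteDimensional_complex (E : Type*) [NormedAddCommGroup E]
    [NormedSpace ℂ E] [FiniteDimensional ℂ E] : CompleteSpace E :=
  FiniteDimensional.complete ℂ E

namespace SymmSys

/-! ### The finite-dimensional spaces and the signature operator -/

/-- `H₀ = H ⊕ Ĥ` (orthogonal sum); the second argument `K` is the space `Ĥ`. -/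
abbrev HZero (H K : Type*) : Type _ := WithLp 2 (H × K)

/-- `𝐇 = H₀ ⊕ H = H ⊕ Ĥ ⊕ H` (orthogonal sum). -/
abbrev HBold (H K : Type*) : Type _ := WithLp 2 (HZero H K × H)

variable {H K : Type*}
  [NormedAddCommGroup H] [InnerProductSpace ℂ H] [FiniteDimensional ℂ H]
  [NormedAddCommGroup K] [InnerProductSpace ℂ K] [FiniteDimensional ℂ K]

variable (H K) in
/-- The signature operator `J {y₀, ŷ, y₁} = {-y₁, i ŷ, y₀}` on `H ⊕ Ĥ ⊕ H`. -/
def J : HBold H K →L[ℂ] HBold H K :=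
  LinearMap.toContinuousLinearMap
    { toFun := fun y => WithLp.toLp 2 (WithLp.toLp 2 (-y.snd, Complex.I • y.fst.snd), y.fst.fst)
      map_add' := by
        intro x y
        refine WithLp.ofLp_injective 2 (Prod.ext (WithLp.ofLp_injective 2 (Prod.ext ?_ ?_)) ?_) <;>
          simp [add_comm]
      map_smul' := by
        intro c x
        refine WithLp.ofLp_injective 2 (Prod.ext (WithLp.ofLp_injective 2 (Prod.ext ?_ ?_)) ?_) <;>
          simp [smul_smul, mul_comm] }

variable (H K) in
/-- The orthoprojector of `H₀ = H ⊕ Ĥ` onto `Ĥ`. -/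
def projHat : HZero H K →L[ℂ] HZero H K :=
  LinearMap.toContinuousLinearMap
    { toFun := fun h => WithLp.toLp 2 (0, h.snd)
      map_add' := by
        intro x y
        apply WithLp.ofLp_injective
        ext <;> simp
      map_smul' := by
        intro c x
        apply WithLp.ofLp_injective
        ext <;> simp }

/-- `U` is `J`-unitary: `U* J U = J`. -/
def IsJUnitary (U : HBold H K →L[ℂ] HBold H K) : Prop :=
  (ContinuousLinearMap.adjoint U) ∘L (J H K) ∘L U = J H K

/-! ### Definite symmetric systems -/

/-- `y` is absolutely continuous on each segment `[a, β] ⊆ I`. -/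
def LocAC {E : Type*} [PseudoMetricSpace E] (I : Set ℝ) (a : ℝ) (y : ℝ → E) : Prop :=
  ∀ β ∈ I, AbsolutelyContinuousOnInterval y a β

/-- `J y' - B y = g` a.e. on `I`, in the class of locally absolutely continuous functions. -/
def SolvesOn (I : Set ℝ) (a : ℝ) (B : ℝ → HBold H K →L[ℂ] HBold H K)
    (y g : ℝ → HBold H K) : Prop :=
  LocAC I a y ∧ ∀ᵐ t ∂(volume.restrict I), ∃ y' : HBold H K,
    HasDerivAt y y' t ∧ J H K y' - B t (y t) = g t

section SolvesOn

variable {I : Set ℝ} {a : ℝ} {B : ℝ → HBold H K →L[ℂ] HBold H K}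

theorem SolvesOn.zero (I : Set ℝ) (a : ℝ) (B : ℝ → HBold H K →L[ℂ] HBold H K) :
    SolvesOn I a B 0 0 := by
  refine ⟨fun β _ => ?_, Eventually.of_forall fun t => ⟨0, ?_, ?_⟩⟩
  · simpa [AbsolutelyContinuousOnInterval] using tendsto_const_nhds
  · exact hasDerivAt_const t (0 : HBold H K)
  · simp

theorem SolvesOn.add {y₁ y₂ g₁ g₂ : ℝ → HBold H K} (h : SolvesOn I a B y₁ g₁)
    (k : SolvesOn I a B y₂ g₂) : SolvesOn I a B (y₁ + y₂) (g₁ + g₂) := by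
  refine ⟨fun β hβ => (h.1 β hβ).add (k.1 β hβ), ?_⟩
  filter_upwards [h.2, k.2] with t ⟨x, hx, ex⟩ ⟨y, hy, ey⟩
  refine ⟨x + y, hx.add hy, ?_⟩
  rw [Pi.add_apply, Pi.add_apply, ← ex, ← ey, map_add, map_add]
  abel

theorem SolvesOn.smul {y g : ℝ → HBold H K} (h : SolvesOn I a B y g) (c : ℂ) :
    SolvesOn I a B (c • y) (c • g) := by
  refine ⟨fun β hβ => ?_, ?_⟩
  · have := Tendsto.const_mul ‖c‖ (h.1 β hβ)
    simpa [AbsolutelyContinuousOnInterval, dist_smul₀, Finset.mul_sum] using this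
  · filter_upwards [h.2] with t ⟨x, hx, ex⟩
    refine ⟨c • x, hx.const_smul c, ?_⟩
    rw [Pi.smul_apply, Pi.smul_apply, ← ex, map_smul, map_smul, smul_sub]

end SolvesOn

variable (H K) in
/-- A definite first-order symmetric system `J y' - B(t) y = Δ(t) f(t)` on an interval
`I = [a, b⟩` with regular left endpoint `a`; here `a < b ≤ ∞`, and `b < ∞` may or may not
belong to `I`. -/
structure SymmetricSystem where
  /-- the interval `[a, b⟩` -/
  I : Set ℝ
  /-- the regular endpoint -/
  a : ℝ
  /-- the potential -/
  B : ℝ → HBold H K →L[ℂ] HBold H K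
  /-- the weight -/
  Δ : ℝ → HBold H K →L[ℂ] HBold H K
  ordConnected : I.OrdConnected
  isLeast : IsLeast I a
  nontrivial : I.Nontrivial
  integrable_B : ∀ β ∈ I, IntegrableOn B (Set.Icc a β) volume
  integrable_Δ : ∀ β ∈ I, IntegrableOn Δ (Set.Icc a β) volume
  selfAdjoint_B : ∀ᵐ t ∂(volume.restrict I), IsSelfAdjoint (B t)
  nonneg_Δ : ∀ᵐ t ∂(volume.restrict I), (Δ t).IsPositive
  definite : ∀ (z : ℂ) (y : ℝ → HBold H K),
    SolvesOn I a B y (fun t => z • Δ t (y t)) →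
    (∀ᵐ t ∂(volume.restrict I), Δ t (y t) = 0) → ∀ t ∈ I, y t = 0

namespace SymmetricSystem

variable (S : SymmetricSystem H K)

/-- The filter `t ↑ b` inside `I = [a, b⟩`.  (If `b ∈ I`, it is concentrated at `b`; the
functions to which it is applied are then continuous on `[a, b]`.) -/
def endFilter : Filter ℝ := Filter.map (Subtype.val : S.I → ℝ) atTop

/-- `f` belongs to `ℒ²_Δ(I)`: `f` is measurable on `I` and `∫_I (Δ f, f) dt < ∞`. -/
def MemL2 (f : ℝ → HBold H K) : Prop :=
  AEStronglyMeasurable f (volume.restrict S.I) ∧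
    IntegrableOn (fun t => inner ℂ (f t) (S.Δ t (f t))) S.I volume

/-- The semi-definite inner product `(f, g)_Δ = ∫_I (Δ(t) f(t), g(t)) dt`
(linear in `f`, conjugate linear in `g`). -/
def form (f g : ℝ → HBold H K) : ℂ := ∫ t in S.I, inner ℂ (g t) (S.Δ t (f t))

end SymmetricSystem

/-- Cauchy-Schwarz (in additive form) for a positive operator. -/
theorem norm_inner_le_of_isPositive {E : Type*} [NormedAddCommGroup E] [InnerProductSpace ℂ E]
    {A : E →L[ℂ] E} (hA : A.IsPositive) (x y : E) :
    ‖inner ℂ x (A y)‖ ≤ ‖inner ℂ x (A x)‖ + ‖inner ℂ y (A y)‖ := by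
  -- expand the quadratic form at `x - c y` with a unimodular `c`
  have key : ∀ c : ℂ, ‖c‖ = 1 →
      2 * (c * inner ℂ x (A y)).re ≤ ‖inner ℂ x (A x)‖ + ‖inner ℂ y (A y)‖ := by
    intro c hc
    have h0 := hA.re_inner_nonneg_right (x - c • y)
    have hs : inner ℂ y (A x) = (starRingEnd ℂ) (inner ℂ x (A y)) := by
      rw [inner_conj_symm]
      exact (hA.isSymmetric y x).symm
    have hcc : (starRingEnd ℂ) c * c = 1 := by
      rw [mul_comm, Complex.mul_conj, Complex.normSq_eq_norm_sq, hc]; norm_num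
    have e : inner ℂ (x - c • y) (A (x - c • y)) =
        inner ℂ x (A x) - c * inner ℂ x (A y)
          - (starRingEnd ℂ) (c * inner ℂ x (A y)) + inner ℂ y (A y) := by
      simp only [map_sub, map_smul, inner_sub_left, inner_sub_right, inner_smul_left,
        inner_smul_right, hs, map_mul]
      linear_combination (inner ℂ y (A y)) * hcc
    rw [e] at h0
    have h1 := Complex.re_le_norm (inner ℂ x (A x))
    have h2 := Complex.re_le_norm (inner ℂ y (A y))
    simp only [RCLike.re_to_complex, Complex.add_re, Complex.sub_re, Complex.conj_re] at h0
    linarith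
  set w := inner ℂ x (A y) with hw
  by_cases hw0 : w = 0
  · rw [hw0, norm_zero]; positivity
  · have hn : (‖w‖ : ℂ) ≠ 0 := by simpa using hw0
    have := key ((starRingEnd ℂ) w / ‖w‖) (by simp [hw0])
    have e : ((starRingEnd ℂ) w / ‖w‖) * w = (‖w‖ : ℂ) := by
      rw [div_mul_eq_mul_div, mul_comm, Complex.mul_conj, Complex.normSq_eq_norm_sq]
      push_cast
      field_simp
    rw [e, Complex.ofReal_re] at this
    have := norm_nonneg w
    linarith

namespace SymmetricSystem

variable (S : SymmetricSystem H K)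

theorem measurableSet_I : MeasurableSet S.I := S.ordConnected.measurableSet

theorem aestronglyMeasurable_Δ : AEStronglyMeasurable S.Δ (volume.restrict S.I) := by
  obtain ⟨u, hu⟩ : ∃ u : ℚ → ℝ, (∀ n, u n ∈ S.I) ∧ S.I ⊆ ⋃ n, Set.Icc S.a (u n) := by
    classical
    by_cases hmax : ∃ m, IsGreatest S.I m
    · obtain ⟨m, hm⟩ := hmax
      exact ⟨fun _ => m, fun _ => hm.1,
        fun t ht => Set.mem_iUnion.2 ⟨0, S.isLeast.2 ht, hm.2 ht⟩⟩
    · refine ⟨fun q => if (q : ℝ) ∈ S.I then (q : ℝ) else S.a, fun q => ?_, fun t ht => ?_⟩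
      · by_cases hq : (q : ℝ) ∈ S.I
        · simp [hq]
        · simpa [hq] using S.isLeast.1
      · obtain ⟨s, hs, hts⟩ : ∃ s ∈ S.I, t < s := by
          by_contra hcon
          push Not at hcon
          exact hmax ⟨t, ht, fun s hs => hcon s hs⟩
        obtain ⟨q, hq1, hq2⟩ := exists_rat_btwn hts
        have hq : (q : ℝ) ∈ S.I := S.ordConnected.out ht hs ⟨hq1.le, hq2.le⟩
        refine Set.mem_iUnion.2 ⟨q, S.isLeast.2 ht, ?_⟩
        simpa [hq] using hq1.le
  have h : AEStronglyMeasurable S.Δ (volume.restrict (⋃ n, Set.Icc S.a (u n))) :=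
    AEStronglyMeasurable.iUnion fun n => (S.integrable_Δ _ (hu.1 n)).aestronglyMeasurable
  exact h.mono_measure (Measure.restrict_mono hu.2 le_rfl)

theorem aestronglyMeasurable_inner {f g : ℝ → HBold H K}
    (hf : AEStronglyMeasurable f (volume.restrict S.I))
    (hg : AEStronglyMeasurable g (volume.restrict S.I)) :
    AEStronglyMeasurable (fun t => (inner ℂ (g t) (S.Δ t (f t)) : ℂ)) (volume.restrict S.I) := by
  have h : AEStronglyMeasurable (fun t => S.Δ t (f t)) (volume.restrict S.I) :=
    (ContinuousLinearMap.apply ℂ (HBold H K)).flip.aestronglyMeasurable_comp₂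
      S.aestronglyMeasurable_Δ hf
  exact hg.inner h

theorem MemL2.integrable_inner {f g : ℝ → HBold H K} (hf : S.MemL2 f) (hg : S.MemL2 g) :
    IntegrableOn (fun t => (inner ℂ (g t) (S.Δ t (f t)) : ℂ)) S.I volume := by
  refine Integrable.mono' (hg.2.norm.add hf.2.norm) (S.aestronglyMeasurable_inner hf.1 hg.1) ?_
  filter_upwards [S.nonneg_Δ] with t ht
  exact norm_inner_le_of_isPositive ht _ _

/-- The linear space `ℒ²_Δ(I)`. -/
def L2 : Submodule ℂ (ℝ → HBold H K) where
  carrier := {f | S.MemL2 f}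
  zero_mem' := ⟨aestronglyMeasurable_const, by simp⟩
  add_mem' := by
    intro f g hf hg
    refine ⟨hf.1.add hg.1, ?_⟩
    have h := ((hf.2.add (MemL2.integrable_inner S hf hg)).add
      (MemL2.integrable_inner S hg hf)).add hg.2
    refine h.congr (Eventually.of_forall fun t => ?_)
    simp only [Pi.add_apply, map_add, inner_add_left, inner_add_right]
    ring
  smul_mem' := by
    intro c f hf
    refine ⟨hf.1.const_smul c, ?_⟩
    refine (hf.2.const_mul ((starRingEnd ℂ) c * c)).congr (Eventually.of_forall fun t => ?_)
    simp only [Pi.smul_apply, map_smul, inner_smul_left, inner_smul_right]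
    ring

/-- The functions `f` with `Δ f = 0` a.e. on `I`.  For `f ∈ ℒ²_Δ(I)` this means `‖f‖_Δ = 0`, so
the quotient space `L²_Δ(I)` is the image of `ℒ²_Δ(I)` in `(ℝ → 𝐇) ⧸ null`. -/
def null : Submodule ℂ (ℝ → HBold H K) where
  carrier := {f | ∀ᵐ t ∂(volume.restrict S.I), S.Δ t (f t) = 0}
  zero_mem' := by simp
  add_mem' := by
    intro f g hf hg
    change ∀ᵐ t ∂(volume.restrict S.I), S.Δ t ((f + g) t) = 0
    filter_upwards [hf, hg] with t h1 h2
    simp [h1, h2]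
  smul_mem' := by
    intro c f hf
    change ∀ᵐ t ∂(volume.restrict S.I), S.Δ t ((c • f) t) = 0
    filter_upwards [hf] with t h1
    simp [h1]

/-- The maximal relation in `ℒ²_Δ(I)`: pairs `{y, f}` with `y` locally absolutely continuous,
`y, f ∈ ℒ²_Δ(I)` and `J y' - B y = Δ f` a.e. on `I`. -/
def tmax : Submodule ℂ ((ℝ → HBold H K) × (ℝ → HBold H K)) where
  carrier := {p | p.1 ∈ S.L2 ∧ p.2 ∈ S.L2 ∧ SolvesOn S.I S.a S.B p.1 (fun t => S.Δ t (p.2 t))}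
  zero_mem' := by
    refine ⟨S.L2.zero_mem, S.L2.zero_mem, ?_⟩
    convert! SolvesOn.zero S.I S.a S.B using 2
    simp
  add_mem' := by
    rintro p q ⟨h1, h2, h3⟩ ⟨k1, k2, k3⟩
    refine ⟨S.L2.add_mem h1 k1, S.L2.add_mem h2 k2, ?_⟩
    convert! h3.add k3 using 2
    simp
  smul_mem' := by
    rintro c p ⟨h1, h2, h3⟩
    refine ⟨S.L2.smul_mem c h1, S.L2.smul_mem c h2, ?_⟩
    convert! h3.smul c using 2
    simp

/-- The domain of the maximal relation. -/
def domMax : Submodule ℂ (ℝ → HBold H K) := S.tmax.map (LinearMap.fst ℂ _ _)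

/-- `[y, z]_b = lim_{t ↑ b} (J y(t), z(t))` exists and is equal to `w`. -/
def HasBracket (y z : ℝ → HBold H K) (w : ℂ) : Prop :=
  Tendsto (fun t => inner ℂ (z t) (J H K (y t))) S.endFilter (𝓝 w)

/-- The minimal relation: pairs `{y, f}` of the maximal relation with `y(a) = 0` and
`[y, z]_b = 0` for all `z` in the domain of the maximal relation. -/
def tmin : Set ((ℝ → HBold H K) × (ℝ → HBold H K)) :=
  {p | p ∈ S.tmax ∧ p.1 S.a = 0 ∧ ∀ z ∈ S.domMax, S.HasBracket p.1 z 0}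

/-- The functions `h ∈ ℒ²_Δ(I)` whose class belongs to `ker (T_min^* - z)`, i.e. such that
`(f, h)_Δ = (y, z h)_Δ` for all `{y, f}` in the minimal relation. -/
def preDefect (z : ℂ) : Submodule ℂ (ℝ → HBold H K) where
  carrier := {h | h ∈ S.L2 ∧ ∀ p ∈ S.tmin, S.form p.2 h = S.form p.1 (z • h)}
  zero_mem' := ⟨S.L2.zero_mem, by intro p _; simp [form]⟩
  add_mem' := by
    rintro h k ⟨h1, h2⟩ ⟨k1, k2⟩
    refine ⟨S.L2.add_mem h1 k1, fun p hp => ?_⟩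
    have e : ∀ f, f ∈ S.L2 → ∀ u, u ∈ S.L2 → ∀ v, v ∈ S.L2 →
        S.form f (u + v) = S.form f u + S.form f v := by
      intro f hf u hu v hv
      simp only [form, Pi.add_apply, inner_add_left]
      exact integral_add (MemL2.integrable_inner S hf hu) (MemL2.integrable_inner S hf hv)
    change S.form p.2 (h + k) = S.form p.1 (z • (h + k))
    rw [smul_add, e _ hp.1.2.1 _ h1 _ k1,
      e _ hp.1.1 _ (S.L2.smul_mem z h1) _ (S.L2.smul_mem z k1), h2 p hp, k2 p hp]
  smul_mem' := by
    rintro c h ⟨h1, h2⟩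
    refine ⟨S.L2.smul_mem c h1, fun p hp => ?_⟩
    have e : ∀ f u, S.form f (c • u) = (starRingEnd ℂ) c * S.form f u := by
      intro f u
      simp only [form, Pi.smul_apply, inner_smul_left]
      exact integral_const_mul _ _
    change S.form p.2 (c • h) = S.form p.1 (z • (c • h))
    rw [smul_comm, e, e, h2 p hp]

/-- The defect subspace `𝔑_z(T_min) = ker (T_min^* - z)` in `L²_Δ(I)`. -/
def defect (z : ℂ) : Submodule ℂ ((ℝ → HBold H K) ⧸ S.null) := (S.preDefect z).map S.null.mkQ

/-- The deficiency index `n₊(T_min) = dim 𝔑_i(T_min)`. -/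
def defPlus : Cardinal := Module.rank ℂ (S.defect Complex.I)

/-- The deficiency index `n₋(T_min) = dim 𝔑_{-i}(T_min)`. -/
def defMinus : Cardinal := Module.rank ℂ (S.defect (-Complex.I))

end SymmetricSystem

/-! ### Boundary mapping and boundary parameter at the endpoint `b` -/

variable {E : Type*} [NormedAddCommGroup E] [InnerProductSpace ℂ E] [FiniteDimensional ℂ E]

/-- A surjective linear mapping `Γ_b = (Γ_{0b}, Γ̂_b, Γ_{1b})` from the domain of the maximal
relation onto `E ⊕ Ĥ ⊕ F`, where `F` is a subspace of `E` (in the usual notation, `E` is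
`H̃_b` and `F` is `H_b`), with
`[y, z]_b = (Γ_{0b} y, Γ_{1b} z) - (Γ_{1b} y, Γ_{0b} z) + i (P^⊥ Γ_{0b} y, P^⊥ Γ_{0b} z)
  + i (Γ̂_b y, Γ̂_b z)`, where `P^⊥` is the orthoprojector onto `E ⊖ F`. -/
structure BoundaryMap (S : SymmetricSystem H K) (F : Submodule ℂ E) where
  /-- the component `Γ_{0b}` -/
  Γ₀ : S.domMax →ₗ[ℂ] E
  /-- the component `Γ̂_b` -/
  Γhat : S.domMax →ₗ[ℂ] K
  /-- the component `Γ_{1b}` -/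
  Γ₁ : S.domMax →ₗ[ℂ] F
  surjective : Function.Surjective fun y : S.domMax => (Γ₀ y, Γhat y, Γ₁ y)
  green : ∀ y z : S.domMax, S.HasBracket (y : ℝ → HBold H K) (z : ℝ → HBold H K)
    (inner ℂ (Γ₁ z : E) (Γ₀ y) - inner ℂ (Γ₀ z) (Γ₁ y : E)
      + Complex.I * inner ℂ (Fᗮ.orthogonalProjectionOnto (Γ₀ z)) (Fᗮ.orthogonalProjectionOnto (Γ₀ y))
      + Complex.I * inner ℂ (Γhat z) (Γhat y))

open ContinuousLinearMap in
/-- A boundary parameter: a collection of two holomorphic operator pairs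
`(C₀(z), C₁(z)) : E ⊕ F → E`, `z ∈ ℂ₊`, and `(D₀(z), D₁(z)) : E ⊕ F → F`, `z ∈ ℂ₋`, of the
class `R̃(E, F)`.  Here `C₀ = (C₀₁, C₀₂)` and `D₀ = (D₀₁, D₀₂)` with respect to
`E = F ⊕ (E ⊖ F)`. -/
structure BoundaryParameter (F : Submodule ℂ E) where
  C₀ : ℂ → E →L[ℂ] E
  C₁ : ℂ → F →L[ℂ] E
  D₀ : ℂ → E →L[ℂ] F
  D₁ : ℂ → F →L[ℂ] F
  holo_C₀ : DifferentiableOn ℂ C₀ {z | 0 < z.im}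
  holo_C₁ : DifferentiableOn ℂ C₁ {z | 0 < z.im}
  holo_D₀ : DifferentiableOn ℂ D₀ {z | z.im < 0}
  holo_D₁ : DifferentiableOn ℂ D₁ {z | z.im < 0}
  /-- `2 Im (C₁ C₀₁*) + C₀₂ C₀₂* ≥ 0` on `ℂ₊` -/
  dissipative : ∀ z : ℂ, 0 < z.im →
    0 ≤ (2 : ℂ) • (ℑ (C₁ z ∘L adjoint (C₀ z ∘L F.subtypeL)) : E →L[ℂ] E)
      + (C₀ z ∘L Fᗮ.subtypeL) ∘L adjoint (C₀ z ∘L Fᗮ.subtypeL)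
  /-- `2 Im (D₁ D₀₁*) + D₀₂ D₀₂* ≤ 0` on `ℂ₋` -/
  accumulative : ∀ z : ℂ, z.im < 0 →
    (2 : ℂ) • (ℑ (D₁ z ∘L adjoint (D₀ z ∘L F.subtypeL)) : F →L[ℂ] F)
      + (D₀ z ∘L Fᗮ.subtypeL) ∘L adjoint (D₀ z ∘L Fᗮ.subtypeL) ≤ 0
  /-- `C₁(z) D₀₁*(z̄) - C₀₁(z) D₁*(z̄) + i C₀₂(z) D₀₂*(z̄) = 0` on `ℂ₊` -/
  symmetric : ∀ z : ℂ, 0 < z.im →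
    C₁ z ∘L adjoint (D₀ (starRingEnd ℂ z) ∘L F.subtypeL)
      - (C₀ z ∘L F.subtypeL) ∘L adjoint (D₁ (starRingEnd ℂ z))
      + Complex.I • ((C₀ z ∘L Fᗮ.subtypeL) ∘L adjoint (D₀ (starRingEnd ℂ z) ∘L Fᗮ.subtypeL)) = 0
  /-- `0 ∈ ρ(C₀(z) - i C₁(z) P_F)` on `ℂ₊` -/
  isUnit_C : ∀ z : ℂ, 0 < z.im → IsUnit (C₀ z - Complex.I • (C₁ z ∘L F.orthogonalProjectionOnto))
  /-- `0 ∈ ρ(D₀₁(z) + i D₁(z))` on `ℂ₋` -/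
  isUnit_D : ∀ z : ℂ, z.im < 0 → IsUnit (D₀ z ∘L F.subtypeL + Complex.I • D₁ z)

/-! ### The solution `v_τ` and the `m`-function -/

variable (S : SymmetricSystem H K) (U : HBold H K →L[ℂ] HBold H K)
  {F : Submodule ℂ E} (G : BoundaryMap S F) (τ : BoundaryParameter F)

/-- `v : I → [H₀, 𝐇]` is an operator solution of `J y' - B y = z Δ y` with `v(·) h ∈ ℒ²_Δ(I)`
for all `h ∈ H₀` that satisfies
`Γ_{1a} v = -P_H`, `i (Γ̂_a - Γ̂_b) v = P_Ĥ`, and `C₀ Γ_{0b} v + C₁ Γ_{1b} v = 0` (if `z ∈ ℂ₊`),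
`D₀ Γ_{0b} v + D₁ Γ_{1b} v = 0` (if `z ∈ ℂ₋`).  Here
`{Γ_{0a} y, Γ̂_a y, Γ_{1a} y} = U y(a) ∈ H ⊕ Ĥ ⊕ H`. -/
def IsVTau (z : ℂ) (v : ℝ → HZero H K →L[ℂ] HBold H K) : Prop :=
  ∀ h : HZero H K, ∃ y : S.domMax, (∀ t, (y : ℝ → HBold H K) t = v t h) ∧
    SolvesOn S.I S.a S.B y (fun t => z • S.Δ t ((y : ℝ → HBold H K) t)) ∧
    (U ((y : ℝ → HBold H K) S.a)).snd = -h.fst ∧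
    Complex.I • ((U ((y : ℝ → HBold H K) S.a)).fst.snd - G.Γhat y) = h.snd ∧
    (0 < z.im → τ.C₀ z (G.Γ₀ y) + τ.C₁ z (G.Γ₁ y) = 0) ∧
    (z.im < 0 → τ.D₀ z (G.Γ₀ y) + τ.D₁ z (G.Γ₁ y) = 0)

/-- The operator solution `v_τ(·, z)`; on `I` it is the unique function satisfying `IsVTau`. -/
def vTau (z : ℂ) : ℝ → HZero H K →L[ℂ] HBold H K :=
  Classical.epsilon (IsVTau S U G τ z)

/-- The `m`-function `m_τ(z) = (Γ_{0a} + Γ̂_a) v_τ(z) + (i/2) P_Ĥ`. -/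
def mTau (z : ℂ) : HZero H K →L[ℂ] HZero H K :=
  (WithLp.fstL 2 ℂ (HZero H K) H) ∘L U ∘L (vTau S U G τ z S.a) + (Complex.I / 2) • projHat H K

/-- The integrand `v_τ*(t, z) Δ(t) v_τ(t, z)`. -/
def vTauGram (z : ℂ) (t : ℝ) : HZero H K →L[ℂ] HZero H K :=
  (ContinuousLinearMap.adjoint (vTau S U G τ z t)) ∘L (S.Δ t) ∘L (vTau S U G τ z t)

/-- The integral `∫_I v_τ*(t, z) Δ(t) v_τ(t, z) dt` exists, and
`(Im z)⁻¹ Im m_τ(z) ≥ ∫_I v_τ*(t, z) Δ(t) v_τ(t, z) dt`. -/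
def MIneq (z : ℂ) : Prop :=
  IntegrableOn (vTauGram S U G τ z) S.I volume ∧
    (∫ t in S.I, vTauGram S U G τ z t) ≤
      ((z.im : ℂ)⁻¹) • (ℑ (mTau S U G τ z) : HZero H K →L[ℂ] HZero H K)

/-- Nevanlinna operator functions `Φ : ℂ ∖ ℝ → [X]`. -/
def IsNevanlinna {X : Type*} [NormedAddCommGroup X] [InnerProductSpace ℂ X] [CompleteSpace X]
    (Φ : ℂ → X →L[ℂ] X) : Prop :=
  DifferentiableOn ℂ Φ {z | z.im ≠ 0} ∧
    ∀ z : ℂ, z.im ≠ 0 → 0 ≤ (z.im : ℂ) • (ℑ (Φ z) : X →L[ℂ] X) ∧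
      ContinuousLinearMap.adjoint (Φ z) = Φ (starRingEnd ℂ z)

end SymmSys

end

/-!
Write `[y, w]` for the boundary terms in Green's identity on `[a, b⟩`. For two solutions `y`, `w` of
the system for the parameters `z`, `z'` it reads `(z - z̄') (y, w)_Δ = [y, w]`, and the boundary
terms split into a form in `(Γ_{0b}, Γ_{1b})` (`pairForm`) and a symplectic form in the two vectors
`hvec y = {-Γ_{1a} y, i (Γ̂_a - Γ̂_b) y}` and `mvec y = {Γ_{0a} y, ½ (Γ̂_a + Γ̂_b) y}`
(`green_solSpace`). The function `v_τ h` is the solution with `hvec y = h` which satisfies the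
condition `τ` at `b`, and `m_τ h` is its value `mvec y`.

*Signs.* The conditions on `τ` are conditions on the adjoints of the coefficients. These adjoints
parametrize the kernels of the dual coefficients (`ker_opC`, `ker_opD`), so that the kernel of
`(C₀(z), C₁(z))` is a nonpositive subspace for the boundary form at `b`, that of `(D₀(z), D₁(z))` a
nonnegative one, and the two at conjugate points are orthogonal. With `y = w = v_τ h` Green's
identity now gives uniqueness of `v_τ` (together with definiteness of the system), the inequality
for `Im m_τ`, and the positivity of `Im z Im m_τ(z)`; with conjugate parameters it gives
`m_τ(z)* = m_τ(z̄)`.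

*Existence.* Uniqueness bounds the dimensions of the spaces of square integrable solutions from
above, in terms of the number of boundary conditions. Conversely, by von Neumann's formula
(`exists_bd_eq_add`) each vector of boundary values is a sum of those of a solution for `z` and a
solution for `z̄`, and all boundary values occur (`bd_surjective`); this bounds the sum of the two
dimensions from below. The bounds match, hence every boundary value problem with uniqueness and the
right number of conditions is solvable (`exists_mem_apply_eq_of_finrank_le`). Von Neumann's formula
rests on the inclusion `T_min^* ⊆ T_max`, `exists_solution_of_forall_tmin`: an element of `T_min^*`
is corrected by a solution of the inhomogeneous system, the remainder annihilates all compactly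
supported right-hand sides with vanishing moments against the homogeneous solutions, and so it is
itself a homogeneous solution.

*Holomorphy.* It suffices to treat `ℂ₊`. For the problem with prescribed `hvec y` and `Γ_{0b} y`,
Green's identity shows that the difference quotients of the remaining boundary values are inner
products `(y, w)_Δ`, where `w` solves the dual problem and depends continuously on the parameter
(`differentiableAt_matrixElement`). The passage to `τ` is the inversion of the operator function
`C₀ + C₁ Q`, with `Q` the holomorphic operator function `Γ_{0b} y ↦ Γ_{1b} y`
(`differentiableAt_mTau_of_im_pos`).
-/


/-! ### Absolutely continuous functions with values in a normed space -/

section AbsolutelyContinuous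

variable {X Y : Type*} [PseudoMetricSpace X] [PseudoMetricSpace Y]

/-- A function whose increments are dominated by those of an absolutely continuous function is
absolutely continuous. -/
theorem AbsolutelyContinuousOnInterval.of_dist_le {f : ℝ → X} {g : ℝ → Y} {a b : ℝ}
    (hg : AbsolutelyContinuousOnInterval g a b)
    (h : ∀ s ∈ Set.uIcc a b, ∀ t ∈ Set.uIcc a b, dist (f s) (f t) ≤ dist (g s) (g t)) :
    AbsolutelyContinuousOnInterval f a b := by
  rw [absolutelyContinuousOnInterval_iff] at hg ⊢
  intro ε hε
  obtain ⟨δ, hδ, H⟩ := hg ε hε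
  refine ⟨δ, hδ, fun E hE hlt => lt_of_le_of_lt ?_ (H E hE hlt)⟩
  refine Finset.sum_le_sum fun i hi => ?_
  exact h _ (hE.1 i hi).1 _ (hE.1 i hi).2

variable {E F G : Type*} [NormedAddCommGroup E] [NormedAddCommGroup F] [NormedAddCommGroup G]

/-- A bounded biadditive expression in two absolutely continuous functions is absolutely
continuous. -/
theorem AbsolutelyContinuousOnInterval.biadditive {f : ℝ → E} {g : ℝ → F} {a b : ℝ}
    (hf : AbsolutelyContinuousOnInterval f a b) (hg : AbsolutelyContinuousOnInterval g a b)
    {p : E → F → G} {C : ℝ} (hC : 0 ≤ C) (hp : ∀ x y, ‖p x y‖ ≤ C * ‖x‖ * ‖y‖)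
    (hl : ∀ x x' y, p (x - x') y = p x y - p x' y)
    (hr : ∀ x y y', p x (y - y') = p x y - p x y') :
    AbsolutelyContinuousOnInterval (fun t => p (f t) (g t)) a b := by
  obtain ⟨Cf, hCf⟩ := isCompact_uIcc.exists_bound_of_continuousOn hf.continuousOn
  obtain ⟨Cg, hCg⟩ := isCompact_uIcc.exists_bound_of_continuousOn hg.continuousOn
  have hCf0 : 0 ≤ Cf := (norm_nonneg _).trans (hCf a Set.left_mem_uIcc)
  have hCg0 : 0 ≤ Cg := (norm_nonneg _).trans (hCg a Set.left_mem_uIcc)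
  rw [absolutelyContinuousOnInterval_iff] at hf hg ⊢
  intro ε hε
  obtain ⟨δ₁, hδ₁, H₁⟩ := hf (ε / 2 / (C * Cg + 1)) (by positivity)
  obtain ⟨δ₂, hδ₂, H₂⟩ := hg (ε / 2 / (C * Cf + 1)) (by positivity)
  refine ⟨min δ₁ δ₂, lt_min hδ₁ hδ₂, fun I hI hlt => ?_⟩
  have h1 := H₁ I hI (hlt.trans_le (min_le_left _ _))
  have h2 := H₂ I hI (hlt.trans_le (min_le_right _ _))
  have key : ∀ s ∈ Set.uIcc a b, ∀ t ∈ Set.uIcc a b,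
      dist (p (f s) (g s)) (p (f t) (g t)) ≤
        (C * Cg + 1) * dist (f s) (f t) + (C * Cf + 1) * dist (g s) (g t) := by
    intro s hs t ht
    have e : p (f s) (g s) - p (f t) (g t) = p (f s - f t) (g s) + p (f t) (g s - g t) := by
      rw [hl, hr]; abel
    rw [dist_eq_norm, dist_eq_norm, dist_eq_norm, e]
    refine (norm_add_le _ _).trans (add_le_add ((hp _ _).trans ?_) ((hp _ _).trans ?_))
    · have := hCg s hs
      calc C * ‖f s - f t‖ * ‖g s‖ ≤ C * ‖f s - f t‖ * Cg := by gcongr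
        _ ≤ (C * Cg + 1) * ‖f s - f t‖ := by nlinarith [norm_nonneg (f s - f t)]
    · have := hCf t ht
      calc C * ‖f t‖ * ‖g s - g t‖ ≤ C * Cf * ‖g s - g t‖ := by gcongr
        _ ≤ (C * Cf + 1) * ‖g s - g t‖ := by nlinarith [norm_nonneg (g s - g t)]
  calc _ ≤ ∑ i ∈ Finset.range I.1, ((C * Cg + 1) * dist (f (I.2 i).1) (f (I.2 i).2)
          + (C * Cf + 1) * dist (g (I.2 i).1) (g (I.2 i).2)) :=
        Finset.sum_le_sum fun i hi => key _ (hI.1 i hi).1 _ (hI.1 i hi).2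
    _ = (C * Cg + 1) * ∑ i ∈ Finset.range I.1, dist (f (I.2 i).1) (f (I.2 i).2)
          + (C * Cf + 1) * ∑ i ∈ Finset.range I.1, dist (g (I.2 i).1) (g (I.2 i).2) := by
        rw [Finset.sum_add_distrib, Finset.mul_sum, Finset.mul_sum]
    _ < (C * Cg + 1) * (ε / 2 / (C * Cg + 1)) + (C * Cf + 1) * (ε / 2 / (C * Cf + 1)) := by
        gcongr
    _ = ε := by
        have : C * Cg + 1 ≠ 0 := by positivity
        have : C * Cf + 1 ≠ 0 := by positivity
        field_simp
        ring

variable [NormedSpace ℝ E]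

/-- The indefinite integral of an integrable vector valued function is absolutely continuous. -/
theorem IntervalIntegrable.absolutelyContinuousOnInterval_integral {f : ℝ → E} {a b c : ℝ}
    (h : IntervalIntegrable f volume a b) (hc : c ∈ Set.uIcc a b) :
    AbsolutelyContinuousOnInterval (fun x => ∫ v in c..x, f v) a b := by
  refine (h.norm.absolutelyContinuousOnInterval_intervalIntegral hc).of_dist_le
    fun s hs t ht => ?_
  have hi : ∀ u ∈ Set.uIcc a b, IntervalIntegrable f volume c u := fun u hu =>
    h.mono_set (Set.uIcc_subset_uIcc hc hu)
  rw [dist_eq_norm, Real.dist_eq, intervalIntegral.integral_interval_sub_left (hi s hs) (hi t ht),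
    intervalIntegral.integral_interval_sub_left (hi s hs).norm (hi t ht).norm]
  exact intervalIntegral.norm_integral_le_abs_integral_norm

/-- Fundamental theorem of calculus for an absolutely continuous vector valued function with an
integrable a.e. derivative. -/
theorem AbsolutelyContinuousOnInterval.integral_eq_sub_of_ae_hasDerivAt [CompleteSpace E]
    {f f' : ℝ → E} {a b : ℝ}
    (hf : AbsolutelyContinuousOnInterval f a b)
    (hf' : ∀ᵐ x, x ∈ Set.uIcc a b → HasDerivAt f (f' x) x)
    (hi : IntervalIntegrable f' volume a b) :
    ∫ x in a..b, f' x = f b - f a := by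
  have hac := hf.sub (hi.absolutelyContinuousOnInterval_integral (c := a) Set.left_mem_uIcc)
  have hd : ∀ᵐ x, x ∈ Set.uIcc a b →
      HasDerivAt (f - fun x => ∫ v in a..x, f' v) 0 x := by
    filter_upwards [hf', hi.ae_hasDerivAt_integral] with x h1 h2 hx
    simpa using (h1 hx).sub (h2 hx a Set.left_mem_uIcc)
  obtain ⟨C, hC⟩ := hac.const_of_ae_hasDerivAt_zero hd
  have h1 := hC a Set.left_mem_uIcc
  have h2 := hC b Set.right_mem_uIcc
  simp only [Pi.sub_apply, intervalIntegral.integral_same, sub_zero] at h1 h2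
  rw [h1, ← h2]; abel

end AbsolutelyContinuous

/-! ### Exhaustion of a half-open interval by segments -/

section Exhaustion

variable {I : Set ℝ} {a : ℝ}

theorem Set.OrdConnected.exists_seq_subset_iUnion_Icc (hI : I.OrdConnected) (ha : IsLeast I a) :
    ∃ u : ℕ → ℝ, (∀ n, u n ∈ I) ∧ I ⊆ ⋃ n, Set.Icc a (u n) := by
  have : Nonempty I := ⟨⟨a, ha.1⟩⟩
  have : OrderTopology I := inferInstance
  obtain ⟨u, hu⟩ := Filter.exists_seq_tendsto (atTop : Filter I)
  refine ⟨fun n => u n, fun n => (u n).2, fun t ht => ?_⟩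
  obtain ⟨n, hn⟩ := (hu.eventually (eventually_ge_atTop (⟨t, ht⟩ : I))).exists
  exact Set.mem_iUnion.2 ⟨n, ha.2 ht, hn⟩

theorem ae_restrict_of_forall_Icc (hI : I.OrdConnected) (ha : IsLeast I a) {p : ℝ → Prop}
    (h : ∀ β ∈ I, ∀ᵐ t ∂(volume.restrict (Set.Icc a β)), p t) :
    ∀ᵐ t ∂(volume.restrict I), p t := by
  obtain ⟨u, hu, hIu⟩ := hI.exists_seq_subset_iUnion_Icc ha
  exact ae_restrict_of_ae_restrict_of_subset hIu
    ((ae_restrict_iUnion_iff _ _).2 fun n => h _ (hu n))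

theorem ae_restrict_Icc_of_ae_restrict (hI : I.OrdConnected) (ha : IsLeast I a) {p : ℝ → Prop}
    (h : ∀ᵐ t ∂(volume.restrict I), p t) {β : ℝ} (hβ : β ∈ I) :
    ∀ᵐ t ∂(volume.restrict (Set.Icc a β)), p t :=
  ae_restrict_of_ae_restrict_of_subset (hI.out ha.1 hβ) h

end Exhaustion

/-! ### Linear differential equations with locally integrable coefficients -/

section LinearODE

variable {A : Type*} [NormedRing A] [NormedAlgebra ℝ A]

/-- The terms of the Picard series of `Y' = M Y`, `Y(a) = 1`. -/
noncomputable def picardTerm (M : ℝ → A) (a : ℝ) : ℕ → ℝ → A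
  | 0 => fun _ => 1
  | n + 1 => fun t => ∫ s in a..t, M s * picardTerm M a n s

variable {M : ℝ → A} {a β : ℝ}

theorem continuousOn_picardTerm (hM : IntervalIntegrable M volume a β) (n : ℕ) :
    ContinuousOn (picardTerm M a n) (Set.uIcc a β) := by
  induction n with
  | zero => exact continuousOn_const
  | succ n ih =>
    exact ((hM.mul_continuousOn ih).absolutelyContinuousOnInterval_integral
      Set.left_mem_uIcc).continuousOn

/-- The fundamental solution of `Y' = M Y` with `Y(a) = 1`, as the sum of the Picard series. -/
noncomputable def fundSol (M : ℝ → A) (a t : ℝ) : A := ∑' n, picardTerm M a n t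

theorem fundSol_self : fundSol M a a = 1 := by
  rw [fundSol, tsum_eq_single 0]
  · rfl
  · intro n hn
    obtain ⟨k, rfl⟩ := Nat.exists_eq_succ_of_ne_zero hn
    simp [picardTerm]

/-- With `l(t) = ∫_a^t ‖M‖`, the `n`-th Picard term is bounded by `l(t)ⁿ / n!`. -/
theorem norm_picardTerm_le (hM : IntervalIntegrable M volume a β) (hab : a ≤ β)
    (n : ℕ) : ∀ t ∈ Set.Icc a β,
      ‖picardTerm M a n t‖ ≤ ‖(1 : A)‖ * ((∫ s in a..t, ‖M s‖) ^ n / n.factorial) := by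
  induction n with
  | zero => intro t _; simp [picardTerm]
  | succ n ih =>
    intro t ht
    set l : ℝ → ℝ := fun t => ∫ s in a..t, ‖M s‖ with hl
    have hsub : Set.uIcc a t ⊆ Set.uIcc a β := by
      rw [Set.uIcc_of_le ht.1, Set.uIcc_of_le hab]; exact Set.Icc_subset_Icc_right ht.2
    have hMt := hM.mono_set hsub
    have hlac : AbsolutelyContinuousOnInterval l a t :=
      hMt.norm.absolutelyContinuousOnInterval_integral Set.left_mem_uIcc
    have hpac : ∀ k : ℕ, AbsolutelyContinuousOnInterval (fun t => l t ^ k) a t := by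
      intro k
      induction k with
      | zero =>
        simp only [pow_zero]
        exact hlac.of_dist_le fun s _ t _ => by simp
      | succ k ihk => simpa only [pow_succ] using ihk.fun_mul hlac
    have hcl := (hpac n).continuousOn
    have hint : IntervalIntegrable (fun s => ‖M s‖ * (l s ^ n / n.factorial)) volume a t :=
      hMt.norm.mul_continuousOn (hcl.div_const _)
    have hftc : ∫ s in a..t, ‖M s‖ * (l s ^ n / n.factorial)
        = l t ^ (n + 1) / (n + 1).factorial := by
      have hac : AbsolutelyContinuousOnInterval
          (fun t => ((n + 1).factorial : ℝ)⁻¹ * l t ^ (n + 1)) a t :=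
        (hpac (n + 1)).const_mul _
      rw [hac.integral_eq_sub_of_ae_hasDerivAt _ hint]
      · simp [hl]; ring
      · filter_upwards [hMt.norm.ae_hasDerivAt_integral] with x hx hxt
        have := ((hx hxt a Set.left_mem_uIcc).pow (n + 1)).const_mul (((n + 1).factorial : ℝ)⁻¹)
        refine this.congr_deriv ?_
        have h1 : (n.factorial : ℝ) ≠ 0 := by positivity
        have h2 : (n : ℝ) + 1 ≠ 0 := by positivity
        rw [Nat.factorial_succ]
        push_cast
        field_simp
        simp only [hl]
        ring
    calc ‖picardTerm M a (n + 1) t‖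
        ≤ ∫ s in a..t, ‖(1 : A)‖ * (‖M s‖ * (l s ^ n / n.factorial)) := by
          refine intervalIntegral.norm_integral_le_of_norm_le ht.1 ?_ (hint.const_mul _)
          refine Eventually.of_forall fun s hs => (norm_mul_le _ _).trans ?_
          rw [mul_left_comm]
          gcongr
          exact ih s ⟨hs.1.le, hs.2.trans ht.2⟩
      _ = ‖(1 : A)‖ * (l t ^ (n + 1) / (n + 1).factorial) := by
          rw [intervalIntegral.integral_const_mul, hftc]

theorem norm_picardTerm_le_const (hM : IntervalIntegrable M volume a β) (hab : a ≤ β) (n : ℕ)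
    {t : ℝ} (ht : t ∈ Set.Icc a β) :
    ‖picardTerm M a n t‖ ≤ ‖(1 : A)‖ * ((∫ s in a..β, ‖M s‖) ^ n / n.factorial) := by
  refine (norm_picardTerm_le hM hab n t ht).trans ?_
  gcongr
  · exact intervalIntegral.integral_nonneg ht.1 fun _ _ => norm_nonneg _
  · exact intervalIntegral.integral_mono_interval le_rfl ht.1 ht.2
      (Eventually.of_forall fun _ => norm_nonneg _) hM.norm

variable [CompleteSpace A]

theorem continuousOn_fundSol (hM : IntervalIntegrable M volume a β) (hab : a ≤ β) :
    ContinuousOn (fundSol M a) (Set.Icc a β) :=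
  continuousOn_tsum (fun n => by simpa [hab] using continuousOn_picardTerm hM n)
    ((Real.summable_pow_div_factorial _).mul_left _)
    fun n _ ht => norm_picardTerm_le_const hM hab n ht

theorem fundSol_eq_integral (hM : IntervalIntegrable M volume a β) (hab : a ≤ β) :
    fundSol M a β = 1 + ∫ s in a..β, M s * fundSol M a s := by
  have hs : ∀ t ∈ Set.Icc a β, HasSum (fun n => picardTerm M a n t) (fundSol M a t) :=
    fun t ht => (Summable.of_norm_bounded ((Real.summable_pow_div_factorial _).mul_left _)
      fun n => norm_picardTerm_le_const hM hab n ht).hasSum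
  have h1 : HasSum (fun n => ∫ s in a..β, M s * picardTerm M a n s)
      (∫ s in a..β, M s * fundSol M a s) := by
    refine intervalIntegral.hasSum_integral_of_dominated_convergence
      (fun n s => ‖M s‖ * (‖(1 : A)‖ * ((∫ s in a..β, ‖M s‖) ^ n / n.factorial)))
      (fun n => ?_) (fun n => ?_) ?_ ?_ ?_
    · exact ((hM.mul_continuousOn (continuousOn_picardTerm hM n)).def'.aestronglyMeasurable)
    · refine Eventually.of_forall fun s hs => (norm_mul_le _ _).trans ?_
      rw [Set.uIoc_of_le hab] at hs
      gcongr
      exact norm_picardTerm_le_const hM hab n ⟨hs.1.le, hs.2⟩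
    · exact Eventually.of_forall fun s _ =>
        ((Real.summable_pow_div_factorial _).mul_left _).mul_left _
    · simp only [tsum_mul_left]
      exact hM.norm.mul_const _
    · refine Eventually.of_forall fun s hs' => ?_
      rw [Set.uIoc_of_le hab] at hs'
      exact (hs s ⟨hs'.1.le, hs'.2⟩).mul_left _
  have h2 := (hasSum_nat_add_iff' 1).2 (hs β ⟨hab, le_rfl⟩)
  have h3 := h2.unique h1
  rw [← h3]
  simp [picardTerm]

theorem intervalIntegrable_mul_fundSol (hM : IntervalIntegrable M volume a β) (hab : a ≤ β) :
    IntervalIntegrable (fun s => M s * fundSol M a s) volume a β :=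
  hM.mul_continuousOn (by simpa [hab] using continuousOn_fundSol hM hab)

theorem absolutelyContinuousOnInterval_fundSol (hM : IntervalIntegrable M volume a β)
    (hab : a ≤ β) : AbsolutelyContinuousOnInterval (fundSol M a) a β := by
  refine ((intervalIntegrable_mul_fundSol hM hab).absolutelyContinuousOnInterval_integral
    Set.left_mem_uIcc).of_dist_le fun s hs t ht => ?_
  have : ∀ t ∈ Set.uIcc a β, fundSol M a t = 1 + ∫ s in a..t, M s * fundSol M a s := by
    intro t ht
    rw [Set.uIcc_of_le hab] at ht
    refine fundSol_eq_integral (hM.mono_set ?_) ht.1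
    rw [Set.uIcc_of_le hab, Set.uIcc_of_le ht.1]
    exact Set.Icc_subset_Icc_right ht.2
  rw [this s hs, this t ht, dist_add_left]

theorem ae_hasDerivAt_fundSol (hM : IntervalIntegrable M volume a β) (hab : a ≤ β) :
    ∀ᵐ t, t ∈ Set.Icc a β → HasDerivAt (fundSol M a) (M t * fundSol M a t) t := by
  have h1 : ∀ᵐ x : ℝ, x ≠ a := by simp [ae_iff, measure_singleton]
  have h2 : ∀ᵐ x : ℝ, x ≠ β := by simp [ae_iff, measure_singleton]
  filter_upwards [h1, h2, (intervalIntegrable_mul_fundSol hM hab).ae_hasDerivAt_integral]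
    with t hta htb ht htm
  have h := (ht (by rwa [Set.uIcc_of_le hab]) a Set.left_mem_uIcc).const_add (1 : A)
  refine h.congr_of_eventuallyEq ?_
  filter_upwards [Icc_mem_nhds (lt_of_le_of_ne htm.1 hta.symm) (lt_of_le_of_ne htm.2 htb)]
    with s hs
  refine fundSol_eq_integral (hM.mono_set ?_) hs.1
  rw [Set.uIcc_of_le hab, Set.uIcc_of_le hs.1]
  exact Set.Icc_subset_Icc_right hs.2

end LinearODE

namespace SymmSys

variable {H K : Type*}
  [NormedAddCommGroup H] [InnerProductSpace ℂ H] [FiniteDimensional ℂ H]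
  [NormedAddCommGroup K] [InnerProductSpace ℂ K] [FiniteDimensional ℂ K]

/-! ### The signature operator and the Lagrange identity -/

theorem J_apply (y : HBold H K) :
    J H K y = WithLp.toLp 2 (WithLp.toLp 2 (-y.snd, Complex.I • y.fst.snd), y.fst.fst) := rfl

@[simp]
theorem J_J (y : HBold H K) : J H K (J H K y) = -y := by
  refine WithLp.ofLp_injective 2 (Prod.ext (WithLp.ofLp_injective 2 (Prod.ext ?_ ?_)) ?_) <;>
    simp [J_apply, smul_smul]

theorem inner_J_right (x y : HBold H K) :
    (inner ℂ x (J H K y) : ℂ) = inner ℂ x.snd y.fst.fst - inner ℂ x.fst.fst y.snd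
      + Complex.I * inner ℂ x.fst.snd y.fst.snd := by
  simp only [J_apply, WithLp.prod_inner_apply, inner_neg_right, inner_smul_right, WithLp.ofLp_fst,
    WithLp.ofLp_snd]
  ring

theorem inner_J_left (x y : HBold H K) :
    (inner ℂ (J H K x) y : ℂ) = -inner ℂ x (J H K y) := by
  rw [← inner_conj_symm, inner_J_right, inner_J_right]
  simp only [map_add, map_sub, map_mul, inner_conj_symm, Complex.conj_I]
  ring

theorem IsJUnitary.inner_J {U : HBold H K →L[ℂ] HBold H K} (hU : IsJUnitary U)
    (x y : HBold H K) :
    (inner ℂ (U x) (J H K (U y)) : ℂ) = inner ℂ x (J H K y) := by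
  rw [← ContinuousLinearMap.adjoint_inner_right]
  exact congrArg (inner ℂ x) (DFunLike.congr_fun hU y)

theorem IsJUnitary.surjective {U : HBold H K →L[ℂ] HBold H K} (hU : IsJUnitary U) :
    Function.Surjective U := by
  have hinj : Function.Injective (U : HBold H K →ₗ[ℂ] HBold H K) := by
    rw [injective_iff_map_eq_zero]
    intro x hx
    have h := hU.inner_J (J H K x) x
    have hx' : U x = 0 := hx
    rw [hx', map_zero, inner_zero_right] at h
    have hz := inner_self_eq_zero.1 h.symm
    simpa [hz] using J_J x
  exact LinearMap.injective_iff_surjective.1 hinj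

/-! ### Integrability and absolute continuity of products -/

section Integrability

variable {V : Type*} [NormedAddCommGroup V] [InnerProductSpace ℂ V]

theorem integrableOn_inner_of_continuousOn {a β : ℝ} {z g : ℝ → V}
    (hz : ContinuousOn z (Set.Icc a β)) (hg : IntegrableOn g (Set.Icc a β)) :
    IntegrableOn (fun t => (inner ℂ (z t) (g t) : ℂ)) (Set.Icc a β) := by
  obtain ⟨C, hC⟩ := isCompact_Icc.exists_bound_of_continuousOn hz
  refine Integrable.mono' (hg.norm.const_mul C)
    ((hz.aestronglyMeasurable measurableSet_Icc).inner hg.aestronglyMeasurable) ?_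
  filter_upwards [ae_restrict_mem measurableSet_Icc] with t ht
  refine (norm_inner_le_norm _ _).trans ?_
  gcongr
  exact hC t ht

theorem integrableOn_clm_apply_of_continuousOn {W : Type*} [NormedAddCommGroup W]
    [NormedSpace ℂ W] {a β : ℝ} {M : ℝ → V →L[ℂ] W} {z : ℝ → V}
    (hM : IntegrableOn M (Set.Icc a β)) (hz : ContinuousOn z (Set.Icc a β)) :
    IntegrableOn (fun t => M t (z t)) (Set.Icc a β) := by
  obtain ⟨C, hC⟩ := isCompact_Icc.exists_bound_of_continuousOn hz
  refine Integrable.mono' (hM.norm.mul_const C) ?_ ?_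
  · exact (ContinuousLinearMap.id ℂ (V →L[ℂ] W)).aestronglyMeasurable_comp₂
      hM.aestronglyMeasurable (hz.aestronglyMeasurable measurableSet_Icc)
  · filter_upwards [ae_restrict_mem measurableSet_Icc] with t ht
    refine ((M t).le_opNorm _).trans ?_
    gcongr
    exact hC t ht

theorem integrableOn_adjoint_apply_of_continuousOn [CompleteSpace V] {a β : ℝ}
    {M : ℝ → V →L[ℂ] V} {g : ℝ → V}
    (hM : ContinuousOn M (Set.Icc a β)) (hg : IntegrableOn g (Set.Icc a β)) :
    IntegrableOn (fun t => ContinuousLinearMap.adjoint (M t) (g t)) (Set.Icc a β) := by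
  obtain ⟨C, hC⟩ := isCompact_Icc.exists_bound_of_continuousOn hM
  have hc' : ContinuousOn (fun t => ContinuousLinearMap.adjoint (M t)) (Set.Icc a β) :=
    (ContinuousLinearMap.adjoint (𝕜 := ℂ) (E := V) (F := V)).continuous.comp_continuousOn hM
  refine Integrable.mono' (hg.norm.const_mul C) ?_ ?_
  · exact (ContinuousLinearMap.id ℂ (V →L[ℂ] V)).aestronglyMeasurable_comp₂
      (hc'.aestronglyMeasurable measurableSet_Icc) hg.aestronglyMeasurable
  · filter_upwards [ae_restrict_mem measurableSet_Icc] with t ht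
    refine (ContinuousLinearMap.le_opNorm _ _).trans ?_
    gcongr
    rw [LinearIsometryEquiv.norm_map]
    exact hC t ht

theorem integrableOn_clm_comp (T : V →L[ℂ] V) {M : ℝ → V →L[ℂ] V} {s : Set ℝ}
    (hM : IntegrableOn M s) : IntegrableOn (fun t => T ∘L M t) s :=
  (ContinuousLinearMap.compL ℂ V V V T).integrable_comp hM

/-- The product rule for an operator function applied to a vector function. -/
theorem hasDerivAt_clm_apply_real {M : ℝ → V →L[ℂ] V} {M' : V →L[ℂ] V} {k : ℝ → V} {k' : V}
    {t : ℝ} (hM : HasDerivAt M M' t) (hk : HasDerivAt k k' t) :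
    HasDerivAt (fun t => M t (k t)) (M' (k t) + M t k') t :=
  (((ContinuousLinearMap.restrictScalarsL ℂ V V ℝ ℝ).hasFDerivAt (x := M t)).comp_hasDerivAt t
    hM).clm_apply hk

theorem absolutelyContinuousOnInterval_clm_apply {M : ℝ → V →L[ℂ] V} {k : ℝ → V} {a β : ℝ}
    (hM : AbsolutelyContinuousOnInterval M a β) (hk : AbsolutelyContinuousOnInterval k a β) :
    AbsolutelyContinuousOnInterval (fun t => M t (k t)) a β :=
  hM.biadditive hk (p := fun M x => M x) zero_le_one
    (fun M x => by rw [one_mul]; exact M.le_opNorm x) (fun M M' x => rfl)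
    (fun M x y => map_sub M x y)

theorem absolutelyContinuousOnInterval_const {X : Type*} [PseudoMetricSpace X] (c : X)
    (a β : ℝ) : AbsolutelyContinuousOnInterval (fun _ : ℝ => c) a β := by
  simpa [AbsolutelyContinuousOnInterval] using tendsto_const_nhds

end Integrability

theorem LocAC.continuousOn_Icc {X : Type*} [NormedAddCommGroup X] {I : Set ℝ} {a β : ℝ}
    {y : ℝ → X} (hy : LocAC I a y) (hβ : β ∈ I) (hab : a ≤ β) : ContinuousOn y (Set.Icc a β) := by
  have h : AbsolutelyContinuousOnInterval y a β := hy β hβ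
  have h' := h.continuousOn
  rwa [Set.uIcc_of_le hab] at h'

namespace SymmetricSystem

variable (S : SymmetricSystem H K)

variable {S} in
theorem Icc_subset {β : ℝ} (hβ : β ∈ S.I) : Set.Icc S.a β ⊆ S.I :=
  S.ordConnected.out S.isLeast.1 hβ

/-- The Lagrange identity on a segment. -/
theorem lagrange {y z g k : ℝ → HBold H K} (hy : SolvesOn S.I S.a S.B y g)
    (hz : SolvesOn S.I S.a S.B z k) {β : ℝ} (hβ : β ∈ S.I)
    (hg : IntegrableOn g (Set.Icc S.a β)) (hk : IntegrableOn k (Set.Icc S.a β)) :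
    (inner ℂ (z β) (J H K (y β)) : ℂ) - inner ℂ (z S.a) (J H K (y S.a)) =
      ∫ t in Set.Icc S.a β, ((inner ℂ (z t) (g t) : ℂ) - inner ℂ (k t) (y t)) := by
  have hab : S.a ≤ β := S.isLeast.2 hβ
  have hcy := hy.1.continuousOn_Icc hβ hab
  have hcz := hz.1.continuousOn_Icc hβ hab
  have hac : AbsolutelyContinuousOnInterval
      (fun t => (inner ℂ (z t) (J H K (y t)) : ℂ)) S.a β := by
    refine (hz.1 β hβ).biadditive (hy.1 β hβ) (p := fun x y => (inner ℂ x (J H K y) : ℂ))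
      (norm_nonneg (J H K)) (fun x y => ?_) (fun x x' y => inner_sub_left _ _ _)
      (fun x y y' => by rw [map_sub, inner_sub_right])
    calc ‖(inner ℂ x (J H K y) : ℂ)‖ ≤ ‖x‖ * (‖J H K‖ * ‖y‖) :=
          (norm_inner_le_norm _ _).trans (by gcongr; exact (J H K).le_opNorm _)
      _ = ‖J H K‖ * ‖x‖ * ‖y‖ := by ring
  have hint : IntegrableOn (fun t => (inner ℂ (z t) (g t) : ℂ) - inner ℂ (k t) (y t))
      (Set.Icc S.a β) := by
    refine (integrableOn_inner_of_continuousOn hcz hg).sub ?_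
    refine ((Complex.conjCLE : ℂ →L[ℝ] ℂ).integrable_comp
      (integrableOn_inner_of_continuousOn hcy hk)).congr (Eventually.of_forall fun t => ?_)
    exact inner_conj_symm (k t) (y t)
  have hd : ∀ᵐ t, t ∈ Set.uIcc S.a β → HasDerivAt (fun t => (inner ℂ (z t) (J H K (y t)) : ℂ))
      ((inner ℂ (z t) (g t) : ℂ) - inner ℂ (k t) (y t)) t := by
    have h1 := (ae_restrict_iff' S.measurableSet_I).1 hy.2
    have h2 := (ae_restrict_iff' S.measurableSet_I).1 hz.2
    have h3 := (ae_restrict_iff' S.measurableSet_I).1 S.selfAdjoint_B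
    filter_upwards [h1, h2, h3] with t h1 h2 h3 ht
    rw [Set.uIcc_of_le hab] at ht
    have htI := Icc_subset hβ ht
    obtain ⟨y', hy', ey⟩ := h1 htI
    obtain ⟨z', hz', ez⟩ := h2 htI
    have hJ : HasDerivAt (fun t => J H K (y t)) (J H K y') t :=
      ((J H K).restrictScalars ℝ).hasFDerivAt.comp_hasDerivAt t hy'
    refine (hz'.inner ℂ hJ).congr_deriv ?_
    have e1 : J H K y' = S.B t (y t) + g t := by rw [← ey]; abel
    have e2 : J H K z' = S.B t (z t) + k t := by rw [← ez]; abel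
    have e3 : (inner ℂ z' (J H K (y t)) : ℂ) = -inner ℂ (J H K z') (y t) := by
      rw [inner_J_left, neg_neg]
    have e4 : (inner ℂ (S.B t (z t)) (y t) : ℂ) = inner ℂ (z t) (S.B t (y t)) := by
      have := ContinuousLinearMap.adjoint_inner_left (S.B t) (y t) (z t)
      rwa [(ContinuousLinearMap.isSelfAdjoint_iff'.1 (h3 htI))] at this
    rw [e3, e1, e2, inner_add_right, inner_add_left, e4]
    ring
  have := hac.integral_eq_sub_of_ae_hasDerivAt hd
    ((intervalIntegrable_iff_integrableOn_Icc_of_le hab).2 hint)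
  rw [← this, intervalIntegral.integral_of_le hab, integral_Icc_eq_integral_Ioc]

/-! ### Solutions of the inhomogeneous system -/

/-- The coefficient of the homogeneous system `y' = -J B y`. -/
noncomputable def coeff (t : ℝ) : HBold H K →L[ℂ] HBold H K := -(J H K ∘L S.B t)

variable {S} in
theorem intervalIntegrable_coeff {β : ℝ} (hβ : β ∈ S.I) :
    IntervalIntegrable S.coeff volume S.a β := by
  rw [intervalIntegrable_iff_integrableOn_Icc_of_le (S.isLeast.2 hβ)]
  exact (integrableOn_clm_comp _ (S.integrable_B β hβ)).neg

/-- The fundamental solution of `J y' - B y = 0` with `Φ(a) = 1`. -/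
noncomputable def fund (t : ℝ) : HBold H K →L[ℂ] HBold H K := fundSol S.coeff S.a t

@[simp]
theorem fund_a : S.fund S.a = 1 := fundSol_self

theorem locAC_fund : LocAC S.I S.a S.fund := fun _ hβ =>
  absolutelyContinuousOnInterval_fundSol (intervalIntegrable_coeff hβ) (S.isLeast.2 hβ)

theorem ae_hasDerivAt_fund :
    ∀ᵐ t ∂(volume.restrict S.I), HasDerivAt S.fund (S.coeff t * S.fund t) t :=
  ae_restrict_of_forall_Icc S.ordConnected S.isLeast fun _ hβ =>
    (ae_restrict_iff' measurableSet_Icc).2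
      (ae_hasDerivAt_fundSol (intervalIntegrable_coeff hβ) (S.isLeast.2 hβ))

theorem solvesOn_fund (c : HBold H K) : SolvesOn S.I S.a S.B (fun t => S.fund t c) 0 := by
  refine ⟨fun β hβ => absolutelyContinuousOnInterval_clm_apply (S.locAC_fund β hβ)
    (absolutelyContinuousOnInterval_const c _ _), ?_⟩
  filter_upwards [S.ae_hasDerivAt_fund] with t ht
  refine ⟨_, hasDerivAt_clm_apply_real ht (hasDerivAt_const t c), ?_⟩
  simp [coeff]

/-- The fundamental solution is `J`-unitary: this is the Lagrange identity for two solutions of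
the homogeneous system. -/
theorem inner_fund_J_fund {t : ℝ} (ht : t ∈ S.I) (c d : HBold H K) :
    (inner ℂ (S.fund t c) (J H K (S.fund t d)) : ℂ) = inner ℂ c (J H K d) := by
  have h := S.lagrange (S.solvesOn_fund d) (S.solvesOn_fund c) ht
    (integrableOn_zero) (integrableOn_zero)
  simpa [sub_eq_zero] using h

theorem adjoint_fund_J_fund {t : ℝ} (ht : t ∈ S.I) (d : HBold H K) :
    ContinuousLinearMap.adjoint (S.fund t) (J H K (S.fund t d)) = J H K d := by
  refine ext_inner_left ℂ fun c => ?_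
  rw [ContinuousLinearMap.adjoint_inner_right, S.inner_fund_J_fund ht]

theorem fund_surjective {t : ℝ} (ht : t ∈ S.I) : Function.Surjective (S.fund t) :=
  IsJUnitary.surjective (U := S.fund t) (by ext1 d; exact S.adjoint_fund_J_fund ht d)

/-- Since `Φ* J Φ = J`, also `Φ J Φ* = J`. -/
theorem fund_J_adjoint_fund {t : ℝ} (ht : t ∈ S.I) (x : HBold H K) :
    S.fund t (J H K (ContinuousLinearMap.adjoint (S.fund t) x)) = J H K x := by
  obtain ⟨d, hd⟩ := S.fund_surjective ht (J H K x)
  have hx : x = -J H K (S.fund t d) := by rw [hd, J_J, neg_neg]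
  rw [hx, map_neg, S.adjoint_fund_J_fund ht, map_neg, map_neg, map_neg, J_J, J_J, map_neg]

/-- The integrand `-J Φ* g` of the variation of constants formula. -/
noncomputable def varConst (g : ℝ → HBold H K) (t : ℝ) : HBold H K :=
  -J H K (ContinuousLinearMap.adjoint (S.fund t) (g t))

theorem integrableOn_adjoint_fund {g : ℝ → HBold H K} {β : ℝ} (hβ : β ∈ S.I)
    (hg : IntegrableOn g (Set.Icc S.a β)) :
    IntegrableOn (fun t => ContinuousLinearMap.adjoint (S.fund t) (g t)) (Set.Icc S.a β) :=
  integrableOn_adjoint_apply_of_continuousOn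
    (S.locAC_fund.continuousOn_Icc hβ (S.isLeast.2 hβ)) hg

theorem intervalIntegrable_varConst {g : ℝ → HBold H K} {β : ℝ} (hβ : β ∈ S.I)
    (hg : IntegrableOn g (Set.Icc S.a β)) : IntervalIntegrable (S.varConst g) volume S.a β := by
  rw [intervalIntegrable_iff_integrableOn_Icc_of_le (S.isLeast.2 hβ)]
  exact ((J H K).integrable_comp (S.integrableOn_adjoint_fund hβ hg)).neg

/-- The solution of `J y' - B y = g` with `y(a) = c`, by variation of constants. -/
noncomputable def sol (c : HBold H K) (g : ℝ → HBold H K) (t : ℝ) : HBold H K :=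
  S.fund t (c + ∫ s in S.a..t, S.varConst g s)

@[simp]
theorem sol_a (c : HBold H K) (g : ℝ → HBold H K) : S.sol c g S.a = c := by simp [sol]

theorem solvesOn_sol (c : HBold H K) {g : ℝ → HBold H K}
    (hg : ∀ β ∈ S.I, IntegrableOn g (Set.Icc S.a β)) :
    SolvesOn S.I S.a S.B (S.sol c g) g := by
  constructor
  · intro β hβ
    have h1 : AbsolutelyContinuousOnInterval (fun t => c + ∫ s in S.a..t, S.varConst g s) S.a β :=
      ((S.intervalIntegrable_varConst hβ (hg β hβ)).absolutelyContinuousOnInterval_integral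
        Set.left_mem_uIcc).of_dist_le fun s _ t _ => by rw [dist_add_left]
    exact absolutelyContinuousOnInterval_clm_apply (S.locAC_fund β hβ) h1
  · have h1 : ∀ᵐ t ∂(volume.restrict S.I),
        HasDerivAt (fun t => ∫ s in S.a..t, S.varConst g s) (S.varConst g t) t := by
      refine ae_restrict_of_forall_Icc S.ordConnected S.isLeast fun β hβ => ?_
      rw [ae_restrict_iff' measurableSet_Icc]
      filter_upwards [(S.intervalIntegrable_varConst hβ (hg β hβ)).ae_hasDerivAt_integral]
        with t ht hm
      exact ht (by rwa [Set.uIcc_of_le (S.isLeast.2 hβ)]) _ Set.left_mem_uIcc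
    filter_upwards [h1, S.ae_hasDerivAt_fund, ae_restrict_mem S.measurableSet_I] with t h1 h2 hI
    refine ⟨_, hasDerivAt_clm_apply_real h2 (h1.const_add c), ?_⟩
    have e := S.fund_J_adjoint_fund hI (g t)
    simp only [varConst, map_add, map_neg, e, coeff,
      mul_apply_eq_comp, neg_apply,
      ContinuousLinearMap.comp_apply, J_J, sol]
    abel

end SymmetricSystem

end SymmSys

/-! ### Square roots of positive operators -/

section OperatorSqrt

variable {V : Type*} [NormedAddCommGroup V] [InnerProductSpace ℂ V] [CompleteSpace V]

/-- The square root of `|A|`; it is a continuous function of the operator `A`, and the positive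
square root of `A` if `A ≥ 0`. -/
noncomputable def opSqrt (A : V →L[ℂ] V) : V →L[ℂ] V := CFC.sqrt (CFC.abs A)

theorem continuous_opSqrt : Continuous (opSqrt : (V →L[ℂ] V) → V →L[ℂ] V) :=
  CFC.continuousOn_sqrt.comp_continuous CFC.continuous_abs fun A => CFC.abs_nonneg A

theorem inner_opSqrt_left (A : V →L[ℂ] V) (x y : V) :
    (inner ℂ (opSqrt A x) y : ℂ) = inner ℂ x (opSqrt A y) :=
  ((ContinuousLinearMap.nonneg_iff_isPositive _).1 (CFC.sqrt_nonneg (CFC.abs A))).isSymmetric x y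

theorem opSqrt_mul_self {A : V →L[ℂ] V} (hA : A.IsPositive) : opSqrt A * opSqrt A = A := by
  have h0 : 0 ≤ A := (ContinuousLinearMap.nonneg_iff_isPositive _).2 hA
  rw [opSqrt, CFC.abs_of_nonneg A h0, CFC.sqrt_mul_sqrt_self A h0]

theorem opSqrt_opSqrt {A : V →L[ℂ] V} (hA : A.IsPositive) (x : V) :
    opSqrt A (opSqrt A x) = A x :=
  DFunLike.congr_fun (opSqrt_mul_self hA) x

theorem inner_opSqrt_opSqrt {A : V →L[ℂ] V} (hA : A.IsPositive) (x y : V) :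
    (inner ℂ (opSqrt A x) (opSqrt A y) : ℂ) = inner ℂ x (A y) := by
  rw [inner_opSqrt_left, opSqrt_opSqrt hA]

theorem norm_opSqrt_sq {A : V →L[ℂ] V} (hA : A.IsPositive) : ‖opSqrt A‖ ^ 2 = ‖A‖ := by
  have h : star (opSqrt A) = opSqrt A := (CFC.sqrt_nonneg (CFC.abs A)).isSelfAdjoint
  have := CStarRing.norm_star_mul_self (x := opSqrt A)
  rw [h, opSqrt_mul_self hA] at this
  rw [this, sq]

theorem MeasureTheory.AEStronglyMeasurable.clm_apply_apply {α : Type*} [MeasurableSpace α]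
    {μ : Measure α} {M : α → V →L[ℂ] V} {f : α → V} (hM : AEStronglyMeasurable M μ)
    (hf : AEStronglyMeasurable f μ) : AEStronglyMeasurable (fun t => M t (f t)) μ :=
  (ContinuousLinearMap.id ℂ (V →L[ℂ] V)).aestronglyMeasurable_comp₂ hM hf

end OperatorSqrt

namespace SymmSys

variable {H K : Type*}
  [NormedAddCommGroup H] [InnerProductSpace ℂ H] [FiniteDimensional ℂ H]
  [NormedAddCommGroup K] [InnerProductSpace ℂ K] [FiniteDimensional ℂ K]

namespace SymmetricSystem

variable (S : SymmetricSystem H K)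

/-! ### The embedding of `L²_Δ(I)` into the unweighted `L²`-space -/

/-- The square root of the weight. -/
noncomputable def root (t : ℝ) : HBold H K →L[ℂ] HBold H K := opSqrt (S.Δ t)

theorem aestronglyMeasurable_root : AEStronglyMeasurable S.root (volume.restrict S.I) :=
  continuous_opSqrt.comp_aestronglyMeasurable S.aestronglyMeasurable_Δ

/-- The unweighted space `L²(I; 𝐇)`. -/
noncomputable abbrev LTwo := Lp (HBold H K) 2 (volume.restrict S.I)

variable {S} in
theorem memLp_root {f : ℝ → HBold H K} (hf : f ∈ S.L2) :
    MemLp (fun t => S.root t (f t)) 2 (volume.restrict S.I) := by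
  rw [memLp_two_iff_integrable_sq_norm (S.aestronglyMeasurable_root.clm_apply_apply hf.1)]
  refine hf.2.re.congr ?_
  filter_upwards [S.nonneg_Δ] with t ht
  rw [root, ← inner_opSqrt_opSqrt ht, inner_self_eq_norm_sq]

variable {S} in
theorem mem_L2_of_memLp_root {f : ℝ → HBold H K}
    (hm : AEStronglyMeasurable f (volume.restrict S.I))
    (hf : MemLp (fun t => S.root t (f t)) 2 (volume.restrict S.I)) : f ∈ S.L2 := by
  refine ⟨hm, ?_⟩
  refine ((memLp_two_iff_integrable_sq_norm hf.1).1 hf).ofReal.congr ?_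
  filter_upwards [S.nonneg_Δ] with t ht
  rw [← inner_opSqrt_opSqrt ht, inner_self_eq_norm_sq_to_K]
  simp [root]

/-- The isometric map `f ↦ Δ^{1/2} f` from `ℒ²_Δ(I)` to `L²(I; 𝐇)`. -/
noncomputable def emb : S.L2 →ₗ[ℂ] S.LTwo where
  toFun f := (memLp_root f.2).toLp _
  map_add' f g := by
    rw [← MemLp.toLp_add]
    refine MemLp.toLp_congr _ _ (Eventually.of_forall fun t => ?_)
    simp
  map_smul' c f := by
    rw [RingHom.id_apply, ← MemLp.toLp_const_smul]
    refine MemLp.toLp_congr _ _ (Eventually.of_forall fun t => ?_)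
    simp

theorem coeFn_emb (f : S.L2) :
    S.emb f =ᵐ[volume.restrict S.I] fun t => S.root t ((f : ℝ → HBold H K) t) :=
  MemLp.coeFn_toLp (memLp_root f.2)

theorem inner_emb_emb (f g : S.L2) : (inner ℂ (S.emb g) (S.emb f) : ℂ) = S.form f g := by
  rw [L2.inner_def, form]
  refine integral_congr_ae ?_
  filter_upwards [S.coeFn_emb f, S.coeFn_emb g, S.nonneg_Δ] with t h1 h2 h3
  rw [h1, h2, root, inner_opSqrt_opSqrt h3]

theorem inner_left_emb (h : S.LTwo) (f : S.L2) :
    (inner ℂ h (S.emb f) : ℂ) = ∫ t in S.I, inner ℂ (S.root t (h t)) ((f : ℝ → HBold H K) t) := by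
  rw [L2.inner_def]
  refine integral_congr_ae ?_
  filter_upwards [S.coeFn_emb f] with t h1
  rw [h1, root, inner_opSqrt_left]

theorem integrable_inner_root (h : S.LTwo) (f : S.L2) :
    IntegrableOn (fun t => (inner ℂ (S.root t (h t)) ((f : ℝ → HBold H K) t) : ℂ)) S.I := by
  refine (L2.integrable_inner (𝕜 := ℂ) h (S.emb f)).congr ?_
  filter_upwards [S.coeFn_emb f] with t h1
  rw [h1, root, inner_opSqrt_left]

theorem conj_form {f g : ℝ → HBold H K} : (starRingEnd ℂ) (S.form f g) = S.form g f := by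
  rw [form, form, ← integral_conj]
  refine integral_congr_ae ?_
  filter_upwards [S.nonneg_Δ] with t ht
  rw [inner_conj_symm]
  exact ht.isSymmetric _ _

/-- `Δ^{1/2} h` is integrable on segments for `h ∈ L²(I; 𝐇)`. -/
theorem integrableOn_root {h : ℝ → HBold H K} (hh : MemLp h 2 (volume.restrict S.I)) {β : ℝ}
    (hβ : β ∈ S.I) : IntegrableOn (fun t => S.root t (h t)) (Set.Icc S.a β) := by
  have hsub := Icc_subset hβ
  have h1 : IntegrableOn (fun t => ‖h t‖ ^ 2) (Set.Icc S.a β) :=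
    ((memLp_two_iff_integrable_sq_norm hh.1).1 hh).mono_measure (Measure.restrict_mono hsub le_rfl)
  refine Integrable.mono' (h1.add (S.integrable_Δ β hβ).norm)
    ((S.aestronglyMeasurable_root.clm_apply_apply hh.1).mono_measure
      (Measure.restrict_mono hsub le_rfl)) ?_
  filter_upwards [ae_restrict_of_ae_restrict_of_subset hsub S.nonneg_Δ] with t ht
  refine (ContinuousLinearMap.le_opNorm _ _).trans ?_
  have := norm_opSqrt_sq ht
  simp only [Pi.add_apply, ← this, root]
  nlinarith [sq_nonneg (‖opSqrt (S.Δ t)‖ - ‖h t‖), norm_nonneg (h t)]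

theorem ae_root_root (f : ℝ → HBold H K) : ∀ᵐ t ∂(volume.restrict S.I),
    S.root t (S.root t (f t)) = S.Δ t (f t) := by
  filter_upwards [S.nonneg_Δ] with t ht
  exact opSqrt_opSqrt ht _

theorem integrableOn_Δ_apply {f : ℝ → HBold H K} (hf : f ∈ S.L2) {β : ℝ} (hβ : β ∈ S.I) :
    IntegrableOn (fun t => S.Δ t (f t)) (Set.Icc S.a β) :=
  (S.integrableOn_root (memLp_root hf) hβ).congr
    (ae_restrict_of_ae_restrict_of_subset (Icc_subset hβ) (S.ae_root_root f))

theorem aestronglyMeasurable_of_continuousOn {X : Type*} [TopologicalSpace X]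
    [TopologicalSpace.PseudoMetrizableSpace X] [SecondCountableTopology X] {y : ℝ → X}
    (hy : ∀ β ∈ S.I, ContinuousOn y (Set.Icc S.a β)) :
    AEStronglyMeasurable y (volume.restrict S.I) := by
  obtain ⟨u, hu, hIu⟩ := S.ordConnected.exists_seq_subset_iUnion_Icc S.isLeast
  have h : AEStronglyMeasurable y (volume.restrict (⋃ n, Set.Icc S.a (u n))) :=
    AEStronglyMeasurable.iUnion fun n => (hy _ (hu n)).aestronglyMeasurable measurableSet_Icc
  exact h.mono_measure (Measure.restrict_mono hIu le_rfl)

variable {S} in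
theorem _root_.SymmSys.SolvesOn.continuousOn {B : ℝ → HBold H K →L[ℂ] HBold H K}
    {y g : ℝ → HBold H K} (hy : SolvesOn S.I S.a B y g) {β : ℝ}
    (hβ : β ∈ S.I) : ContinuousOn y (Set.Icc S.a β) :=
  hy.1.continuousOn_Icc hβ (S.isLeast.2 hβ)

/-! ### Green's identity -/

instance : S.endFilter.NeBot := by
  have : Nonempty S.I := ⟨⟨S.a, S.isLeast.1⟩⟩
  exact Filter.map_neBot

theorem eventually_endFilter_ge {β : ℝ} (hβ : β ∈ S.I) :
    ∀ᶠ t in S.endFilter, β ≤ t ∧ t ∈ S.I := by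
  refine Filter.eventually_map.2 ?_
  filter_upwards [eventually_ge_atTop (⟨β, hβ⟩ : S.I)] with t ht
  exact ⟨ht, t.2⟩

theorem tendsto_setIntegral_endFilter {f : ℝ → ℂ} (hf : IntegrableOn f S.I) :
    Tendsto (fun β => ∫ t in Set.Icc S.a β, f t) S.endFilter (𝓝 (∫ t in S.I, f t)) := by
  have hU : ⋃ β : S.I, Set.Icc S.a (β : ℝ) = S.I := by
    refine Set.Subset.antisymm (Set.iUnion_subset fun β => Icc_subset β.2) fun t ht => ?_
    exact Set.mem_iUnion.2 ⟨⟨t, ht⟩, S.isLeast.2 ht, le_rfl⟩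
  have := S.ordConnected
  have h := tendsto_setIntegral_of_monotone (μ := volume) (f := f)
    (s := fun β : S.I => Set.Icc S.a (β : ℝ)) (fun _ => measurableSet_Icc)
    (fun β γ h => Set.Icc_subset_Icc_right h) (by rwa [hU])
  rw [hU] at h
  exact Filter.tendsto_map'_iff.2 h

/-- Green's identity, with the boundary term at `b` as a limit. -/
theorem hasBracket_green {p q : (ℝ → HBold H K) × (ℝ → HBold H K)} (hp : p ∈ S.tmax)
    (hq : q ∈ S.tmax) :
    S.HasBracket p.1 q.1 (inner ℂ (q.1 S.a) (J H K (p.1 S.a))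
      + (S.form p.2 q.1 - S.form p.1 q.2)) := by
  have h1 := MemL2.integrable_inner S hp.2.1 hq.1
  have h2 := MemL2.integrable_inner S hp.1 hq.2.1
  have e : ∀ᵐ t ∂(volume.restrict S.I), (inner ℂ (q.1 t) (S.Δ t (p.2 t)) : ℂ)
      - inner ℂ (q.2 t) (S.Δ t (p.1 t)) =
      inner ℂ (q.1 t) (S.Δ t (p.2 t)) - inner ℂ (S.Δ t (q.2 t)) (p.1 t) := by
    filter_upwards [S.nonneg_Δ] with t ht
    exact congrArg _ (ht.isSymmetric _ _).symm
  have h3 := S.tendsto_setIntegral_endFilter (h1.sub h2)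
  simp only [Pi.sub_apply] at h3
  rw [integral_sub h1 h2] at h3
  refine Tendsto.congr' ?_ (h3.const_add (inner ℂ (q.1 S.a) (J H K (p.1 S.a))))
  filter_upwards [S.eventually_endFilter_ge S.isLeast.1] with β hβ
  have hl := S.lagrange hp.2.2 hq.2.2 hβ.2 (S.integrableOn_Δ_apply hp.2.1 hβ.2)
    (S.integrableOn_Δ_apply hq.2.1 hβ.2)
  have e' := integral_congr_ae (ae_restrict_of_ae_restrict_of_subset (Icc_subset hβ.2) e)
  refine (congrArg (inner ℂ (q.1 S.a) (J H K (p.1 S.a)) + ·) e').trans ?_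
  rw [← hl]
  ring

end SymmetricSystem

end SymmSys

namespace SymmSys

variable {H K : Type*}
  [NormedAddCommGroup H] [InnerProductSpace ℂ H] [FiniteDimensional ℂ H]
  [NormedAddCommGroup K] [InnerProductSpace ℂ K] [FiniteDimensional ℂ K]

namespace SymmetricSystem

variable (S : SymmetricSystem H K)

/-! ### Compactly supported right-hand sides -/

variable {S} in
theorem mem_L2_of_bounded {f : ℝ → HBold H K} (hf : AEStronglyMeasurable f (volume.restrict S.I))
    {β C : ℝ} (hβ : β ∈ S.I) (hC : ∀ t ∈ Set.Icc S.a β, ‖f t‖ ≤ C)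
    (h0 : ∀ t ∈ S.I, β < t → f t = 0) : f ∈ S.L2 := by
  refine ⟨hf, ?_⟩
  have hI : IntegrableOn (fun t => (inner ℂ (f t) (S.Δ t (f t)) : ℂ)) (Set.Icc S.a β) := by
    refine Integrable.mono' ((S.integrable_Δ β hβ).norm.const_mul (C ^ 2))
      ((S.aestronglyMeasurable_inner hf hf).mono_measure
        (Measure.restrict_mono (Icc_subset hβ) le_rfl)) ?_
    filter_upwards [ae_restrict_mem measurableSet_Icc] with t ht
    have h1 := hC t ht
    have h2 := (norm_nonneg (f t)).trans h1
    calc ‖(inner ℂ (f t) (S.Δ t (f t)) : ℂ)‖ ≤ ‖f t‖ * (‖S.Δ t‖ * ‖f t‖) :=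
          (norm_inner_le_norm _ _).trans (by gcongr; exact (S.Δ t).le_opNorm _)
      _ ≤ C * (‖S.Δ t‖ * C) := by gcongr
      _ = C ^ 2 * ‖S.Δ t‖ := by ring
  refine hI.of_forall_sdiff_eq_zero S.measurableSet_I fun t ht => ?_
  rw [h0 t ht.1 (not_le.1 fun h => ht.2 ⟨S.isLeast.2 ht.1, h⟩), inner_zero_left]

/-- The functions of `ℒ²_Δ(I)` which vanish near the endpoint `b`. -/
def L2c : Submodule ℂ (ℝ → HBold H K) where
  carrier := {f | f ∈ S.L2 ∧ ∃ β ∈ S.I, ∀ t, β < t → f t = 0}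
  zero_mem' := ⟨S.L2.zero_mem, S.a, S.isLeast.1, fun _ _ => rfl⟩
  add_mem' := by
    rintro f g ⟨hf, β, hβ, h1⟩ ⟨hg, γ, hγ, h2⟩
    refine ⟨S.L2.add_mem hf hg, max β γ, ?_, fun t ht => ?_⟩
    · rcases max_choice β γ with h | h <;> rw [h] <;> assumption
    · rw [Pi.add_apply, h1 t ((le_max_left _ _).trans_lt ht),
        h2 t ((le_max_right _ _).trans_lt ht), add_zero]
  smul_mem' := by
    rintro c f ⟨hf, β, hβ, h1⟩
    exact ⟨S.L2.smul_mem c hf, β, hβ, fun t ht => by rw [Pi.smul_apply, h1 t ht, smul_zero]⟩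

theorem diff_Icc_lt {β t : ℝ} (ht : t ∈ S.I \ Set.Icc S.a β) : β < t :=
  not_le.1 fun h => ht.2 ⟨S.isLeast.2 ht.1, h⟩

variable {S} in
/-- A locally integrable function which annihilates `L2c` vanishes. -/
theorem ae_eq_zero_of_forall_integral_inner {k : ℝ → HBold H K}
    (hk : ∀ β ∈ S.I, IntegrableOn k (Set.Icc S.a β))
    (h : ∀ f ∈ S.L2c, ∫ t in S.I, (inner ℂ (k t) (f t) : ℂ) = 0) :
    ∀ᵐ t ∂(volume.restrict S.I), k t = 0 := by
  refine ae_restrict_of_forall_Icc S.ordConnected S.isLeast fun β hβ => ?_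
  refine (hk β hβ).ae_eq_zero_of_forall_setIntegral_eq_zero fun A hA _ => ?_
  rw [Measure.restrict_restrict hA]
  set A' := A ∩ Set.Icc S.a β with hA'
  have hA'm : MeasurableSet A' := hA.inter measurableSet_Icc
  have hsub : A' ⊆ S.I := Set.inter_subset_right.trans (Icc_subset hβ)
  have hkA : IntegrableOn k A' := (hk β hβ).mono_set Set.inter_subset_right
  refine ext_inner_right ℂ fun e => ?_
  rw [inner_zero_left, ← inner_conj_symm, ← integral_inner hkA, ← integral_conj]
  simp only [inner_conj_symm]
  have hf : A'.indicator (fun _ => e) ∈ S.L2c := by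
    refine ⟨mem_L2_of_bounded (β := β) (C := ‖e‖)
      ((aestronglyMeasurable_const).indicator hA'm) hβ (fun t _ => ?_) fun t _ ht => ?_,
      β, hβ, fun t ht => ?_⟩
    · exact norm_indicator_le_norm_self _ _
    · exact Set.indicator_of_notMem (fun hm => absurd hm.2.2 (not_le.2 ht)) _
    · exact Set.indicator_of_notMem (fun hm => absurd hm.2.2 (not_le.2 ht)) _
  rw [← h _ hf, setIntegral_eq_of_subset_of_forall_sdiff_eq_zero S.measurableSet_I hsub]
  · refine setIntegral_congr_fun hA'm fun t ht => ?_
    simp only [Set.indicator_of_mem ht]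
  · intro t ht
    rw [Set.indicator_of_notMem ht.2, inner_zero_right]

theorem integrableOn_adjoint_fund_Δ {f : ℝ → HBold H K} (hf : f ∈ S.L2c) :
    IntegrableOn (fun t => ContinuousLinearMap.adjoint (S.fund t) (S.Δ t (f t))) S.I := by
  obtain ⟨h1, β, hβ, h2⟩ := hf
  refine (S.integrableOn_adjoint_fund hβ
    (S.integrableOn_Δ_apply h1 hβ)).of_forall_sdiff_eq_zero S.measurableSet_I fun t ht => ?_
  rw [h2 t (S.diff_Icc_lt ht), map_zero, map_zero]

/-- The moments `f ↦ ∫_I Φ* Δ f dt` against the solutions of the homogeneous system. -/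
noncomputable def moment : S.L2c →ₗ[ℂ] HBold H K where
  toFun f := ∫ t in S.I, ContinuousLinearMap.adjoint (S.fund t) (S.Δ t ((f : ℝ → HBold H K) t))
  map_add' f g := by
    rw [← integral_add (S.integrableOn_adjoint_fund_Δ f.2) (S.integrableOn_adjoint_fund_Δ g.2)]
    simp
  map_smul' c f := by
    rw [RingHom.id_apply, ← integral_smul]
    simp

theorem inner_moment (d : HBold H K) (f : S.L2c) :
    (inner ℂ d (S.moment f) : ℂ) =
      ∫ t in S.I, inner ℂ (S.Δ t (S.fund t d)) ((f : ℝ → HBold H K) t) := by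
  change (inner ℂ d (∫ t in S.I, _) : ℂ) = _
  rw [← integral_inner (S.integrableOn_adjoint_fund_Δ f.2)]
  refine integral_congr_ae ?_
  filter_upwards [S.nonneg_Δ] with t ht
  rw [ContinuousLinearMap.adjoint_inner_right]
  exact (ht.isSymmetric _ _).symm

/-- Definiteness of the system: a solution `Φ d` with `Δ Φ d = 0` vanishes. -/
theorem eq_zero_of_Δ_fund {d : HBold H K}
    (h : ∀ᵐ t ∂(volume.restrict S.I), S.Δ t (S.fund t d) = 0) : d = 0 := by
  have hs : SolvesOn S.I S.a S.B (fun t => S.fund t d)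
      (fun t => (0 : ℂ) • S.Δ t (S.fund t d)) := by
    simp only [zero_smul]
    exact S.solvesOn_fund d
  simpa using S.definite 0 _ hs h S.a S.isLeast.1

/-- Every vector is a moment: this is the definiteness of the system. -/
theorem moment_surjective : Function.Surjective S.moment := by
  rw [← LinearMap.range_eq_top, ← Submodule.orthogonal_eq_bot_iff, Submodule.eq_bot_iff]
  intro d hd
  refine S.eq_zero_of_Δ_fund (ae_eq_zero_of_forall_integral_inner (fun β hβ => ?_) fun f hf => ?_)
  · exact integrableOn_clm_apply_of_continuousOn (S.integrable_Δ β hβ)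
      ((S.solvesOn_fund d).continuousOn hβ)
  · rw [← S.inner_moment d ⟨f, hf⟩]
    exact (Submodule.mem_orthogonal' _ _).1 hd _ ⟨_, rfl⟩

/-- Near `b` the solution of `J y' - B y = Δ f`, `y(a) = c`, is a solution of the homogeneous
system determined by the moments of `f`. -/
theorem sol_eq_of_moment (c : HBold H K) (f : S.L2c) :
    ∃ β ∈ S.I, ∀ t ∈ S.I, β ≤ t →
      S.sol c (fun t => S.Δ t ((f : ℝ → HBold H K) t)) t
        = S.fund t (c - J H K (S.moment f)) := by
  obtain ⟨f, hf, β, hβ, h0⟩ := f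
  refine ⟨β, hβ, fun t ht hβt => ?_⟩
  have hat := S.isLeast.2 ht
  have : ∫ s in S.a..t, S.varConst (fun t => S.Δ t (f t)) s
      = -J H K (S.moment ⟨f, hf, β, hβ, h0⟩) := by
    rw [intervalIntegral.integral_of_le hat, ← integral_Icc_eq_integral_Ioc]
    change (∫ s in Set.Icc S.a t, S.varConst (fun t => S.Δ t (f t)) s) = -J H K (∫ t in S.I, _)
    rw [setIntegral_eq_of_subset_of_forall_sdiff_eq_zero S.measurableSet_I (Icc_subset ht)]
    · rw [← (J H K).integral_comp_comm
        (S.integrableOn_adjoint_fund ht (S.integrableOn_Δ_apply hf ht)), ← integral_neg]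
      rfl
    · intro s hs
      simp only
      rw [h0 s (hβt.trans_lt (S.diff_Icc_lt hs)), map_zero, map_zero]
  rw [sol, this, sub_eq_add_neg]

/-- The initial value `J ∫_I Φ* Δ f` makes the solution of `J y' - B y = Δ f` vanish near `b`. -/
theorem sol_mem_tmax_of_moment (c : HBold H K) (f : S.L2c) (h : c = J H K (S.moment f)) :
    (S.sol c (fun t => S.Δ t ((f : ℝ → HBold H K) t)),
      (f : ℝ → HBold H K)) ∈ S.tmax ∧
    ∃ β ∈ S.I, ∀ t ∈ S.I, β ≤ t →
      S.sol c (fun t => S.Δ t ((f : ℝ → HBold H K) t)) t = 0 := by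
  obtain ⟨β, hβ, hz⟩ := S.sol_eq_of_moment c f
  have hz' : ∀ t ∈ S.I, β ≤ t → S.sol c (fun t => S.Δ t ((f : ℝ → HBold H K) t)) t = 0 :=
    fun t ht hb => by rw [hz t ht hb, h, sub_self, map_zero]
  have hs := S.solvesOn_sol c (fun β hβ => S.integrableOn_Δ_apply f.2.1 hβ)
  refine ⟨⟨?_, f.2.1, hs⟩, β, hβ, hz'⟩
  obtain ⟨C, hC⟩ := isCompact_Icc.exists_bound_of_continuousOn (hs.continuousOn hβ)
  exact mem_L2_of_bounded (S.aestronglyMeasurable_of_continuousOn fun β hβ => hs.continuousOn hβ)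
    hβ hC fun t ht hb => hz' t ht hb.le

variable {S} in
theorem hasBracket_zero_of_eventually {y z : ℝ → HBold H K} {β : ℝ} (hβ : β ∈ S.I)
    (h : ∀ t ∈ S.I, β ≤ t → y t = 0) : S.HasBracket y z 0 := by
  refine Tendsto.congr' ?_ tendsto_const_nhds
  filter_upwards [S.eventually_endFilter_ge hβ] with t ht
  rw [h t ht.2 ht.1, map_zero, inner_zero_right]

/-- Every initial value is attained by an element of the maximal relation which vanishes
near `b`. -/
theorem exists_tmax_of_initial (c : HBold H K) : ∃ p ∈ S.tmax, p.1 S.a = c ∧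
    ∀ z, S.HasBracket p.1 z 0 := by
  obtain ⟨f, hf⟩ := S.moment_surjective (-J H K c)
  have hc : c = J H K (S.moment f) := by rw [hf, map_neg, J_J, neg_neg]
  obtain ⟨h1, β, hβ, h2⟩ := S.sol_mem_tmax_of_moment c f hc
  exact ⟨_, h1, S.sol_a _ _, fun z => hasBracket_zero_of_eventually hβ h2⟩

/-! ### The adjoint of the minimal relation -/

variable {S} in
theorem mem_L2_of_root_eq {h : ℝ → HBold H K} (hh : MemLp h 2 (volume.restrict S.I))
    {w : ℝ → HBold H K} (hw : AEStronglyMeasurable w (volume.restrict S.I))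
    (e : ∀ᵐ t ∂(volume.restrict S.I), S.root t (h t) = S.Δ t (w t)) : w ∈ S.L2 := by
  refine mem_L2_of_memLp_root hw
    (hh.mono (S.aestronglyMeasurable_root.clm_apply_apply hw) ?_)
  filter_upwards [e, S.nonneg_Δ] with t ht hp
  have h1 : (inner ℂ (S.root t (w t)) (S.root t (w t)) : ℂ) = inner ℂ (S.root t (w t)) (h t) := by
    rw [root, inner_opSqrt_opSqrt hp, inner_opSqrt_left, ← ht, root]
  have h2 : ‖S.root t (w t)‖ * ‖S.root t (w t)‖ ≤ ‖S.root t (w t)‖ * ‖h t‖ := by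
    have := norm_inner_le_norm (𝕜 := ℂ) (S.root t (w t)) (h t)
    rw [← h1, inner_self_eq_norm_sq_to_K] at this
    simpa [sq] using this
  by_contra hlt
  nlinarith [norm_nonneg (h t), not_le.1 hlt]

variable {S} in
/-- The adjoint of the minimal relation is contained in the maximal relation.  The pair
`{h, g}` is taken in the unweighted space `L²(I; 𝐇)`, which avoids a description of the closure of
the image of `ℒ²_Δ(I)`. -/
theorem exists_solution_of_forall_tmin {h g : S.LTwo}
    (hadj : ∀ y f : S.L2, ((y : ℝ → HBold H K), (f : ℝ → HBold H K)) ∈ S.tmin →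
      (inner ℂ h (S.emb f) : ℂ) = inner ℂ g (S.emb y)) :
    ∃ w ∈ S.L2, SolvesOn S.I S.a S.B w (fun t => S.root t (g t)) ∧
      ∀ᵐ t ∂(volume.restrict S.I), S.root t (h t) = S.Δ t (w t) := by
  have hg := fun β (hβ : β ∈ S.I) => S.integrableOn_root (Lp.memLp g) hβ
  have hh := fun β (hβ : β ∈ S.I) => S.integrableOn_root (Lp.memLp h) hβ
  have hΔ : ∀ y : ℝ → HBold H K, (∀ β ∈ S.I, ContinuousOn y (Set.Icc S.a β)) → ∀ β ∈ S.I,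
      IntegrableOn (fun t => S.Δ t (y t)) (Set.Icc S.a β) := fun y hy β hβ =>
    integrableOn_clm_apply_of_continuousOn (S.integrable_Δ β hβ) (hy β hβ)
  -- `w₀` is a solution; it differs from the required one by a solution `Φ d` of the homogeneous
  -- system
  set w₀ := S.sol 0 (fun t => S.root t (g t)) with hw₀
  have hs₀ : SolvesOn S.I S.a S.B w₀ _ := S.solvesOn_sol 0 hg
  set k : ℝ → HBold H K := fun t => S.root t (h t) - S.Δ t (w₀ t) with hk
  have hkint : ∀ β ∈ S.I, IntegrableOn k (Set.Icc S.a β) := fun β hβ =>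
    (hh β hβ).sub (hΔ w₀ (fun β hβ => hs₀.continuousOn hβ) β hβ)
  have hint2 : ∀ (y f : ℝ → HBold H K), (∀ β ∈ S.I, ContinuousOn y (Set.Icc S.a β)) →
      f ∈ S.L2c → IntegrableOn (fun t => (inner ℂ (S.Δ t (y t)) (f t) : ℂ)) S.I := by
    intro y f hy hf
    obtain ⟨hf, β, hβ, h0⟩ := hf
    have h1 : IntegrableOn (fun t => (inner ℂ (S.Δ t (y t)) (f t) : ℂ)) (Set.Icc S.a β) := by
      refine (integrableOn_inner_of_continuousOn (hy β hβ)
        (S.integrableOn_Δ_apply hf hβ)).congr ?_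
      filter_upwards [ae_restrict_of_ae_restrict_of_subset (Icc_subset hβ) S.nonneg_Δ] with t ht
      exact (ht.isSymmetric _ _).symm
    refine h1.of_forall_sdiff_eq_zero S.measurableSet_I fun t ht => ?_
    rw [h0 t (S.diff_Icc_lt ht), inner_zero_right]
  have hint : ∀ f : S.L2c, IntegrableOn (fun t => (inner ℂ (k t) ((f : ℝ → HBold H K) t) : ℂ))
      S.I := by
    intro f
    have := (S.integrable_inner_root h ⟨f, f.2.1⟩).sub
      (hint2 w₀ f (fun β hβ => hs₀.continuousOn hβ) f.2)
    refine this.congr (Eventually.of_forall fun t => ?_)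
    simp only [hk, Pi.sub_apply, inner_sub_left]
  let l : S.L2c →ₗ[ℂ] ℂ :=
    { toFun := fun f => ∫ t in S.I, (inner ℂ (k t) ((f : ℝ → HBold H K) t) : ℂ)
      map_add' := fun f f' => by
        rw [← integral_add (hint f) (hint f')]
        simp
      map_smul' := fun c f => by
        rw [RingHom.id_apply, ← integral_smul]
        simp }
  -- pairs in the minimal relation with vanishing moments annihilate `k`
  have hker : LinearMap.ker S.moment ≤ LinearMap.ker l := by
    intro f hf
    rw [LinearMap.mem_ker] at hf ⊢
    obtain ⟨h1, β, hβ, h2⟩ := S.sol_mem_tmax_of_moment 0 f (by rw [hf, map_zero])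
    set y := S.sol 0 (fun t => S.Δ t ((f : ℝ → HBold H K) t)) with hy
    have hya : y S.a = 0 := S.sol_a _ _
    have hmin : (y, (f : ℝ → HBold H K)) ∈ S.tmin :=
      ⟨h1, hya, fun z _ => hasBracket_zero_of_eventually hβ h2⟩
    have e1 := hadj ⟨y, h1.1⟩ ⟨f, f.2.1⟩ hmin
    rw [inner_left_emb, inner_left_emb] at e1
    obtain ⟨-, γ, hγ, hf0⟩ := f.2
    -- a common end of the supports of `y` and `f`
    have hδ : max β γ ∈ S.I := by rcases max_choice β γ with h | h <;> rw [h] <;> assumption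
    have hl := S.lagrange h1.2.2 hs₀ hδ (S.integrableOn_Δ_apply f.2.1 hδ) (hg _ hδ)
    simp only at hl
    rw [h2 _ hδ (le_max_left _ _), hya, map_zero, inner_zero_right, inner_zero_right,
      sub_zero] at hl
    have hi1 := integrableOn_inner_of_continuousOn (hs₀.continuousOn hδ)
      (S.integrableOn_Δ_apply f.2.1 hδ)
    have hi2 : IntegrableOn (fun t => (inner ℂ (S.root t (g t)) (y t) : ℂ))
        (Set.Icc S.a (max β γ)) :=
      (S.integrable_inner_root g ⟨y, h1.1⟩).mono_set (Icc_subset hδ)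
    rw [integral_sub hi1 hi2, eq_comm, sub_eq_zero] at hl
    have e2 : ∫ t in S.I, (inner ℂ (S.root t (g t)) (y t) : ℂ)
        = ∫ t in Set.Icc S.a (max β γ), inner ℂ (S.root t (g t)) (y t) :=
      setIntegral_eq_of_subset_of_forall_sdiff_eq_zero S.measurableSet_I (Icc_subset hδ)
        fun t ht => by
          rw [h2 t ht.1 ((le_max_left _ _).trans (S.diff_Icc_lt ht).le), inner_zero_right]
    have e3 : ∫ t in S.I, (inner ℂ (S.Δ t (w₀ t)) ((f : ℝ → HBold H K) t) : ℂ)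
        = ∫ t in Set.Icc S.a (max β γ), inner ℂ (w₀ t) (S.Δ t ((f : ℝ → HBold H K) t)) := by
      rw [setIntegral_eq_of_subset_of_forall_sdiff_eq_zero S.measurableSet_I (Icc_subset hδ)
        fun t ht => by
          rw [hf0 t ((le_max_right _ _).trans_lt (S.diff_Icc_lt ht)), inner_zero_right]]
      refine integral_congr_ae ?_
      filter_upwards [ae_restrict_of_ae_restrict_of_subset (Icc_subset hδ) S.nonneg_Δ] with t ht
      exact ht.isSymmetric _ _
    change (∫ t in S.I, (inner ℂ (k t) ((f : ℝ → HBold H K) t) : ℂ)) = 0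
    have e4 : ∫ t in S.I, (inner ℂ (k t) ((f : ℝ → HBold H K) t) : ℂ) =
        (∫ t in S.I, (inner ℂ (S.root t (h t)) ((f : ℝ → HBold H K) t) : ℂ)) -
          ∫ t in S.I, (inner ℂ (S.Δ t (w₀ t)) ((f : ℝ → HBold H K) t) : ℂ) := by
      rw [← integral_sub (S.integrable_inner_root h ⟨f, f.2.1⟩)
        (hint2 w₀ f (fun β hβ => hs₀.continuousOn hβ) f.2)]
      simp only [hk, inner_sub_left]
    rw [e4, e3, hl, ← e2, sub_eq_zero]
    exact e1
  -- hence the annihilator `k` acts through the moments, like `Δ Φ d` for some `d`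
  obtain ⟨φ, hφ⟩ : l ∈ LinearMap.range S.moment.dualMap := by
    rw [LinearMap.range_dualMap_eq_dualAnnihilator_ker, Submodule.mem_dualAnnihilator]
    exact fun f hf => hker hf
  set d := (InnerProductSpace.toDual ℂ (HBold H K)).symm (LinearMap.toContinuousLinearMap φ)
    with hd
  have hdφ : ∀ x, (inner ℂ d x : ℂ) = φ x := fun x => InnerProductSpace.toDual_symm_apply
  have hcf : ∀ β ∈ S.I, ContinuousOn (fun t => S.fund t d) (Set.Icc S.a β) :=
    fun β hβ => (S.solvesOn_fund d).continuousOn hβ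
  have hkd : ∀ᵐ t ∂(volume.restrict S.I), k t - S.Δ t (S.fund t d) = 0 := by
    refine ae_eq_zero_of_forall_integral_inner (fun β hβ => (hkint β hβ).sub (hΔ _ hcf β hβ))
      fun f hf => ?_
    simp only [inner_sub_left]
    rw [integral_sub (hint ⟨f, hf⟩) (hint2 _ f hcf hf), ← S.inner_moment d ⟨f, hf⟩, hdφ,
      sub_eq_zero]
    exact (LinearMap.congr_fun hφ ⟨f, hf⟩).symm
  have hsw : SolvesOn S.I S.a S.B (w₀ + fun t => S.fund t d) (fun t => S.root t (g t)) := by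
    simpa using hs₀.add (S.solvesOn_fund d)
  have he : ∀ᵐ t ∂(volume.restrict S.I),
      S.root t (h t) = S.Δ t ((w₀ + fun t => S.fund t d) t) := by
    filter_upwards [hkd] with t ht
    rw [Pi.add_apply, map_add, ← sub_eq_zero, ← ht]
    simp only [hk]
    abel
  exact ⟨_, mem_L2_of_root_eq (Lp.memLp h)
    (S.aestronglyMeasurable_of_continuousOn fun β hβ => hsw.continuousOn hβ) he, hsw, he⟩

end SymmetricSystem

end SymmSys

namespace SymmSys

variable {H K : Type*}
  [NormedAddCommGroup H] [InnerProductSpace ℂ H] [FiniteDimensional ℂ H]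
  [NormedAddCommGroup K] [InnerProductSpace ℂ K] [FiniteDimensional ℂ K]

/-! ### The minimal relation -/

theorem SolvesOn.congr_right {I : Set ℝ} {a : ℝ} {B : ℝ → HBold H K →L[ℂ] HBold H K}
    {y g g' : ℝ → HBold H K} (h : SolvesOn I a B y g)
    (hg : ∀ᵐ t ∂(volume.restrict I), g t = g' t) : SolvesOn I a B y g' := by
  refine ⟨h.1, ?_⟩
  filter_upwards [h.2, hg] with t ⟨y', h1, h2⟩ h3
  exact ⟨y', h1, h2.trans h3⟩

theorem SolvesOn.sub {I : Set ℝ} {a : ℝ} {B : ℝ → HBold H K →L[ℂ] HBold H K}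
    {y₁ y₂ g₁ g₂ : ℝ → HBold H K} (h : SolvesOn I a B y₁ g₁)
    (k : SolvesOn I a B y₂ g₂) : SolvesOn I a B (y₁ - y₂) (g₁ - g₂) := by
  have := h.add (k.smul (-1))
  simpa only [neg_smul, one_smul, ← sub_eq_add_neg] using this

namespace SymmetricSystem

variable {S : SymmetricSystem H K}

/-- Solvability on `I` depends only on the values on `I`. -/
theorem solvesOn_congr_left {y y' g : ℝ → HBold H K} (h : SolvesOn S.I S.a S.B y g)
    (hy : ∀ t ∈ S.I, y' t = y t) : SolvesOn S.I S.a S.B y' g := by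
  refine ⟨fun β hβ => ?_, ?_⟩
  · have hsub : Set.uIcc S.a β ⊆ S.I := by
      rw [Set.uIcc_of_le (S.isLeast.2 hβ)]; exact Icc_subset hβ
    have h1 : AbsolutelyContinuousOnInterval y S.a β := h.1 β hβ
    exact h1.of_dist_le fun s hs t ht => by rw [hy s (hsub hs), hy t (hsub ht)]
  · refine ae_restrict_of_forall_Icc S.ordConnected S.isLeast fun β hβ => ?_
    have h1 : ∀ᵐ x : ℝ, x ≠ S.a := by simp [ae_iff, measure_singleton]
    have h2 : ∀ᵐ x : ℝ, x ≠ β := by simp [ae_iff, measure_singleton]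
    have h3 := ae_restrict_Icc_of_ae_restrict S.ordConnected S.isLeast h.2 hβ
    rw [ae_restrict_iff' measurableSet_Icc] at h3 ⊢
    filter_upwards [h1, h2, h3] with t h1 h2 h3 ht
    obtain ⟨d, hd, e⟩ := h3 ht
    refine ⟨d, hd.congr_of_eventuallyEq ?_, by rw [hy t (Icc_subset hβ ht), e]⟩
    filter_upwards [Icc_mem_nhds (lt_of_le_of_ne ht.1 h1.symm) (lt_of_le_of_ne ht.2 h2)]
      with s hs
    exact hy s (Icc_subset hβ hs)

theorem mem_L2_congr {y y' : ℝ → HBold H K} (h : y ∈ S.L2) (hy : ∀ t ∈ S.I, y' t = y t) :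
    y' ∈ S.L2 := by
  have hae : ∀ᵐ t ∂(volume.restrict S.I), y t = y' t := by
    filter_upwards [ae_restrict_mem S.measurableSet_I] with t ht using (hy t ht).symm
  refine ⟨h.1.congr hae, h.2.congr ?_⟩
  filter_upwards [hae] with t ht
  rw [ht]

/-- An element of the minimal relation has no boundary terms in Green's identity. -/
theorem form_eq_of_mem_tmin {p q : (ℝ → HBold H K) × (ℝ → HBold H K)} (hp : p ∈ S.tmin)
    (hq : q ∈ S.tmax) : S.form p.2 q.1 = S.form p.1 q.2 := by
  have h := tendsto_nhds_unique (S.hasBracket_green hp.1 hq) (hp.2.2 q.1 ⟨q, hq, rfl⟩)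
  rwa [hp.2.1, map_zero, inner_zero_right, zero_add, sub_eq_zero] at h

/-- Form values against `w` can be computed from any `h ∈ L²(I; 𝐇)` with `Δ^{1/2} h = Δ w`. -/
theorem form_eq_inner_emb {h : S.LTwo} {w : ℝ → HBold H K}
    (e : ∀ᵐ t ∂(volume.restrict S.I), S.root t (h t) = S.Δ t (w t)) (f : S.L2) :
    S.form f w = inner ℂ h (S.emb f) := by
  rw [inner_left_emb, form]
  refine integral_congr_ae ?_
  filter_upwards [e, S.nonneg_Δ] with t ht hp
  rw [ht]
  exact (hp.isSymmetric _ _).symm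

theorem ae_root_emb (f : S.L2) : ∀ᵐ t ∂(volume.restrict S.I),
    S.root t (S.emb f t) = S.Δ t ((f : ℝ → HBold H K) t) := by
  filter_upwards [S.coeFn_emb f, S.ae_root_root f] with t h1 h2
  rw [h1, h2]

theorem HasBracket.add_left {y₁ y₂ z : ℝ → HBold H K} {c₁ c₂ : ℂ} (h₁ : S.HasBracket y₁ z c₁)
    (h₂ : S.HasBracket y₂ z c₂) : S.HasBracket (y₁ + y₂) z (c₁ + c₂) :=
  (Tendsto.add h₁ h₂).congr fun t => by rw [Pi.add_apply, map_add, inner_add_right]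

theorem HasBracket.smul_left {y z : ℝ → HBold H K} {c : ℂ} (h : S.HasBracket y z c) (d : ℂ) :
    S.HasBracket (d • y) z (d * c) :=
  (Tendsto.const_mul d h).congr fun t => by rw [Pi.smul_apply, map_smul, inner_smul_right]

variable (S) in
/-- The minimal relation as a subspace. -/
def tminSubmodule : Submodule ℂ ((ℝ → HBold H K) × (ℝ → HBold H K)) where
  carrier := S.tmin
  zero_mem' := ⟨S.tmax.zero_mem, rfl, fun z _ =>
    hasBracket_zero_of_eventually S.isLeast.1 fun _ _ _ => rfl⟩
  add_mem' := by
    rintro x y ⟨h1, h2, h3⟩ ⟨k1, k2, k3⟩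
    refine ⟨S.tmax.add_mem h1 k1, ?_, fun z hz => ?_⟩
    · rw [Prod.fst_add, Pi.add_apply, h2, k2, add_zero]
    · have := (h3 z hz).add_left (k3 z hz)
      rwa [add_zero] at this
  smul_mem' := by
    rintro c x ⟨h1, h2, h3⟩
    refine ⟨S.tmax.smul_mem c h1, ?_, fun z hz => ?_⟩
    · rw [Prod.smul_fst, Pi.smul_apply, h2, smul_zero]
    · have := (h3 z hz).smul_left c
      rwa [mul_zero] at this

variable (S) in
/-- The minimal relation as a subspace of `ℒ²_Δ(I) × ℒ²_Δ(I)`. -/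
def tminL2 : Submodule ℂ (S.L2 × S.L2) :=
  S.tminSubmodule.comap (S.L2.subtype.prodMap S.L2.subtype)

variable (S) in
/-- The map `{y, f} ↦ f - z y` on pairs of elements of `ℒ²_Δ(I)`. -/
noncomputable def shift (z : ℂ) : S.L2 × S.L2 →ₗ[ℂ] S.LTwo :=
  S.emb ∘ₗ LinearMap.snd ℂ _ _ - z • (S.emb ∘ₗ LinearMap.fst ℂ _ _)

theorem shift_apply (z : ℂ) (x : S.L2 × S.L2) : S.shift z x = S.emb x.2 - z • S.emb x.1 := rfl

/-- The minimal relation is symmetric, so `T_min - z` is bounded below for nonreal `z`. -/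
theorem norm_emb_le_norm_shift {z : ℂ} {x : S.L2 × S.L2} (hx : x ∈ S.tminL2) :
    |z.im| * ‖S.emb x.1‖ ≤ ‖S.shift z x‖ := by
  have h1 : (starRingEnd ℂ) (S.form x.2 x.1) = S.form x.2 x.1 := by
    rw [conj_form]
    exact (form_eq_of_mem_tmin (S := S) hx hx.1).symm
  have h2 : (inner ℂ (S.emb x.1) (S.shift z x) : ℂ) =
      S.form x.2 x.1 - z * (‖S.emb x.1‖ : ℂ) ^ 2 := by
    rw [shift_apply, inner_sub_right, inner_smul_right, inner_emb_emb, inner_self_eq_norm_sq_to_K]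
    rfl
  have h3 : (inner ℂ (S.emb x.1) (S.shift z x) : ℂ).im = -(z.im * ‖S.emb x.1‖ ^ 2) := by
    rw [h2, Complex.sub_im, Complex.conj_eq_iff_im.1 h1, ← Complex.ofReal_pow, Complex.mul_im,
      Complex.ofReal_re, Complex.ofReal_im]
    ring
  have h4 := (Complex.abs_im_le_norm _).trans
    (norm_inner_le_norm (𝕜 := ℂ) (S.emb x.1) (S.shift z x))
  rw [h3, abs_neg, abs_mul, abs_of_nonneg (sq_nonneg ‖S.emb x.1‖)] at h4
  by_contra hlt
  have h5 := not_le.1 hlt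
  have h6 : 0 < ‖S.emb x.1‖ := by
    by_contra h0
    have : ‖S.emb x.1‖ = 0 := le_antisymm (not_lt.1 h0) (norm_nonneg _)
    rw [this, mul_zero] at h5
    exact absurd h5 (not_lt.2 (norm_nonneg _))
  nlinarith

/-- The closure of `ran (T_min - z)`, described by its approximating sequences: the components
converge separately. -/
theorem exists_limit_of_mem_closure {z : ℂ} (hz : z.im ≠ 0) {g : S.LTwo}
    (hg : g ∈ (S.tminL2.map (S.shift z)).topologicalClosure) :
    ∃ x : ℕ → S.L2 × S.L2, (∀ n, x n ∈ S.tminL2) ∧ ∃ u : S.LTwo,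
      Tendsto (fun n => S.emb (x n).1) atTop (𝓝 u) ∧
      Tendsto (fun n => S.emb (x n).2) atTop (𝓝 (g + z • u)) := by
  rw [← SetLike.mem_coe, Submodule.topologicalClosure_coe, mem_closure_iff_seq_limit] at hg
  obtain ⟨s, hs, hlim⟩ := hg
  choose x hx hxs using hs
  have hz' : 0 < |z.im| := abs_pos.2 hz
  have hc : CauchySeq fun n => S.emb (x n).1 := by
    rw [Metric.cauchySeq_iff]
    intro ε hε
    obtain ⟨n, hn⟩ := Metric.cauchySeq_iff.1 hlim.cauchySeq (|z.im| * ε) (by positivity)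
    refine ⟨n, fun k hk m hm => ?_⟩
    have h1 := hn k hk m hm
    have h2 := norm_emb_le_norm_shift (z := z) (S.tminL2.sub_mem (hx k) (hx m))
    rw [map_sub, hxs, hxs, Prod.fst_sub, map_sub, ← dist_eq_norm, ← dist_eq_norm] at h2
    exact lt_of_mul_lt_mul_left (h2.trans_lt h1) hz'.le
  obtain ⟨u, hu⟩ := cauchySeq_tendsto_of_complete hc
  refine ⟨x, hx, u, hu, ?_⟩
  refine (hlim.add (hu.const_smul z)).congr fun n => ?_
  rw [← hxs, shift_apply, sub_add_cancel]

/-! ### Boundary values -/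

variable {E : Type*} [NormedAddCommGroup E] [InnerProductSpace ℂ E] [FiniteDimensional ℂ E]
  {F : Submodule ℂ E} (G : BoundaryMap S F)

/-- The form `[y, z]_b` in terms of the boundary mapping. -/
noncomputable def _root_.SymmSys.BoundaryMap.bracket (y z : S.domMax) : ℂ :=
  inner ℂ (G.Γ₁ z : E) (G.Γ₀ y) - inner ℂ (G.Γ₀ z) (G.Γ₁ y : E)
    + Complex.I * inner ℂ (Fᗮ.orthogonalProjectionOnto (G.Γ₀ z))
      (Fᗮ.orthogonalProjectionOnto (G.Γ₀ y))
    + Complex.I * inner ℂ (G.Γhat z) (G.Γhat y)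

/-- All boundary values `(y(a), Γ_b y)`. -/
noncomputable def _root_.SymmSys.BoundaryMap.bd : S.domMax →ₗ[ℂ] HBold H K × E × K × F :=
  ((LinearMap.proj S.a).comp S.domMax.subtype).prod (G.Γ₀.prod (G.Γhat.prod G.Γ₁))

theorem bd_apply (y : S.domMax) :
    G.bd y = ((y : ℝ → HBold H K) S.a, G.Γ₀ y, G.Γhat y, G.Γ₁ y) := rfl

theorem green {y z : S.domMax} {f g : ℝ → HBold H K} (hy : ((y : ℝ → HBold H K), f) ∈ S.tmax)
    (hz : ((z : ℝ → HBold H K), g) ∈ S.tmax) :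
    G.bracket y z - inner ℂ ((z : ℝ → HBold H K) S.a) (J H K ((y : ℝ → HBold H K) S.a))
      = S.form f z - S.form y g := by
  have h := tendsto_nhds_unique (S.hasBracket_green hy hz) (G.green y z)
  simp only at h
  rw [BoundaryMap.bracket, ← h]
  ring

/-- The form on the boundary space at `b` is nondegenerate. -/
theorem eq_zero_of_bracket {y : S.domMax} (h : ∀ z, G.bracket y z = 0) :
    G.Γ₀ y = 0 ∧ G.Γhat y = 0 ∧ G.Γ₁ y = 0 := by
  have hs : ∀ e k f, ∃ z, G.Γ₀ z = e ∧ G.Γhat z = k ∧ G.Γ₁ z = f := by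
    intro e k f
    obtain ⟨z, hz⟩ := G.surjective (e, k, f)
    exact ⟨z, by simpa using hz⟩
  have hk : G.Γhat y = 0 := by
    obtain ⟨z, h1, h2, h3⟩ := hs 0 (G.Γhat y) 0
    have := h z
    rw [BoundaryMap.bracket, h1, h2, h3] at this
    simpa using this
  have hf : G.Γ₁ y = 0 := by
    obtain ⟨z, h1, h2, h3⟩ := hs (G.Γ₁ y) 0 0
    have h4 := h z
    rw [BoundaryMap.bracket, h1, h2, h3,
      Submodule.orthogonalProjectionOnto_orthogonal_apply_eq_zero (G.Γ₁ y).2] at h4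
    simpa using h4
  have hp : Fᗮ.orthogonalProjectionOnto (G.Γ₀ y) = 0 := by
    obtain ⟨z, h1, h2, h3⟩ := hs (G.Γ₀ y) 0 0
    have h4 := h z
    rw [BoundaryMap.bracket, h1, h2, h3, hf, hk, Submodule.coe_zero, inner_zero_left,
      inner_zero_right, inner_zero_left, sub_zero, zero_add, mul_zero, add_zero,
      mul_eq_zero, or_iff_right Complex.I_ne_zero, inner_self_eq_zero] at h4
    exact h4
  have hmem : G.Γ₀ y ∈ F := by
    rw [Submodule.orthogonalProjectionOnto_eq_zero_iff, Submodule.orthogonal_orthogonal] at hp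
    exact hp
  have he : G.Γ₀ y = 0 := by
    obtain ⟨z, h1, h2, h3⟩ := hs 0 0 ⟨G.Γ₀ y, hmem⟩
    have h4 := h z
    rw [BoundaryMap.bracket, h1, h2, h3] at h4
    simpa using h4
  exact ⟨he, hk, hf⟩

theorem bracket_eq_zero_of_hasBracket {y z : S.domMax}
    (h : S.HasBracket (y : ℝ → HBold H K) z 0) : G.bracket y z = 0 :=
  tendsto_nhds_unique (G.green y z) h

/-- The boundary values at `a` and at `b` are independent of each other. -/
theorem bd_surjective : Function.Surjective G.bd := by
  rintro ⟨c, e, k, f⟩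
  obtain ⟨z, hz⟩ := G.surjective (e, k, f)
  obtain ⟨p, hp, hpa, hpb⟩ := S.exists_tmax_of_initial (c - (z : ℝ → HBold H K) S.a)
  let y : S.domMax := ⟨p.1, p, hp, rfl⟩
  obtain ⟨h0, h1, h2⟩ := eq_zero_of_bracket G (y := y)
    fun z => bracket_eq_zero_of_hasBracket G (hpb z)
  simp only [Prod.mk.injEq] at hz
  refine ⟨y + z, ?_⟩
  rw [bd_apply, map_add, map_add, map_add, h0, h1, h2, hz.1, hz.2.1, hz.2.2]
  simp only [zero_add, Prod.mk.injEq, and_true]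
  change p.1 S.a + (z : ℝ → HBold H K) S.a = c
  rw [hpa, sub_add_cancel]

/-- The form on the space of all boundary values is nondegenerate. -/
theorem bd_eq_zero_of_green {y : S.domMax} (h : ∀ z : S.domMax, G.bracket y z
      - inner ℂ ((z : ℝ → HBold H K) S.a) (J H K ((y : ℝ → HBold H K) S.a)) = 0) :
    G.bd y = 0 := by
  have ha : (y : ℝ → HBold H K) S.a = 0 := by
    obtain ⟨z, hz⟩ := bd_surjective G (J H K ((y : ℝ → HBold H K) S.a), 0, 0, 0)
    simp only [bd_apply, Prod.mk.injEq] at hz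
    have h1 := h z
    rw [BoundaryMap.bracket, hz.1, hz.2.1, hz.2.2.1, hz.2.2.2] at h1
    have h2 : J H K ((y : ℝ → HBold H K) S.a) = 0 := by simpa using h1
    have h3 := J_J ((y : ℝ → HBold H K) S.a)
    rw [h2, map_zero] at h3
    exact neg_eq_zero.1 h3.symm
  obtain ⟨h0, h1, h2⟩ := eq_zero_of_bracket G (y := y) fun z => by simpa [ha] using h z
  rw [bd_apply, ha, h0, h1, h2]
  rfl

theorem bd_congr {y z : S.domMax} (h : ∀ t ∈ S.I, (y : ℝ → HBold H K) t = (z : ℝ → HBold H K) t) :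
    G.bd y = G.bd z := by
  rw [← sub_eq_zero, ← map_sub]
  have h0 : ∀ t ∈ S.I, ((y - z : S.domMax) : ℝ → HBold H K) t = 0 := fun t ht => by
    change (y : ℝ → HBold H K) t - (z : ℝ → HBold H K) t = 0
    rw [h t ht, sub_self]
  obtain ⟨h1, h2, h3⟩ := eq_zero_of_bracket G (y := y - z) fun w =>
    bracket_eq_zero_of_hasBracket G
      (hasBracket_zero_of_eventually S.isLeast.1 fun t ht _ => h0 t ht)
  rw [bd_apply, h1, h2, h3, h0 S.a S.isLeast.1]
  rfl

/-! ### Defect subspaces and the von Neumann decomposition -/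

variable (S) in
/-- The square integrable solutions of `J y' - B y = z Δ y`.  They are normalized to vanish
outside `I`, so that each of them is determined by its values on `I`. -/
def solSpace (z : ℂ) : Submodule ℂ S.domMax where
  carrier := {y | SolvesOn S.I S.a S.B y (fun t => z • S.Δ t ((y : ℝ → HBold H K) t)) ∧
    ∀ t ∉ S.I, (y : ℝ → HBold H K) t = 0}
  zero_mem' := by
    refine ⟨?_, fun t _ => rfl⟩
    convert! SolvesOn.zero S.I S.a S.B using 2
    simp
  add_mem' := by
    rintro y w ⟨h1, h2⟩ ⟨k1, k2⟩
    refine ⟨?_, fun t ht => ?_⟩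
    · convert! h1.add k1 using 2
      simp
    · change (y : ℝ → HBold H K) t + (w : ℝ → HBold H K) t = 0
      rw [h2 t ht, k2 t ht, add_zero]
  smul_mem' := by
    rintro c y ⟨h1, h2⟩
    refine ⟨?_, fun t ht => ?_⟩
    · convert! h1.smul c using 2
      rw [Pi.smul_apply, smul_comm c z]
      exact congrArg (z • ·) ((S.Δ _).map_smul c _)
    · change c • (y : ℝ → HBold H K) t = 0
      rw [h2 t ht, smul_zero]

theorem mem_L2_of_domMax (y : S.domMax) : (y : ℝ → HBold H K) ∈ S.L2 := by
  obtain ⟨y, p, hp, rfl⟩ := y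
  exact hp.1

theorem mem_tmax_of_solvesOn {z : ℂ} {w : ℝ → HBold H K} (hw : w ∈ S.L2)
    (hs : SolvesOn S.I S.a S.B w (fun t => z • S.Δ t (w t))) : (w, z • w) ∈ S.tmax :=
  ⟨hw, S.L2.smul_mem z hw, by simpa using hs⟩

theorem mem_tmax_of_mem_solSpace {z : ℂ} {y : S.domMax} (hy : y ∈ S.solSpace z) :
    ((y : ℝ → HBold H K), z • (y : ℝ → HBold H K)) ∈ S.tmax :=
  mem_tmax_of_solvesOn (mem_L2_of_domMax y) hy.1

theorem exists_mem_solSpace {z : ℂ} {w : ℝ → HBold H K} (hw : w ∈ S.L2)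
    (hs : SolvesOn S.I S.a S.B w (fun t => z • S.Δ t (w t))) :
    ∃ y ∈ S.solSpace z, ∀ t ∈ S.I, (y : ℝ → HBold H K) t = w t := by
  have hind : ∀ t ∈ S.I, S.I.indicator w t = w t := fun t ht => Set.indicator_of_mem ht _
  have h1 := mem_L2_congr hw hind
  have h2 : SolvesOn S.I S.a S.B (S.I.indicator w) (fun t => z • S.Δ t (S.I.indicator w t)) := by
    refine (solvesOn_congr_left hs hind).congr_right ?_
    filter_upwards [ae_restrict_mem S.measurableSet_I] with t ht
    rw [hind t ht]
  exact ⟨⟨_, _, mem_tmax_of_solvesOn h1 h2, rfl⟩,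
    ⟨h2, fun t ht => Set.indicator_of_notMem ht _⟩, hind⟩

/-- Von Neumann's formula, on the level of boundary values: modulo the minimal relation, each
element of the domain of the maximal relation is a sum of solutions for `z` and `z̄`. -/
theorem exists_bd_eq_add {z : ℂ} (hz : z.im ≠ 0) (y : S.domMax) :
    ∃ u ∈ S.solSpace z, ∃ p ∈ S.solSpace ((starRingEnd ℂ) z), G.bd y = G.bd u + G.bd p := by
  obtain ⟨y, ⟨y', f⟩, hp, rfl⟩ := y
  change ((y', f) : (ℝ → HBold H K) × (ℝ → HBold H K)) ∈ S.tmax at hp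
  set z' := (starRingEnd ℂ) z with hz'
  have hzz' : z' - z ≠ 0 := by
    intro h
    have := congrArg Complex.im h
    simp only [hz', Complex.sub_im, Complex.conj_im, Complex.zero_im] at this
    exact hz (by linarith)
  have hg0 : f - z' • y' ∈ S.L2 := S.L2.sub_mem hp.2.1 (S.L2.smul_mem _ hp.1)
  set M := (S.tminL2.map (S.shift z')).topologicalClosure with hM
  have : CompleteSpace M := (Submodule.isClosed_topologicalClosure _).completeSpace_coe
  obtain ⟨g₁, hg₁, g₂, hg₂, hg⟩ := M.exists_add_mem_mem_orthogonal (S.emb ⟨_, hg0⟩)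
  -- the component orthogonal to `ran (T_min - z̄)` is a solution for `z`
  obtain ⟨w, hwL, hws, hwe⟩ := exists_solution_of_forall_tmin (S := S) (h := g₂) (g := z • g₂) (by
    intro v k hvk
    have h0 : (inner ℂ (S.shift z' (v, k)) g₂ : ℂ) = 0 :=
      hg₂ _ (Submodule.le_topologicalClosure _ ⟨(v, k), hvk, rfl⟩)
    rw [← inner_conj_symm, map_eq_zero, shift_apply, inner_sub_right, inner_smul_right,
      sub_eq_zero] at h0
    rw [inner_smul_left]
    exact h0)
  have hws' : SolvesOn S.I S.a S.B w (fun t => z • S.Δ t (w t)) := by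
    refine hws.congr_right ?_
    filter_upwards [Lp.coeFn_smul z g₂, hwe] with t h1 h2
    rw [h1, Pi.smul_apply, map_smul, h2]
  -- the other component comes from the closure of the minimal relation
  obtain ⟨x, hx, v, hv, hf⟩ := exists_limit_of_mem_closure (z := z') (by simpa [hz'] using hz) hg₁
  have hadj : ∀ q r : S.L2, ((q : ℝ → HBold H K), (r : ℝ → HBold H K)) ∈ S.tmax →
      (inner ℂ v (S.emb r) : ℂ) = inner ℂ (g₁ + z' • v) (S.emb q) := by
    intro q r hqr
    refine tendsto_nhds_unique (hv.inner tendsto_const_nhds)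
      ((hf.inner tendsto_const_nhds).congr fun n => ?_)
    rw [inner_emb_emb, inner_emb_emb, ← conj_form,
      form_eq_of_mem_tmin (p := (((x n).1 : ℝ → HBold H K), ((x n).2 : ℝ → HBold H K))) (hx n) hqr,
      conj_form]
  obtain ⟨y₁, hyL, hys, hye⟩ := exists_solution_of_forall_tmin (S := S) (h := v)
    (g := g₁ + z' • v) fun q r hqr => hadj q r hqr.1
  set f₁ : ℝ → HBold H K := f - z' • y' - w + z' • y₁ with hf₁
  have hf₁L : f₁ ∈ S.L2 := S.L2.add_mem (S.L2.sub_mem hg0 hwL) (S.L2.smul_mem _ hyL)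
  have hfe : ∀ᵐ t ∂(volume.restrict S.I),
      S.root t ((g₁ + z' • v : S.LTwo) t) = S.Δ t (f₁ t) := by
    have hg' : g₁ = S.emb ⟨_, hg0⟩ - g₂ := by rw [hg, add_sub_cancel_right]
    have h3 : ∀ᵐ t ∂(volume.restrict S.I), g₁ t = S.emb ⟨_, hg0⟩ t - g₂ t := by
      rw [hg']; exact Lp.coeFn_sub _ _
    filter_upwards [Lp.coeFn_add g₁ (z' • v), Lp.coeFn_smul z' v, h3,
      ae_root_emb ⟨_, hg0⟩, hwe, hye] with t h1 h2 h3 h4 h5 h6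
    rw [h1, Pi.add_apply, h2, Pi.smul_apply, h3, map_add, map_sub, map_smul, h4, h5, h6]
    simp only [hf₁, Pi.add_apply, Pi.sub_apply, Pi.smul_apply, map_add, map_sub, map_smul]
  have hy₁ : (y₁, f₁) ∈ S.tmax := ⟨hyL, hf₁L, hys.congr_right hfe⟩
  have hbd : G.bd ⟨y₁, _, hy₁, rfl⟩ = 0 := by
    refine bd_eq_zero_of_green G fun q => ?_
    obtain ⟨q, ⟨q', r⟩, hqr, rfl⟩ := q
    refine (green G (y := ⟨y₁, _, hy₁, rfl⟩) (z := ⟨q', _, hqr, rfl⟩) hy₁ hqr).trans ?_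
    rw [sub_eq_zero, ← conj_form, ← conj_form (f := r)]
    refine congrArg _ ?_
    have h1 := form_eq_inner_emb hfe ⟨q', hqr.1⟩
    have h2 := form_eq_inner_emb hye ⟨r, hqr.2.1⟩
    exact h1.trans ((hadj ⟨q', hqr.1⟩ ⟨r, hqr.2.1⟩ hqr).symm.trans h2.symm)
  -- the remainder `y - y₁ - u` solves the system for `z̄`
  set u : ℝ → HBold H K := (z - z')⁻¹ • w with hu
  have huw : w = (z - z') • u := by
    rw [hu, smul_smul, mul_inv_cancel₀ (by rwa [← neg_sub, neg_ne_zero]), one_smul]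
  have huL : u ∈ S.L2 := S.L2.smul_mem _ hwL
  have hus : SolvesOn S.I S.a S.B u (fun t => z • S.Δ t (u t)) := by
    convert! hws'.smul (z - z')⁻¹ using 2
    simp [hu, smul_comm z]
  have hpL : y' - y₁ - u ∈ S.L2 := S.L2.sub_mem (S.L2.sub_mem hp.1 hyL) huL
  have hps : SolvesOn S.I S.a S.B (y' - y₁ - u)
      (fun t => z' • S.Δ t ((y' - y₁ - u) t)) := by
    refine ((hp.2.2.sub hy₁.2.2).sub hus).congr_right (Eventually.of_forall fun t => ?_)
    simp only [Pi.sub_apply, hf₁, Pi.add_apply, Pi.smul_apply, map_add, map_sub, map_smul, huw]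
    module
  obtain ⟨u', hu', hue⟩ := exists_mem_solSpace huL hus
  obtain ⟨p', hp', hpe⟩ := exists_mem_solSpace hpL hps
  refine ⟨u', hu', p', hp', ?_⟩
  rw [← map_add, ← sub_eq_zero, ← map_sub, ← hbd]
  refine bd_congr G fun t ht => ?_
  change y' t - ((u' : ℝ → HBold H K) t + (p' : ℝ → HBold H K) t) = y₁ t
  rw [hue t ht, hpe t ht]
  simp only [Pi.sub_apply]
  abel

end SymmetricSystem

end SymmSys

namespace SymmSys

variable {H K : Type*}
  [NormedAddCommGroup H] [InnerProductSpace ℂ H] [FiniteDimensional ℂ H]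
  [NormedAddCommGroup K] [InnerProductSpace ℂ K] [FiniteDimensional ℂ K]
  {E : Type*} [NormedAddCommGroup E] [InnerProductSpace ℂ E] [FiniteDimensional ℂ E]
  {F : Submodule ℂ E}

/-! ### The boundary form on `E ⊕ F` -/

/-- The sesquilinear form `{e, f}, {e', f'} ↦ (e, f') - (f, e') + i (P^⊥ e, P^⊥ e')` on `E ⊕ F`;
without the term in `Γ̂_b`, this is the boundary form at `b`. -/
noncomputable def pairForm (x y : E × F) : ℂ :=
  inner ℂ (y.2 : E) x.1 - inner ℂ y.1 (x.2 : E)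
    + Complex.I * inner ℂ (Fᗮ.orthogonalProjectionOnto y.1) (Fᗮ.orthogonalProjectionOnto x.1)

/-- The real quadratic form of `-i` times `pairForm`. -/
noncomputable def pairQuad (x : E × F) : ℝ :=
  2 * (inner ℂ (x.2 : E) x.1 : ℂ).im + ‖Fᗮ.orthogonalProjectionOnto x.1‖ ^ 2

theorem pairForm_self (x : E × F) : pairForm x x = Complex.I * (pairQuad x : ℂ) := by
  have h1 : (inner ℂ x.1 (x.2 : E) : ℂ) = (starRingEnd ℂ) (inner ℂ (x.2 : E) x.1) :=
    (inner_conj_symm _ _).symm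
  rw [pairForm, pairQuad, h1, Complex.sub_conj, inner_self_eq_norm_sq_to_K]
  push_cast
  simp only [RCLike.ofReal_eq_complex_ofReal]
  ring

theorem pairForm_sub_left (x x' y : E × F) :
    pairForm (x - x') y = pairForm x y - pairForm x' y := by
  simp only [pairForm, Prod.fst_sub, Prod.snd_sub, map_sub, inner_sub_right,
    AddSubgroupClass.coe_sub]
  ring

theorem pairQuad_of_fst_eq_zero {x : E × F} (h : x.1 = 0) : pairQuad x = 0 := by
  simp [pairQuad, h]

theorem pairQuad_nonneg_of_proj_eq_zero {x : E × F} (h : F.orthogonalProjectionOnto x.1 = 0) :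
    0 ≤ pairQuad x := by
  have h1 : (inner ℂ (x.2 : E) x.1 : ℂ) = 0 := by
    rw [Submodule.orthogonalProjectionOnto_eq_zero_iff] at h
    exact (Submodule.mem_orthogonal _ _).1 h _ x.2.2
  rw [pairQuad, h1]
  simp

/-- Exactness of `X → Y → Z` by a dimension count. -/
theorem _root_.LinearMap.ker_eq_range_of_finrank {X Y Z : Type*} [AddCommGroup X] [Module ℂ X]
    [AddCommGroup Y] [Module ℂ Y] [AddCommGroup Z] [Module ℂ Z] [FiniteDimensional ℂ X]
    [FiniteDimensional ℂ Y] [FiniteDimensional ℂ Z] {T : X →ₗ[ℂ] Y} {L : Y →ₗ[ℂ] Z}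
    (hT : Function.Injective T) (hL : Function.Surjective L) (h : ∀ x, L (T x) = 0)
    (hd : Module.finrank ℂ Y = Module.finrank ℂ X + Module.finrank ℂ Z) :
    LinearMap.ker L = LinearMap.range T := by
  have hle : LinearMap.range T ≤ LinearMap.ker L := by
    rintro _ ⟨x, rfl⟩; exact h x
  refine (Submodule.eq_of_le_of_finrank_eq hle ?_).symm
  have h1 := L.finrank_range_add_finrank_ker
  rw [LinearMap.range_eq_top.2 hL, finrank_top] at h1
  rw [LinearMap.finrank_range_of_inj hT]
  omega

theorem inner_imaginaryPart {V : Type*} [NormedAddCommGroup V] [InnerProductSpace ℂ V]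
    [CompleteSpace V] (A : V →L[ℂ] V) (x : V) :
    (inner ℂ x ((ℑ A : V →L[ℂ] V) x) : ℂ) = ((inner ℂ x (A x) : ℂ).im : ℂ) := by
  have h : (inner ℂ x (star A x) : ℂ) = (starRingEnd ℂ) (inner ℂ x (A x)) := by
    rw [ContinuousLinearMap.star_eq_adjoint, ContinuousLinearMap.adjoint_inner_right,
      inner_conj_symm]
  have e : (ℑ A : V →L[ℂ] V) x = (-Complex.I * (1 / 2 : ℂ)) • (A x - star A x) := by
    rw [imaginaryPart_apply_coe]
    have : (2⁻¹ : ℝ) • (A - star A) = ((1 / 2 : ℂ)) • (A - star A) := by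
      rw [← Complex.coe_smul]; norm_num
    rw [this, smul_smul]
    rfl
  rw [e, inner_smul_right, inner_sub_right, h, Complex.sub_conj]
  push_cast
  linear_combination (-((inner ℂ x (A x) : ℂ).im : ℂ)) * Complex.I_mul_I

theorem _root_.Submodule.eq_zero_of_smul_add_smul_orthogonal {V : Type*} [NormedAddCommGroup V]
    [InnerProductSpace ℂ V] {W : Submodule ℂ V} {u : W} {v : Wᗮ} {c d : ℂ} (hc : c ≠ 0)
    (hd : d ≠ 0) (h : c • (u : V) + d • (v : V) = 0) : u = 0 ∧ v = 0 := by
  have hu : u = 0 := by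
    have h1 := congrArg (fun x => (inner ℂ (u : V) x : ℂ)) h
    simp only [inner_add_right, inner_smul_right,
      (Submodule.mem_orthogonal _ _).1 v.2 _ u.2, mul_zero, add_zero, inner_zero_right] at h1
    rcases mul_eq_zero.1 h1 with h2 | h2
    · exact absurd h2 hc
    · exact Subtype.ext (inner_self_eq_zero.1 h2)
  refine ⟨hu, Subtype.ext ?_⟩
  rw [hu, Submodule.coe_zero, smul_zero, zero_add] at h
  exact (smul_eq_zero.1 h).resolve_left hd

theorem inner_comp_adjoint {V W : Type*} [NormedAddCommGroup V] [InnerProductSpace ℂ V]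
    [CompleteSpace V] [NormedAddCommGroup W] [InnerProductSpace ℂ W] [CompleteSpace W]
    (T : V →L[ℂ] W) (x : W) :
    (inner ℂ x ((T ∘L ContinuousLinearMap.adjoint T) x) : ℂ) =
      (‖ContinuousLinearMap.adjoint T x‖ : ℂ) ^ 2 := by
  rw [ContinuousLinearMap.comp_apply, ← ContinuousLinearMap.adjoint_inner_left,
    inner_self_eq_norm_sq_to_K]
  rfl

theorem _root_.Submodule.inner_coe_smul_add_smul_orthogonal {V : Type*} [NormedAddCommGroup V]
    [InnerProductSpace ℂ V] {W : Submodule ℂ V} (w u : W) (v : Wᗮ) (c d : ℂ) :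
    (inner ℂ (w : V) (c • (u : V) + d • (v : V)) : ℂ) = c * inner ℂ w u := by
  rw [inner_add_right, inner_smul_right, inner_smul_right,
    (Submodule.mem_orthogonal _ _).1 v.2 _ w.2, mul_zero, add_zero, Submodule.coe_inner]

namespace BoundaryParameter

variable (τ : BoundaryParameter F)

open ContinuousLinearMap

/-- The boundary operator `(e, f) ↦ C₀(z) e + C₁(z) f`. -/
def opC (z : ℂ) : E × F →ₗ[ℂ] E := (τ.C₀ z).toLinearMap.coprod (τ.C₁ z).toLinearMap

/-- The boundary operator `(e, f) ↦ D₀(z) e + D₁(z) f`. -/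
def opD (z : ℂ) : E × F →ₗ[ℂ] F := (τ.D₀ z).toLinearMap.coprod (τ.D₁ z).toLinearMap

theorem opC_apply (z : ℂ) (x : E × F) : τ.opC z x = τ.C₀ z x.1 + τ.C₁ z x.2 := rfl

theorem opD_apply (z : ℂ) (x : E × F) : τ.opD z x = τ.D₀ z x.1 + τ.D₁ z x.2 := rfl

/-- A parametrization of the kernel of `(C₀(z̄), C₁(z̄))` by means of the adjoints of `D₀(z)` and
`D₁(z)`. -/
noncomputable def kerC (z : ℂ) : F →ₗ[ℂ] E × F :=
  LinearMap.prod
    (-(F.subtypeL ∘L adjoint (τ.D₁ z)) +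
      Complex.I • (Fᗮ.subtypeL ∘L adjoint (τ.D₀ z ∘L Fᗮ.subtypeL))).toLinearMap
    (adjoint (τ.D₀ z ∘L F.subtypeL)).toLinearMap

/-- A parametrization of the kernel of `(D₀(z̄), D₁(z̄))` by means of the adjoints of `C₀(z)` and
`C₁(z)`. -/
noncomputable def kerD (z : ℂ) : E →ₗ[ℂ] E × F :=
  LinearMap.prod
    (F.subtypeL ∘L adjoint (τ.C₁ z) -
      Complex.I • (Fᗮ.subtypeL ∘L adjoint (τ.C₀ z ∘L Fᗮ.subtypeL))).toLinearMap
    (-(adjoint (τ.C₀ z ∘L F.subtypeL))).toLinearMap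

theorem kerC_apply (z : ℂ) (x : F) : τ.kerC z x =
    (-(adjoint (τ.D₁ z) x : E) + Complex.I • (adjoint (τ.D₀ z ∘L Fᗮ.subtypeL) x : E),
      adjoint (τ.D₀ z ∘L F.subtypeL) x) := rfl

theorem kerD_apply (z : ℂ) (x : E) : τ.kerD z x =
    ((adjoint (τ.C₁ z) x : E) - Complex.I • (adjoint (τ.C₀ z ∘L Fᗮ.subtypeL) x : E),
      -adjoint (τ.C₀ z ∘L F.subtypeL) x) := rfl

/-- The symmetry condition on a boundary parameter gives one inclusion; by the invertibility
conditions, the dimensions are equal. -/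
theorem ker_opC {z : ℂ} (hz : z.im < 0) :
    LinearMap.ker (τ.opC ((starRingEnd ℂ) z)) = LinearMap.range (τ.kerC z) := by
  have hz' : 0 < ((starRingEnd ℂ) z).im := by simpa using hz
  refine LinearMap.ker_eq_range_of_finrank ?_ ?_ ?_ ?_
  · rw [← LinearMap.ker_eq_bot, LinearMap.ker_eq_bot']
    intro x hx
    rw [kerC_apply, Prod.mk_eq_zero] at hx
    have h1 : adjoint (τ.D₁ z) x = 0 :=
      (Submodule.eq_zero_of_smul_add_smul_orthogonal (c := -1) (d := Complex.I) (by simp)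
        Complex.I_ne_zero (by simpa using hx.1)).1
    have h2 : adjoint (τ.D₀ z ∘L F.subtypeL + Complex.I • τ.D₁ z) x = 0 := by
      rw [map_add, map_smulₛₗ, add_apply, hx.2, smul_apply, h1, smul_zero, add_zero]
    have hu := (τ.isUnit_D z hz).star
    rw [star_eq_adjoint] at hu
    obtain ⟨v, hv⟩ := hu.exists_left_inv
    have h3 := DFunLike.congr_fun hv x
    change v (adjoint (τ.D₀ z ∘L F.subtypeL + Complex.I • τ.D₁ z) x) = x at h3
    rw [← h3, h2, map_zero]
  · intro x
    obtain ⟨v, hv⟩ := (τ.isUnit_C _ hz').exists_right_inv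
    refine ⟨(v x, -(Complex.I • F.orthogonalProjectionOnto (v x))), ?_⟩
    have h := DFunLike.congr_fun hv x
    rw [opC_apply, map_neg, map_smul, ← sub_eq_add_neg]
    exact h
  · intro x
    have h := DFunLike.congr_fun (τ.symmetric _ hz') x
    simp only [Complex.conj_conj] at h
    rw [opC_apply, kerC_apply, map_add, map_neg, map_smul]
    have h' : τ.C₁ ((starRingEnd ℂ) z) (adjoint (τ.D₀ z ∘L F.subtypeL) x)
      - τ.C₀ ((starRingEnd ℂ) z) (adjoint (τ.D₁ z) x : E)
      + Complex.I • τ.C₀ ((starRingEnd ℂ) z) (adjoint (τ.D₀ z ∘L Fᗮ.subtypeL) x : E) = 0 := h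
    rw [← h']
    abel
  · rw [Module.finrank_prod, add_comm]

/-- The counterpart of `ker_opC` for `(D₀(z̄), D₁(z̄))`. -/
theorem ker_opD {z : ℂ} (hz : 0 < z.im) :
    LinearMap.ker (τ.opD ((starRingEnd ℂ) z)) = LinearMap.range (τ.kerD z) := by
  have hz' : ((starRingEnd ℂ) z).im < 0 := by simpa using hz
  refine LinearMap.ker_eq_range_of_finrank ?_ ?_ ?_ ?_
  · rw [← LinearMap.ker_eq_bot, LinearMap.ker_eq_bot']
    intro x hx
    rw [kerD_apply, Prod.mk_eq_zero] at hx
    obtain ⟨h1, h2⟩ := Submodule.eq_zero_of_smul_add_smul_orthogonal (u := adjoint (τ.C₁ z) x)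
      (v := adjoint (τ.C₀ z ∘L Fᗮ.subtypeL) x) (c := 1) (d := -Complex.I) (by simp)
        (by simp) (by simpa [sub_eq_add_neg] using hx.1)
    have h3 : adjoint (τ.C₀ z ∘L F.subtypeL) x = 0 := neg_eq_zero.1 hx.2
    have h4 : adjoint (τ.C₀ z) x = 0 := by
      refine ext_inner_left ℂ fun w => ?_
      rw [adjoint_inner_right, inner_zero_right]
      have hw : w = (F.orthogonalProjectionOnto w : E) + (Fᗮ.orthogonalProjectionOnto w : E) :=
        (F.starProjection_add_starProjection_orthogonal w).symm
      have e1 : (inner ℂ (τ.C₀ z (F.orthogonalProjectionOnto w : E)) x : ℂ) = 0 := by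
        have := adjoint_inner_right (τ.C₀ z ∘L F.subtypeL) (F.orthogonalProjectionOnto w) x
        rw [h3, inner_zero_right] at this
        exact this.symm
      have e2 : (inner ℂ (τ.C₀ z (Fᗮ.orthogonalProjectionOnto w : E)) x : ℂ) = 0 := by
        have := adjoint_inner_right (τ.C₀ z ∘L Fᗮ.subtypeL) (Fᗮ.orthogonalProjectionOnto w) x
        rw [h2, inner_zero_right] at this
        exact this.symm
      rw [hw, map_add, inner_add_left, e1, e2, add_zero]
    have h5 : adjoint (τ.C₀ z - Complex.I • (τ.C₁ z ∘L F.orthogonalProjectionOnto)) x = 0 := by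
      rw [map_sub, map_smulₛₗ, adjoint_comp, sub_apply, smul_apply, comp_apply, h1, h4]
      simp
    have hu := (τ.isUnit_C z hz).star
    rw [star_eq_adjoint] at hu
    obtain ⟨v, hv⟩ := hu.exists_left_inv
    have h6 := DFunLike.congr_fun hv x
    change v (adjoint (τ.C₀ z - Complex.I • (τ.C₁ z ∘L F.orthogonalProjectionOnto)) x) = x at h6
    rw [← h6, h5, map_zero]
  · intro x
    obtain ⟨v, hv⟩ := (τ.isUnit_D _ hz').exists_right_inv
    refine ⟨((v x : E), Complex.I • v x), ?_⟩
    have h := DFunLike.congr_fun hv x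
    rw [opD_apply, map_smul]
    exact h
  · intro x
    have h := congrArg (fun T => adjoint T x) (τ.symmetric z hz)
    simp only [map_add, map_sub, map_smulₛₗ, adjoint_comp, adjoint_adjoint, map_zero,
      add_apply, sub_apply, smul_apply, comp_apply, zero_apply, Complex.conj_I] at h
    rw [opD_apply, kerD_apply, map_sub, map_neg, map_smul, ← h]
    simp only [Submodule.subtypeL_apply, neg_smul]
    simp only [adjoint_comp, comp_apply]
    abel
  · rw [Module.finrank_prod]

theorem proj_orthogonal_add (u : F) (v : Fᗮ) (c d : ℂ) :
    Fᗮ.orthogonalProjectionOnto (c • (u : E) + d • (v : E)) = d • v := by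
  rw [map_add, map_smul, map_smul, Submodule.orthogonalProjectionOnto_orthogonal_apply_eq_zero u.2,
    Submodule.orthogonalProjectionOnto_mem_subspace_eq_self, smul_zero, zero_add]

theorem kerC_fst (z : ℂ) (x : F) : (τ.kerC z x).1 = (-1 : ℂ) • (adjoint (τ.D₁ z) x : E) +
    Complex.I • (adjoint (τ.D₀ z ∘L Fᗮ.subtypeL) x : E) := by
  rw [kerC_apply, neg_one_smul]

theorem kerD_fst (z : ℂ) (x : E) : (τ.kerD z x).1 = (1 : ℂ) • (adjoint (τ.C₁ z) x : E) +
    (-Complex.I) • (adjoint (τ.C₀ z ∘L Fᗮ.subtypeL) x : E) := by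
  rw [kerD_apply, one_smul, neg_smul, sub_eq_add_neg]

/-- The kernel of `(C₀(z), C₁(z))` is a nonpositive subspace: this is the sign condition on
`(D₀(z̄), D₁(z̄))`, read on the parametrization `kerC`. -/
theorem pairQuad_nonpos {z : ℂ} (hz : 0 < z.im) {x : E × F} (hx : τ.opC z x = 0) :
    pairQuad x ≤ 0 := by
  set z' := (starRingEnd ℂ) z with hz'
  have hz'' : z'.im < 0 := by simpa [hz'] using hz
  have hk := τ.ker_opC hz''
  rw [hz', Complex.conj_conj, ← hz'] at hk
  obtain ⟨w, rfl⟩ : x ∈ LinearMap.range (τ.kerC z') := hk ▸ hx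
  have h1 := ((nonneg_iff_isPositive _).1
    (sub_nonneg.2 (τ.accumulative z' hz''))).re_inner_nonneg_right w
  rw [zero_sub, neg_apply, inner_neg_right, add_apply, smul_apply, inner_add_right,
    inner_smul_right, inner_imaginaryPart, inner_comp_adjoint, comp_apply, ← adjoint_inner_left,
    ← inner_conj_symm] at h1
  rw [pairQuad, kerC_fst, proj_orthogonal_add, norm_smul, kerC_apply,
    Submodule.inner_coe_smul_add_smul_orthogonal]
  simp only [Complex.conj_im, map_neg, map_add, RCLike.re_to_complex, Complex.mul_re,
    ← Complex.ofReal_pow, Complex.ofReal_re, Complex.ofReal_im,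
    mul_zero, sub_zero, Complex.re_ofNat] at h1
  simp only [neg_one_mul, Complex.neg_im, Complex.norm_I, one_mul]
  linarith

/-- The kernel of `(D₀(z), D₁(z))` is a nonnegative subspace: this is the sign condition on
`(C₀(z̄), C₁(z̄))`, read on the parametrization `kerD`. -/
theorem pairQuad_nonneg {z : ℂ} (hz : z.im < 0) {x : E × F} (hx : τ.opD z x = 0) :
    0 ≤ pairQuad x := by
  set z' := (starRingEnd ℂ) z with hz'
  have hz'' : 0 < z'.im := by simpa [hz'] using hz
  have hk := τ.ker_opD hz''
  rw [hz', Complex.conj_conj, ← hz'] at hk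
  obtain ⟨w, rfl⟩ : x ∈ LinearMap.range (τ.kerD z') := hk ▸ hx
  have h1 := ((nonneg_iff_isPositive _).1 (τ.dissipative z' hz'')).re_inner_nonneg_right w
  rw [add_apply, smul_apply, inner_add_right,
    inner_smul_right, inner_imaginaryPart, inner_comp_adjoint, comp_apply, ← adjoint_inner_left,
    ← inner_conj_symm] at h1
  rw [pairQuad, kerD_fst, proj_orthogonal_add, norm_smul, kerD_apply,
    Submodule.inner_coe_smul_add_smul_orthogonal]
  simp only [Complex.conj_im, map_add, RCLike.re_to_complex, Complex.mul_re,
    ← Complex.ofReal_pow, Complex.ofReal_re, Complex.ofReal_im,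
    mul_zero, sub_zero, Complex.re_ofNat] at h1
  simp only [inner_neg_left, norm_neg, Complex.neg_im, Complex.norm_I, one_mul]
  linarith

/-- The kernels of `(C₀(z), C₁(z))` and `(D₀(z̄), D₁(z̄))` are orthogonal in the boundary form. -/
theorem pairForm_eq_zero {z : ℂ} (hz : 0 < z.im) {x y : E × F} (hx : τ.opC z x = 0)
    (hy : τ.opD ((starRingEnd ℂ) z) y = 0) : pairForm x y = 0 := by
  set z' := (starRingEnd ℂ) z with hz'
  have hz'' : z'.im < 0 := by simpa [hz'] using hz
  have hk := τ.ker_opC hz''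
  rw [hz', Complex.conj_conj, ← hz'] at hk
  obtain ⟨w, rfl⟩ : x ∈ LinearMap.range (τ.kerC z') := hk ▸ hx
  have h0 : (inner ℂ (τ.opD z' y) w : ℂ) = 0 := by rw [hy, inner_zero_left]
  have hd : y.1 = (F.orthogonalProjectionOnto y.1 : E) + (Fᗮ.orthogonalProjectionOnto y.1 : E) :=
    (F.starProjection_add_starProjection_orthogonal y.1).symm
  have e1 : (inner ℂ (τ.D₀ z' (F.orthogonalProjectionOnto y.1 : E)) w : ℂ) =
      inner ℂ (F.orthogonalProjectionOnto y.1) (adjoint (τ.D₀ z' ∘L F.subtypeL) w) :=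
    (adjoint_inner_right (τ.D₀ z' ∘L F.subtypeL) _ _).symm
  have e2 : (inner ℂ (τ.D₀ z' (Fᗮ.orthogonalProjectionOnto y.1 : E)) w : ℂ) =
      inner ℂ (Fᗮ.orthogonalProjectionOnto y.1) (adjoint (τ.D₀ z' ∘L Fᗮ.subtypeL) w) :=
    (adjoint_inner_right (τ.D₀ z' ∘L Fᗮ.subtypeL) _ _).symm
  have e3 : (inner ℂ y.1 (adjoint (τ.D₀ z' ∘L F.subtypeL) w : E) : ℂ) =
      inner ℂ (F.orthogonalProjectionOnto y.1) (adjoint (τ.D₀ z' ∘L F.subtypeL) w) :=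
    (Submodule.inner_orthogonalProjectionOnto_eq_of_mem_right _ _).symm
  rw [opD_apply, hd, map_add, inner_add_left, inner_add_left, e1, e2,
    ← adjoint_inner_right (τ.D₁ z')] at h0
  rw [pairForm, kerC_fst, proj_orthogonal_add, kerC_apply,
    Submodule.inner_coe_smul_add_smul_orthogonal, e3, inner_smul_right]
  linear_combination (inner ℂ (Fᗮ.orthogonalProjectionOnto y.1)
    (adjoint (τ.D₀ z' ∘L Fᗮ.subtypeL) w)) * Complex.I_mul_I - h0

end BoundaryParameter
end SymmSys

namespace SymmSys

variable {H K : Type*}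
  [NormedAddCommGroup H] [InnerProductSpace ℂ H] [FiniteDimensional ℂ H]
  [NormedAddCommGroup K] [InnerProductSpace ℂ K] [FiniteDimensional ℂ K]
  {E : Type*} [NormedAddCommGroup E] [InnerProductSpace ℂ E] [FiniteDimensional ℂ E]
  {F : Submodule ℂ E}

/-! ### Boundary values and the boundary value problem -/

namespace SymmetricSystem

variable {S : SymmetricSystem H K} (U : HBold H K →L[ℂ] HBold H K) (G : BoundaryMap S F)

theorem inner_toLp_toLp {V W : Type*} [NormedAddCommGroup V] [InnerProductSpace ℂ V]
    [NormedAddCommGroup W] [InnerProductSpace ℂ W] (v v' : V) (w w' : W) :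
    (inner ℂ (WithLp.toLp 2 (v, w)) (WithLp.toLp 2 (v', w')) : ℂ) = inner ℂ v v' + inner ℂ w w' :=
  WithLp.prod_inner_apply _ _

/-- The boundary value `{-Γ_{1a} y, i (Γ̂_a - Γ̂_b) y}`, which is prescribed in the definition of
`v_τ`. -/
noncomputable def hvec : S.domMax →ₗ[ℂ] HZero H K where
  toFun y := WithLp.toLp 2 (-(U ((y : ℝ → HBold H K) S.a)).snd,
    Complex.I • ((U ((y : ℝ → HBold H K) S.a)).fst.snd - G.Γhat y))
  map_add' y w := by
    have h : U (((y + w : S.domMax) : ℝ → HBold H K) S.a) =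
      U ((y : ℝ → HBold H K) S.a) + U ((w : ℝ → HBold H K) S.a) := U.map_add _ _
    rw [h, map_add]
    refine WithLp.ofLp_injective 2 (Prod.ext ?_ ?_)
    · change -(_ + _) = -_ + -_
      exact neg_add _ _
    · change Complex.I • (_ + _ - (_ + _)) = Complex.I • (_ - _) + Complex.I • (_ - _)
      rw [← smul_add, add_sub_add_comm]
      rfl
  map_smul' c y := by
    have h : U (((c • y : S.domMax) : ℝ → HBold H K) S.a) =
      c • U ((y : ℝ → HBold H K) S.a) := U.map_smul _ _
    rw [h, map_smul]
    refine WithLp.ofLp_injective 2 (Prod.ext ?_ ?_)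
    · change -(c • _) = c • -_
      exact (smul_neg _ _).symm
    · change Complex.I • (c • _ - c • _) = c • (Complex.I • (_ - _))
      rw [← smul_sub, smul_comm]
      rfl

/-- The boundary value `{Γ_{0a} y, ½ (Γ̂_a + Γ̂_b) y}`; on the solution `v_τ h` it is the value
`m_τ h` of the `m`-function. -/
noncomputable def mvec : S.domMax →ₗ[ℂ] HZero H K where
  toFun y := WithLp.toLp 2 ((U ((y : ℝ → HBold H K) S.a)).fst.fst,
    (1 / 2 : ℂ) • ((U ((y : ℝ → HBold H K) S.a)).fst.snd + G.Γhat y))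
  map_add' y w := by
    have h : U (((y + w : S.domMax) : ℝ → HBold H K) S.a) =
      U ((y : ℝ → HBold H K) S.a) + U ((w : ℝ → HBold H K) S.a) := U.map_add _ _
    rw [h, map_add]
    refine WithLp.ofLp_injective 2 (Prod.ext rfl ?_)
    change (1 / 2 : ℂ) • (_ + _ + (_ + _)) = (1 / 2 : ℂ) • (_ + _) + (1 / 2 : ℂ) • (_ + _)
    rw [← smul_add, add_add_add_comm]
    rfl
  map_smul' c y := by
    have h : U (((c • y : S.domMax) : ℝ → HBold H K) S.a) =
      c • U ((y : ℝ → HBold H K) S.a) := U.map_smul _ _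
    rw [h, map_smul]
    refine WithLp.ofLp_injective 2 (Prod.ext rfl ?_)
    change (1 / 2 : ℂ) • (c • _ + c • _) = c • ((1 / 2 : ℂ) • (_ + _))
    rw [← smul_add, smul_comm]
    rfl

/-- The boundary values `{Γ_{0b} y, Γ_{1b} y}`. -/
noncomputable def endPair : S.domMax →ₗ[ℂ] E × F := G.Γ₀.prod G.Γ₁

theorem endPair_apply (y : S.domMax) : endPair G y = (G.Γ₀ y, G.Γ₁ y) := rfl

theorem hvec_apply (y : S.domMax) : hvec U G y =
    WithLp.toLp 2 (-(U ((y : ℝ → HBold H K) S.a)).snd,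
      Complex.I • ((U ((y : ℝ → HBold H K) S.a)).fst.snd - G.Γhat y)) := rfl

theorem mvec_apply (y : S.domMax) : mvec U G y =
    WithLp.toLp 2 ((U ((y : ℝ → HBold H K) S.a)).fst.fst,
      (1 / 2 : ℂ) • ((U ((y : ℝ → HBold H K) S.a)).fst.snd + G.Γhat y)) := rfl

variable {U}

/-- The boundary terms of Green's identity at `a` and `b` together.  Those with `Γ̂_a` and `Γ̂_b`
combine by `(p, p') - (q, q') = ½ (p - q, p' + q') + ½ (p + q, p' - q')`. -/
theorem bracket_sub_inner_J (hU : IsJUnitary U) (y w : S.domMax) :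
    G.bracket y w - inner ℂ ((w : ℝ → HBold H K) S.a) (J H K ((y : ℝ → HBold H K) S.a)) =
      pairForm (endPair G y) (endPair G w) + inner ℂ (hvec U G w) (mvec U G y)
        - inner ℂ (mvec U G w) (hvec U G y) := by
  rw [← hU.inner_J, inner_J_right, hvec_apply, hvec_apply, mvec_apply, mvec_apply,
    inner_toLp_toLp, inner_toLp_toLp, endPair_apply, endPair_apply]
  simp only [BoundaryMap.bracket, pairForm, inner_neg_left, inner_neg_right, inner_smul_left,
    inner_smul_right, inner_add_left, inner_add_right, inner_sub_left, inner_sub_right,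
    Complex.conj_I, map_div₀, map_one, map_ofNat]
  ring

/-- Green's identity for the solutions of `J y' - B y = z Δ y` and `J w' - B w = z' Δ w`. -/
theorem green_solSpace (hU : IsJUnitary U) {z z' : ℂ} {y w : S.domMax} (hy : y ∈ S.solSpace z)
    (hw : w ∈ S.solSpace z') :
    (z - (starRingEnd ℂ) z') * S.form (y : ℝ → HBold H K) (w : ℝ → HBold H K) =
      pairForm (endPair G y) (endPair G w) + inner ℂ (hvec U G w) (mvec U G y)
        - inner ℂ (mvec U G w) (hvec U G y) := by
  rw [← bracket_sub_inner_J G hU, green G (mem_tmax_of_mem_solSpace hy)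
    (mem_tmax_of_mem_solSpace hw)]
  have h1 : S.form (z • (y : ℝ → HBold H K)) (w : ℝ → HBold H K) =
      z * S.form (y : ℝ → HBold H K) (w : ℝ → HBold H K) := by
    simp only [form, Pi.smul_apply, map_smul, inner_smul_right]
    exact integral_const_mul _ _
  have h2 : S.form (y : ℝ → HBold H K) (z' • (w : ℝ → HBold H K)) =
      (starRingEnd ℂ) z' * S.form (y : ℝ → HBold H K) (w : ℝ → HBold H K) := by
    simp only [form, Pi.smul_apply, inner_smul_left]
    exact integral_const_mul _ _
  rw [h1, h2, sub_mul]

/-- The class of an element of `dom T_max` in `L²_Δ(I)`. -/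
noncomputable def cls : S.domMax →ₗ[ℂ] S.LTwo :=
  S.emb ∘ₗ Submodule.inclusion (fun _ hy => mem_L2_of_domMax ⟨_, hy⟩)

theorem inner_cls_cls (y w : S.domMax) :
    (inner ℂ (cls w) (cls y) : ℂ) = S.form (y : ℝ → HBold H K) (w : ℝ → HBold H K) :=
  S.inner_emb_emb _ _

theorem form_self (y : S.domMax) :
    S.form (y : ℝ → HBold H K) (y : ℝ → HBold H K) = ((‖cls y‖ ^ 2 : ℝ) : ℂ) := by
  rw [← inner_cls_cls, inner_self_eq_norm_sq_to_K]
  push_cast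
  rfl

theorem two_im_mul_norm_sq (hU : IsJUnitary U) {z : ℂ} {y : S.domMax} (hy : y ∈ S.solSpace z) :
    2 * z.im * ‖cls y‖ ^ 2 =
      pairQuad (endPair G y) + 2 * (inner ℂ (hvec U G y) (mvec U G y) : ℂ).im := by
  have h := green_solSpace G hU hy hy
  rw [form_self, Complex.sub_conj, pairForm_self, add_sub_assoc,
    ← inner_conj_symm (mvec U G y), Complex.sub_conj] at h
  have := congrArg Complex.im h
  simp only [Complex.mul_im, Complex.add_im, Complex.ofReal_im, Complex.ofReal_re, Complex.I_re,
    Complex.I_im, Complex.mul_re] at this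
  linarith

theorem eq_zero_of_cls_eq_zero {z : ℂ} {y : S.domMax} (hy : y ∈ S.solSpace z) (h : cls y = 0) :
    y = 0 := by
  refine Subtype.ext (funext fun t => ?_)
  by_cases ht : t ∈ S.I
  · refine S.definite z _ hy.1 ?_ t ht
    have h1 := S.ae_root_root (y : ℝ → HBold H K)
    have h2 := S.coeFn_emb ⟨_, mem_L2_of_domMax y⟩
    have h3 : S.emb ⟨_, mem_L2_of_domMax y⟩ = 0 := h
    rw [h3] at h2
    filter_upwards [h1, h2, Lp.coeFn_zero (HBold H K) 2 (volume.restrict S.I)] with t e1 e2 e3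
    rw [← e1, ← e2, e3, Pi.zero_apply, map_zero]
  · exact hy.2 t ht

theorem eq_zero_of_hvec_eq_zero (hU : IsJUnitary U) {z : ℂ} (hz : z.im ≠ 0) {y : S.domMax}
    (hy : y ∈ S.solSpace z) (h0 : hvec U G y = 0) (hq : z.im * pairQuad (endPair G y) ≤ 0) :
    y = 0 := by
  refine eq_zero_of_cls_eq_zero hy ?_
  have h := two_im_mul_norm_sq G hU hy
  rw [h0, inner_zero_left, Complex.zero_im, mul_zero, add_zero] at h
  rw [← h] at hq
  have h1 : 0 < z.im ^ 2 := by positivity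
  have h2 : ‖cls y‖ ^ 2 ≤ 0 := by
    by_contra hc
    push Not at hc
    have := mul_pos h1 hc
    nlinarith
  simpa using h2

/-- The boundary values `hvec` and `L (Γ_{0b}, Γ_{1b})`. -/
noncomputable def bvp {X : Type*} [AddCommGroup X] [Module ℂ X] (U : HBold H K →L[ℂ] HBold H K)
    (L : E × F →ₗ[ℂ] X) : S.domMax →ₗ[ℂ] HZero H K × X :=
  (hvec U G).prod (L ∘ₗ endPair G)

section bvp

variable {X : Type*} [AddCommGroup X] [Module ℂ X] {L : E × F →ₗ[ℂ] X} {z : ℂ}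

theorem eq_zero_of_bvp_eq_zero (hU : IsJUnitary U) (hz : z.im ≠ 0)
    (hL : ∀ x, L x = 0 → z.im * pairQuad x ≤ 0) :
    ∀ y ∈ S.solSpace z, bvp G U L y = 0 → y = 0 := by
  intro y hy h
  obtain ⟨h1, h2⟩ := Prod.mk_eq_zero.1 h
  exact eq_zero_of_hvec_eq_zero G hU hz hy h1 (hL _ h2)

variable (F) in
/-- The map `(e, f) ↦ P_F e`. -/
noncomputable def projFst : E × F →ₗ[ℂ] F :=
  F.orthogonalProjectionOnto.toLinearMap ∘ₗ LinearMap.fst ℂ E F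

/-- The targets of the two simplest boundary value problems, with `Γ_{0b} y` prescribed in `ℂ₊` and
`P_F Γ_{0b} y` in `ℂ₋`, have together the dimension of the space of all boundary values. -/
theorem finrank_boundary : Module.finrank ℂ (HZero H K × E) + Module.finrank ℂ (HZero H K × F) =
    Module.finrank ℂ (HBold H K × E × K × F) := by
  simp only [Module.finrank_prod, (WithLp.linearEquiv 2 ℂ (HZero H K × H)).finrank_eq,
    (WithLp.linearEquiv 2 ℂ (H × K)).finrank_eq]
  ring

/-- Let `T₁` and `T₂` be injective on `N₁` and `N₂`, and let `b(N₁) + b(N₂)` be the whole space.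
If the dimensions of the targets fit, then `T₁` maps `N₁` onto its target. -/
theorem exists_mem_apply_eq_of_finrank_le {V W A₁ A₂ : Type*} [AddCommGroup V] [Module ℂ V]
    [AddCommGroup W] [Module ℂ W] [AddCommGroup A₁] [Module ℂ A₁] [AddCommGroup A₂] [Module ℂ A₂]
    [FiniteDimensional ℂ W] [FiniteDimensional ℂ A₁] [FiniteDimensional ℂ A₂]
    {N₁ N₂ : Submodule ℂ V} {T₁ : V →ₗ[ℂ] A₁} {T₂ : V →ₗ[ℂ] A₂} {b : V →ₗ[ℂ] W}
    (h₁ : ∀ y ∈ N₁, T₁ y = 0 → y = 0) (h₂ : ∀ y ∈ N₂, T₂ y = 0 → y = 0)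
    (hb : ∀ x, ∃ u ∈ N₁, ∃ p ∈ N₂, b u + b p = x)
    (hd : Module.finrank ℂ A₁ + Module.finrank ℂ A₂ ≤ Module.finrank ℂ W) (x : A₁) :
    ∃ y ∈ N₁, T₁ y = x := by
  have i₁ : Function.Injective (T₁ ∘ₗ N₁.subtype) :=
    (injective_iff_map_eq_zero _).2 fun y hy => Subtype.ext (h₁ y y.2 hy)
  have i₂ : Function.Injective (T₂ ∘ₗ N₂.subtype) :=
    (injective_iff_map_eq_zero _).2 fun y hy => Subtype.ext (h₂ y y.2 hy)
  have f₁ : FiniteDimensional ℂ N₁ := Module.Finite.of_injective _ i₁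
  have f₂ : FiniteDimensional ℂ N₂ := Module.Finite.of_injective _ i₂
  have hs : Function.Surjective ((b ∘ₗ N₁.subtype).coprod (b ∘ₗ N₂.subtype)) := by
    intro x
    obtain ⟨u, hu, p, hp, h⟩ := hb x
    exact ⟨(⟨u, hu⟩, ⟨p, hp⟩), h⟩
  have n₁ := LinearMap.finrank_le_finrank_of_injective i₁
  have n₂ := LinearMap.finrank_le_finrank_of_injective i₂
  have n₃ := LinearMap.finrank_le_finrank_of_surjective hs
  rw [Module.finrank_prod] at n₃
  obtain ⟨y, hy⟩ := (LinearMap.injective_iff_surjective_of_finrank_eq_finrank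
    (by omega : Module.finrank ℂ N₁ = Module.finrank ℂ A₁)).1 i₁ x
  exact ⟨y, y.2, hy⟩

theorem exists_add_eq_bd (hz : z.im ≠ 0) (x : HBold H K × E × K × F) :
    ∃ u ∈ S.solSpace z, ∃ p ∈ S.solSpace ((starRingEnd ℂ) z), G.bd u + G.bd p = x := by
  obtain ⟨y, rfl⟩ := bd_surjective G x
  obtain ⟨u, hu, p, hp, h⟩ := exists_bd_eq_add G hz y
  exact ⟨u, hu, p, hp, h.symm⟩

/-- In the upper half-plane, a boundary value problem with a nonpositive condition of the right
codimension is solvable: by uniqueness in this problem and in that with the condition `P_F Γ_{0b} y`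
for `z̄`, the solution spaces are not too large, and by von Neumann's formula they are not too
small. -/
theorem exists_bvp_eq_of_im_pos [FiniteDimensional ℂ X] (hU : IsJUnitary U) (hz : 0 < z.im)
    (hX : Module.finrank ℂ X = Module.finrank ℂ E) (hL : ∀ x, L x = 0 → pairQuad x ≤ 0) :
    ∀ x, ∃ y ∈ S.solSpace z, bvp G U L y = x := by
  have hz' : ((starRingEnd ℂ) z).im < 0 := by simpa using hz
  refine exists_mem_apply_eq_of_finrank_le (T₂ := bvp G U (projFst F))
    (eq_zero_of_bvp_eq_zero G hU hz.ne' fun x hx =>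
      mul_nonpos_of_nonneg_of_nonpos hz.le (hL x hx))
    (eq_zero_of_bvp_eq_zero G hU hz'.ne fun x hx =>
      mul_nonpos_of_nonpos_of_nonneg hz'.le (pairQuad_nonneg_of_proj_eq_zero hx))
    (exists_add_eq_bd G hz.ne') ?_
  rw [← finrank_boundary, Module.finrank_prod, Module.finrank_prod, Module.finrank_prod, hX]

/-- The counterpart of `exists_bvp_eq_of_im_pos` in the lower half-plane. -/
theorem exists_bvp_eq_of_im_neg [FiniteDimensional ℂ X] (hU : IsJUnitary U) (hz : z.im < 0)
    (hX : Module.finrank ℂ X = Module.finrank ℂ F) (hL : ∀ x, L x = 0 → 0 ≤ pairQuad x) :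
    ∀ x, ∃ y ∈ S.solSpace z, bvp G U L y = x := by
  have hz' : 0 < ((starRingEnd ℂ) z).im := by simpa using hz
  refine exists_mem_apply_eq_of_finrank_le (T₂ := bvp G U (LinearMap.fst ℂ E F))
    (eq_zero_of_bvp_eq_zero G hU hz.ne fun x hx =>
      mul_nonpos_of_nonpos_of_nonneg hz.le (hL x hx))
    (eq_zero_of_bvp_eq_zero G hU hz'.ne' fun x hx => by
      rw [pairQuad_of_fst_eq_zero hx, mul_zero])
    (exists_add_eq_bd G hz.ne) ?_
  rw [← finrank_boundary, Module.finrank_prod, Module.finrank_prod, Module.finrank_prod, hX,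
    add_comm]

theorem exists_linear_section {V A : Type*} [AddCommGroup V] [Module ℂ V] [AddCommGroup A]
    [Module ℂ A] {N : Submodule ℂ V} {T : V →ₗ[ℂ] A} (hi : ∀ y ∈ N, T y = 0 → y = 0)
    (hs : ∀ x, ∃ y ∈ N, T y = x) : ∃ R : A →ₗ[ℂ] V, (∀ x, R x ∈ N) ∧ ∀ x, T (R x) = x := by
  have i : Function.Injective (T ∘ₗ N.subtype) :=
    (injective_iff_map_eq_zero _).2 fun y hy => Subtype.ext (hi y y.2 hy)
  have s : Function.Surjective (T ∘ₗ N.subtype) := fun x => by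
    obtain ⟨y, hy, rfl⟩ := hs x
    exact ⟨⟨y, hy⟩, rfl⟩
  exact ⟨N.subtype ∘ₗ (LinearEquiv.ofBijective _ ⟨i, s⟩).symm.toLinearMap,
    fun x => Subtype.prop _, fun x => (LinearEquiv.ofBijective _ ⟨i, s⟩).apply_symm_apply x⟩

end bvp

end SymmetricSystem

/-! ### The solutions `v_τ` -/

namespace BoundaryParameter

open Classical in
/-- The boundary condition at `b` for the parameter `z`: the kernel of `(C₀(z), C₁(z))` if
`z ∈ ℂ₊`, and of `(D₀(z), D₁(z))` otherwise. -/
noncomputable def bc (τ : BoundaryParameter F) (z : ℂ) : Submodule ℂ (E × F) :=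
  if 0 < z.im then LinearMap.ker (τ.opC z) else LinearMap.ker (τ.opD z)

variable {τ : BoundaryParameter F}

theorem bc_of_im_pos {z : ℂ} (hz : 0 < z.im) : τ.bc z = LinearMap.ker (τ.opC z) := if_pos hz

theorem bc_of_im_neg {z : ℂ} (hz : z.im < 0) : τ.bc z = LinearMap.ker (τ.opD z) :=
  if_neg hz.not_gt

theorem im_mul_pairQuad_nonpos {z : ℂ} (hz : z.im ≠ 0) {x : E × F} (hx : x ∈ τ.bc z) :
    z.im * pairQuad x ≤ 0 := by
  rcases hz.lt_or_gt with h | h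
  · rw [bc_of_im_neg h] at hx
    exact mul_nonpos_of_nonpos_of_nonneg h.le (τ.pairQuad_nonneg h hx)
  · rw [bc_of_im_pos h] at hx
    exact mul_nonpos_of_nonneg_of_nonpos h.le (τ.pairQuad_nonpos h hx)

theorem _root_.SymmSys.conj_pairForm (x y : E × F) :
    (starRingEnd ℂ) (pairForm x y) = -pairForm y x := by
  simp only [pairForm, map_add, map_sub, map_mul, inner_conj_symm, Complex.conj_I]
  ring

theorem pairForm_eq_zero_of_mem_bc {z : ℂ} (hz : z.im ≠ 0) {x y : E × F} (hx : x ∈ τ.bc z)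
    (hy : y ∈ τ.bc ((starRingEnd ℂ) z)) : pairForm x y = 0 := by
  rcases hz.lt_or_gt with h | h
  · have h' : 0 < ((starRingEnd ℂ) z).im := by simpa using h
    rw [bc_of_im_neg h] at hx
    rw [bc_of_im_pos h'] at hy
    have := τ.pairForm_eq_zero h' hy (y := x) (by rw [Complex.conj_conj]; exact hx)
    rw [← map_eq_zero (starRingEnd ℂ), conj_pairForm, this, neg_zero]
  · have h' : ((starRingEnd ℂ) z).im < 0 := by simpa using h
    rw [bc_of_im_pos h] at hx
    rw [bc_of_im_neg h'] at hy
    exact τ.pairForm_eq_zero h hx hy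

end BoundaryParameter

namespace SymmetricSystem

variable {S : SymmetricSystem H K} {U : HBold H K →L[ℂ] HBold H K} (G : BoundaryMap S F)
  (τ : BoundaryParameter F)

/-- The solutions for the parameter `z` satisfying the boundary condition `τ` at `b`. -/
noncomputable def weylSpace (z : ℂ) : Submodule ℂ S.domMax :=
  S.solSpace z ⊓ (τ.bc z).comap (endPair G)

variable {z : ℂ}

theorem eq_zero_of_mem_weylSpace (hU : IsJUnitary U) (hz : z.im ≠ 0) :
    ∀ y ∈ weylSpace G τ z, hvec U G y = 0 → y = 0 :=
  fun _ hy h => eq_zero_of_hvec_eq_zero G hU hz hy.1 h (τ.im_mul_pairQuad_nonpos hz hy.2)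

theorem exists_mem_weylSpace (hU : IsJUnitary U) (hz : z.im ≠ 0) (h : HZero H K) :
    ∃ y ∈ weylSpace G τ z, hvec U G y = h := by
  rcases hz.lt_or_gt with hz' | hz'
  · obtain ⟨y, hy, h'⟩ := exists_bvp_eq_of_im_neg G hU hz' (L := τ.opD z) rfl
      (fun x hx => τ.pairQuad_nonneg hz' hx) (h, 0)
    obtain ⟨h1, h2⟩ := Prod.ext_iff.1 h'
    refine ⟨y, ⟨hy, ?_⟩, h1⟩
    change endPair G y ∈ τ.bc z
    rw [BoundaryParameter.bc_of_im_neg hz']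
    exact h2
  · obtain ⟨y, hy, h'⟩ := exists_bvp_eq_of_im_pos G hU hz' (L := τ.opC z) rfl
      (fun x hx => τ.pairQuad_nonpos hz' hx) (h, 0)
    obtain ⟨h1, h2⟩ := Prod.ext_iff.1 h'
    refine ⟨y, ⟨hy, ?_⟩, h1⟩
    change endPair G y ∈ τ.bc z
    rw [BoundaryParameter.bc_of_im_pos hz']
    exact h2

open Classical in
/-- The solution with boundary value `h` at the regular endpoint that satisfies the boundary
condition `τ` at `b` (zero for real `z`). -/
noncomputable def weylSol (hU : IsJUnitary U) (z : ℂ) : HZero H K →ₗ[ℂ] S.domMax :=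
  if hz : z.im ≠ 0 then
    (exists_linear_section (eq_zero_of_mem_weylSpace G τ hU hz)
      (exists_mem_weylSpace G τ hU hz)).choose
  else 0

theorem weylSol_mem (hU : IsJUnitary U) (hz : z.im ≠ 0) (h : HZero H K) :
    weylSol G τ hU z h ∈ weylSpace G τ z := by
  rw [weylSol, dif_pos hz]
  exact (exists_linear_section (eq_zero_of_mem_weylSpace G τ hU hz)
    (exists_mem_weylSpace G τ hU hz)).choose_spec.1 h

theorem hvec_weylSol (hU : IsJUnitary U) (hz : z.im ≠ 0) (h : HZero H K) :
    hvec U G (weylSol G τ hU z h) = h := by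
  rw [weylSol, dif_pos hz]
  exact (exists_linear_section (eq_zero_of_mem_weylSpace G τ hU hz)
    (exists_mem_weylSpace G τ hU hz)).choose_spec.2 h

theorem eq_weylSol (hU : IsJUnitary U) (hz : z.im ≠ 0) {h : HZero H K} {y : S.domMax}
    (hy : y ∈ weylSpace G τ z) (hh : hvec U G y = h) : y = weylSol G τ hU z h := by
  rw [← sub_eq_zero]
  refine eq_zero_of_mem_weylSpace G τ hU hz _ (sub_mem hy (weylSol_mem G τ hU hz h)) ?_
  rw [map_sub, hh, hvec_weylSol, sub_self]
  exact hz

theorem hvec_eq_iff {h : HZero H K} {y : S.domMax} : hvec U G y = h ↔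
    (U ((y : ℝ → HBold H K) S.a)).snd = -h.fst ∧
    Complex.I • ((U ((y : ℝ → HBold H K) S.a)).fst.snd - G.Γhat y) = h.snd := by
  rw [hvec_apply]
  constructor
  · rintro rfl
    exact ⟨(neg_neg _).symm, rfl⟩
  · rintro ⟨h1, h2⟩
    refine WithLp.ofLp_injective 2 (Prod.ext ?_ h2)
    change -_ = h.fst
    rw [h1, neg_neg]

variable {τ}

theorem mem_bc_iff (hz : z.im ≠ 0) {y : S.domMax} : endPair G y ∈ τ.bc z ↔
    (0 < z.im → τ.C₀ z (G.Γ₀ y) + τ.C₁ z (G.Γ₁ y) = 0) ∧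
    (z.im < 0 → τ.D₀ z (G.Γ₀ y) + τ.D₁ z (G.Γ₁ y) = 0) := by
  rcases hz.lt_or_gt with h | h
  · rw [BoundaryParameter.bc_of_im_neg h]
    exact ⟨fun k => ⟨fun h' => absurd h' h.not_gt, fun _ => k⟩, fun k => k.2 h⟩
  · rw [BoundaryParameter.bc_of_im_pos h]
    exact ⟨fun k => ⟨fun _ => k, fun h' => absurd h h'.not_gt⟩, fun k => k.1 h⟩

theorem isVTau_iff (hz : z.im ≠ 0) {v : ℝ → HZero H K →L[ℂ] HBold H K} : IsVTau S U G τ z v ↔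
    ∀ h : HZero H K, ∃ y : S.domMax, (∀ t, (y : ℝ → HBold H K) t = v t h) ∧
      SolvesOn S.I S.a S.B y (fun t => z • S.Δ t ((y : ℝ → HBold H K) t)) ∧
      hvec U G y = h ∧ endPair G y ∈ τ.bc z := by
  refine forall_congr' fun h => exists_congr fun y => and_congr_right fun _ =>
    and_congr_right fun _ => ?_
  rw [hvec_eq_iff, mem_bc_iff G hz, and_assoc]

theorem exists_isVTau (hU : IsJUnitary U) (hz : z.im ≠ 0) : ∃ v, IsVTau S U G τ z v := by
  refine ⟨fun t => LinearMap.toContinuousLinearMap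
    (LinearMap.proj t ∘ₗ S.domMax.subtype ∘ₗ weylSol G τ hU z), ?_⟩
  rw [isVTau_iff G hz]
  intro h
  have hm := weylSol_mem G τ hU hz h
  exact ⟨weylSol G τ hU z h, fun t => rfl, hm.1.1, hvec_weylSol G τ hU hz h, hm.2⟩

theorem bd_fst_eq {y w : S.domMax} (h : G.bd y = G.bd w) :
    hvec U G y = hvec U G w ∧ mvec U G y = mvec U G w ∧ endPair G y = endPair G w := by
  rw [bd_apply, bd_apply] at h
  obtain ⟨h1, h'⟩ := Prod.mk.inj h
  obtain ⟨h2, h'⟩ := Prod.mk.inj h'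
  obtain ⟨h3, h4⟩ := Prod.mk.inj h'
  rw [hvec_apply, hvec_apply, mvec_apply, mvec_apply, endPair_apply, endPair_apply, h1, h2, h3, h4]
  exact ⟨rfl, rfl, rfl⟩

/-- A function as in `IsVTau` agrees on `I` with the normalized solution, and has the same boundary
values. -/
theorem exists_weylSol_of_isVTau (hU : IsJUnitary U) (hz : z.im ≠ 0)
    {v : ℝ → HZero H K →L[ℂ] HBold H K} (hv : IsVTau S U G τ z v) (h : HZero H K) :
    ∃ y : S.domMax, (∀ t, (y : ℝ → HBold H K) t = v t h) ∧ G.bd y = G.bd (weylSol G τ hU z h) ∧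
      ∀ t ∈ S.I, v t h = (weylSol G τ hU z h : ℝ → HBold H K) t := by
  obtain ⟨y, hyv, hs, hh, hb⟩ := (isVTau_iff G hz).1 hv h
  obtain ⟨w, hw, hwy⟩ := exists_mem_solSpace (mem_L2_of_domMax y) hs
  have hbd := bd_congr G hwy
  obtain ⟨e1, -, e3⟩ := bd_fst_eq (U := U) G hbd
  have hww : w = weylSol G τ hU z h := by
    refine eq_weylSol G τ hU hz ⟨hw, ?_⟩ (e1.trans hh)
    change endPair G w ∈ τ.bc z
    rwa [e3]
  rw [← hww]
  exact ⟨y, hyv, hbd.symm, fun t ht => by rw [← hyv, hwy t ht]⟩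

theorem isVTau_vTau (hU : IsJUnitary U) (hz : z.im ≠ 0) :
    IsVTau S U G τ z (vTau S U G τ z) :=
  Classical.epsilon_spec (exists_isVTau G hU hz)

theorem eqOn_of_isVTau (hU : IsJUnitary U) (hz : z.im ≠ 0)
    {v w : ℝ → HZero H K →L[ℂ] HBold H K} (hv : IsVTau S U G τ z v) (hw : IsVTau S U G τ z w) :
    Set.EqOn v w S.I := by
  intro t ht
  refine ContinuousLinearMap.ext fun h => ?_
  obtain ⟨-, -, -, h1⟩ := exists_weylSol_of_isVTau G hU hz hv h
  obtain ⟨-, -, -, h2⟩ := exists_weylSol_of_isVTau G hU hz hw h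
  rw [h1 t ht, h2 t ht]

theorem vTau_apply (hU : IsJUnitary U) (hz : z.im ≠ 0) {t : ℝ} (ht : t ∈ S.I) (h : HZero H K) :
    vTau S U G τ z t h = (weylSol G τ hU z h : ℝ → HBold H K) t := by
  obtain ⟨-, -, -, h1⟩ := exists_weylSol_of_isVTau G hU hz (isVTau_vTau G hU hz) h
  exact h1 t ht

/-- The term `(i/2) P_Ĥ` turns `Γ̂_a` into the mean value `½ (Γ̂_a + Γ̂_b)`. -/
theorem mTau_apply (hU : IsJUnitary U) (hz : z.im ≠ 0) (h : HZero H K) :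
    mTau S U G τ z h = mvec U G (weylSol G τ hU z h) := by
  have h1 : mTau S U G τ z h = (U ((weylSol G τ hU z h : ℝ → HBold H K) S.a)).fst
      + (Complex.I / 2) • projHat H K h := by
    rw [← vTau_apply G hU hz S.isLeast.1]
    rfl
  have h2 := hvec_weylSol G τ hU hz h
  set y := weylSol G τ hU z h
  have h3 : projHat H K h = WithLp.toLp 2 (0, Complex.I •
      ((U ((y : ℝ → HBold H K) S.a)).fst.snd - G.Γhat y)) := by
    rw [← h2]; rfl
  rw [h1, h3, mvec_apply]
  refine WithLp.ofLp_injective 2 (Prod.ext ?_ ?_)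
  · change _ + (Complex.I / 2) • (0 : H) = _
    rw [smul_zero, add_zero]
    rfl
  · change (U ((y : ℝ → HBold H K) S.a)).fst.snd + (Complex.I / 2) • (Complex.I • (_ - _)) =
      (1 / 2 : ℂ) • (_ + _)
    rw [smul_smul, div_mul_eq_mul_div, Complex.I_mul_I]
    module

end SymmetricSystem

end SymmSys

/-! ### Operator functions and their matrix elements -/

section MatrixElements

variable {V W : Type*} [NormedAddCommGroup V] [InnerProductSpace ℂ V]
  [NormedAddCommGroup W] [InnerProductSpace ℂ W]

theorem ContinuousLinearMap.eq_sum_matrixElements {ι κ : Type*} [Fintype ι] [Fintype κ]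
    (b : OrthonormalBasis ι ℂ V) (c : OrthonormalBasis κ ℂ W) (T : V →L[ℂ] W) :
    T = ∑ i, ∑ j, (inner ℂ (c j) (T (b i)) : ℂ) • (innerSL ℂ (b i)).smulRight (c j) := by
  refine ContinuousLinearMap.ext fun x => ?_
  simp only [sum_apply, smul_apply,
    ContinuousLinearMap.smulRight_apply, innerSL_apply_apply]
  conv_lhs => rw [← b.sum_repr' x, map_sum]
  refine Finset.sum_congr rfl fun i _ => ?_
  rw [map_smul, ← c.sum_repr' (T (b i)), Finset.smul_sum]
  refine Finset.sum_congr rfl fun j _ => ?_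
  rw [c.sum_repr', smul_comm]

theorem inner_integral_apply [FiniteDimensional ℂ W] {α : Type*} [MeasurableSpace α] {μ : Measure α}
    {Φ : α → V →L[ℂ] W} (h : Integrable Φ μ) (v : V) (w : W) :
    (inner ℂ w ((∫ t, Φ t ∂μ) v) : ℂ) = ∫ t, (inner ℂ w (Φ t v) : ℂ) ∂μ :=
  ((innerSL ℂ w ∘L ContinuousLinearMap.apply ℂ W v).integral_comp_comm h).symm

theorem ContinuousLinearMap.le_of_inner_le {A B : V →L[ℂ] V} (α β : V → ℝ)
    (hA : ∀ x, (inner ℂ x (A x) : ℂ) = α x) (hB : ∀ x, (inner ℂ x (B x) : ℂ) = β x)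
    (h : ∀ x, α x ≤ β x) : A ≤ B := by
  rw [ContinuousLinearMap.le_def, ContinuousLinearMap.isPositive_iff_complex]
  intro x
  have e : (inner ℂ ((B - A) x) x : ℂ) = ((β x - α x : ℝ) : ℂ) := by
    rw [← inner_conj_symm, sub_apply, inner_sub_right, hA, hB, ← Complex.ofReal_sub,
      Complex.conj_ofReal]
  rw [e]
  exact ⟨by simp, by simpa using h x⟩

theorem integrable_sum_sum_smul {α ι κ Z : Type*} [MeasurableSpace α] {μ : Measure α} [Fintype ι]
    [Fintype κ] [NormedAddCommGroup Z] [NormedSpace ℂ Z] {f : ι → κ → α → ℂ} (c : ι → κ → Z)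
    (h : ∀ i j, Integrable (f i j) μ) : Integrable (fun t => ∑ i, ∑ j, f i j t • c i j) μ :=
  integrable_finsetSum _ fun i _ => integrable_finsetSum _ fun j _ => (h i j).smul_const _

variable [FiniteDimensional ℂ V] [FiniteDimensional ℂ W]

theorem differentiableAt_of_matrixElements {Φ : ℂ → V →L[ℂ] W} {z : ℂ}
    (h : ∀ v w, DifferentiableAt ℂ (fun ζ => (inner ℂ w (Φ ζ v) : ℂ)) z) :
    DifferentiableAt ℂ Φ z := by
  have e : Φ = fun ζ => ∑ i, ∑ j, (inner ℂ (stdOrthonormalBasis ℂ W j)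
      (Φ ζ (stdOrthonormalBasis ℂ V i)) : ℂ) •
        (innerSL ℂ (stdOrthonormalBasis ℂ V i)).smulRight (stdOrthonormalBasis ℂ W j) :=
    funext fun ζ => ContinuousLinearMap.eq_sum_matrixElements _ _ _
  rw [e]
  exact DifferentiableAt.fun_sum fun i _ => DifferentiableAt.fun_sum fun j _ =>
    (h _ _).smul_const _

theorem integrable_of_matrixElements {α : Type*} [MeasurableSpace α] {μ : Measure α}
    {Φ : α → V →L[ℂ] W} (h : ∀ v w, Integrable (fun t => (inner ℂ w (Φ t v) : ℂ)) μ) :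
    Integrable Φ μ := by
  have e : Φ = fun t => ∑ i, ∑ j, (inner ℂ (stdOrthonormalBasis ℂ W j)
      (Φ t (stdOrthonormalBasis ℂ V i)) : ℂ) •
        (innerSL ℂ (stdOrthonormalBasis ℂ V i)).smulRight (stdOrthonormalBasis ℂ W j) :=
    funext fun t => ContinuousLinearMap.eq_sum_matrixElements _ _ _
  rw [e]
  exact integrable_sum_sum_smul _ fun i j => h _ _

theorem ContinuousLinearMap.inner_adjoint_comp_comp (A : V →L[ℂ] W) (T : W →L[ℂ] W) (x y : V) :
    (inner ℂ x ((ContinuousLinearMap.adjoint A ∘L T ∘L A) y) : ℂ) = inner ℂ (A x) (T (A y)) := by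
  rw [ContinuousLinearMap.comp_apply, ContinuousLinearMap.comp_apply,
    ContinuousLinearMap.adjoint_inner_right]

theorem isUnit_of_injective {T : V →L[ℂ] V} (h : ∀ x, T x = 0 → x = 0) : IsUnit T := by
  have hi : Function.Injective T.toLinearMap := (injective_iff_map_eq_zero _).2 h
  exact ContinuousLinearMap.isUnit_iff_bijective.2 ⟨hi, LinearMap.injective_iff_surjective.1 hi⟩

end MatrixElements

namespace SymmSys

variable {H K : Type*}
  [NormedAddCommGroup H] [InnerProductSpace ℂ H] [FiniteDimensional ℂ H]
  [NormedAddCommGroup K] [InnerProductSpace ℂ K] [FiniteDimensional ℂ K]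
  {E : Type*} [NormedAddCommGroup E] [InnerProductSpace ℂ E] [FiniteDimensional ℂ E]
  {F : Submodule ℂ E}

namespace SymmetricSystem

variable {S : SymmetricSystem H K} {U : HBold H K →L[ℂ] HBold H K} (G : BoundaryMap S F)
  {τ : BoundaryParameter F} {z : ℂ}

/-! ### Symmetry, positivity and the inequality for the `m`-function -/

theorem adjoint_mTau (hU : IsJUnitary U) (hz : z.im ≠ 0) :
    ContinuousLinearMap.adjoint (mTau S U G τ z) = mTau S U G τ ((starRingEnd ℂ) z) := by
  have hz' : ((starRingEnd ℂ) z).im ≠ 0 := by simpa using hz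
  refine ((ContinuousLinearMap.eq_adjoint_iff _ _).2 fun h' h => ?_).symm
  rw [mTau_apply G hU hz, mTau_apply G hU hz']
  have hy := weylSol_mem G τ hU hz h
  have hw := weylSol_mem G τ hU hz' h'
  have key := green_solSpace G hU hy.1 hw.1
  rw [Complex.conj_conj, sub_self, zero_mul, hvec_weylSol G τ hU hz, hvec_weylSol G τ hU hz',
    τ.pairForm_eq_zero_of_mem_bc hz hy.2 hw.2, zero_add] at key
  exact (sub_eq_zero.1 key.symm).symm

/-- The `m`-function dominates the norm of the solution, because the boundary form at `b` has a sign
on the boundary condition. -/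
theorem im_mul_norm_sq_le (hU : IsJUnitary U) (hz : z.im ≠ 0) (h : HZero H K) :
    z.im ^ 2 * ‖cls (weylSol G τ hU z h)‖ ^ 2 ≤
      z.im * (inner ℂ h (mTau S U G τ z h) : ℂ).im := by
  have hy := weylSol_mem G τ hU hz h
  have h1 := two_im_mul_norm_sq G hU hy.1
  have h2 := τ.im_mul_pairQuad_nonpos hz hy.2
  rw [hvec_weylSol G τ hU hz, ← mTau_apply G hU hz] at h1
  have h3 : z.im ^ 2 * ‖cls (weylSol G τ hU z h)‖ ^ 2 =
      z.im * pairQuad (endPair G (weylSol G τ hU z h)) / 2 +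
        z.im * (inner ℂ h (mTau S U G τ z h) : ℂ).im := by
    linear_combination (z.im / 2) * h1
  linarith

theorem im_smul_imaginaryPart_mTau_nonneg (hU : IsJUnitary U) (hz : z.im ≠ 0) :
    0 ≤ (z.im : ℂ) • (ℑ (mTau S U G τ z) : HZero H K →L[ℂ] HZero H K) := by
  refine ContinuousLinearMap.le_of_inner_le (fun _ => 0)
    (fun h => z.im * (inner ℂ h (mTau S U G τ z h) : ℂ).im) (fun x => ?_) (fun x => ?_) fun x => ?_
  · simp
  · rw [smul_apply, inner_smul_right, inner_imaginaryPart, ← Complex.ofReal_mul]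
  · exact le_trans (by positivity) (im_mul_norm_sq_le G hU hz x)

theorem inner_vTauGram (hU : IsJUnitary U) (hz : z.im ≠ 0) {t : ℝ} (ht : t ∈ S.I)
    (h h' : HZero H K) : (inner ℂ h' (vTauGram S U G τ z t h) : ℂ) =
      inner ℂ ((weylSol G τ hU z h' : ℝ → HBold H K) t)
        (S.Δ t ((weylSol G τ hU z h : ℝ → HBold H K) t)) := by
  rw [← vTau_apply G hU hz ht, ← vTau_apply G hU hz ht]
  exact ContinuousLinearMap.inner_adjoint_comp_comp _ _ _ _

theorem mIneq (hU : IsJUnitary U) (hz : z.im ≠ 0) : MIneq S U G τ z := by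
  have hint : IntegrableOn (vTauGram S U G τ z) S.I volume := by
    refine integrable_of_matrixElements fun h h' => ?_
    refine (integrableOn_congr_fun (fun t ht => inner_vTauGram G hU hz ht h h')
      S.measurableSet_I).2 ?_
    exact MemL2.integrable_inner S (mem_L2_of_domMax _) (mem_L2_of_domMax _)
  refine ⟨hint, ContinuousLinearMap.le_of_inner_le (fun h => ‖cls (weylSol G τ hU z h)‖ ^ 2)
    (fun h => (z.im)⁻¹ * (inner ℂ h (mTau S U G τ z h) : ℂ).im) (fun h => ?_) (fun h => ?_)
    fun h => ?_⟩
  · rw [inner_integral_apply hint, ← form_self]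
    exact setIntegral_congr_fun S.measurableSet_I fun t ht => inner_vTauGram G hU hz ht h h
  · rw [smul_apply, inner_smul_right, inner_imaginaryPart]
    push_cast
    rfl
  · have h1 := im_mul_norm_sq_le G hU hz h (τ := τ)
    have h2 : 0 < z.im ^ 2 := by positivity
    have h3 : (z.im)⁻¹ * (inner ℂ h (mTau S U G τ z h) : ℂ).im =
        z.im * (inner ℂ h (mTau S U G τ z h) : ℂ).im / z.im ^ 2 := by
      field_simp
    rw [h3, le_div_iff₀ h2, mul_comm]
    exact h1

/-! ### Holomorphy of the `m`-function -/

variable (S U) in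
/-- `Y {h, x}` is a solution for the parameter `z` with the boundary values `hvec y = h` and
`L (Γ_{0b} y, Γ_{1b} y) = x`. -/
structure IsBvpSolution {X : Type*} [AddCommGroup X] [Module ℂ X] (L : E × F →ₗ[ℂ] X) (z : ℂ)
    (Y : HZero H K × X →ₗ[ℂ] S.domMax) : Prop where
  mem : ∀ x, Y x ∈ S.solSpace z
  bvp_eq : ∀ x, bvp G U L (Y x) = x

variable {G}

theorem IsBvpSolution.hvec_eq {X : Type*} [AddCommGroup X] [Module ℂ X] {L : E × F →ₗ[ℂ] X}
    {Y : HZero H K × X →ₗ[ℂ] S.domMax} (hY : IsBvpSolution S U G L z Y) (x : HZero H K × X) :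
    hvec U G (Y x) = x.1 := congrArg Prod.fst (hY.bvp_eq x)

theorem IsBvpSolution.map_endPair {X : Type*} [AddCommGroup X] [Module ℂ X] {L : E × F →ₗ[ℂ] X}
    {Y : HZero H K × X →ₗ[ℂ] S.domMax} (hY : IsBvpSolution S U G L z Y) (x : HZero H K × X) :
    L (endPair G (Y x)) = x.2 := congrArg Prod.snd (hY.bvp_eq x)

variable (G)

theorem exists_isBvpSolution_fst (hU : IsJUnitary U) :
    ∃ Y : ℂ → HZero H K × E →ₗ[ℂ] S.domMax,
      ∀ z, 0 < z.im → IsBvpSolution S U G (LinearMap.fst ℂ E F) z (Y z) := by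
  have h : ∀ z : ℂ, ∃ Y : HZero H K × E →ₗ[ℂ] S.domMax,
      0 < z.im → IsBvpSolution S U G (LinearMap.fst ℂ E F) z Y := by
    intro z
    by_cases hz : 0 < z.im
    · obtain ⟨R, h1, h2⟩ := exists_linear_section
        (eq_zero_of_bvp_eq_zero (L := LinearMap.fst ℂ E F) G hU hz.ne' fun x hx => by
          rw [pairQuad_of_fst_eq_zero hx, mul_zero])
        (exists_bvp_eq_of_im_pos G hU hz rfl fun x hx => (pairQuad_of_fst_eq_zero hx).le)
      exact ⟨R, fun _ => ⟨h1, h2⟩⟩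
    · exact ⟨0, fun h => absurd h hz⟩
  choose Y hY using h
  exact ⟨Y, hY⟩

theorem exists_isBvpSolution_projFst (hU : IsJUnitary U) :
    ∃ Y : ℂ → HZero H K × F →ₗ[ℂ] S.domMax,
      ∀ z, z.im < 0 → IsBvpSolution S U G (projFst F) z (Y z) := by
  have h : ∀ z : ℂ, ∃ Y : HZero H K × F →ₗ[ℂ] S.domMax,
      z.im < 0 → IsBvpSolution S U G (projFst F) z Y := by
    intro z
    by_cases hz : z.im < 0
    · obtain ⟨R, h1, h2⟩ := exists_linear_section
        (eq_zero_of_bvp_eq_zero (L := projFst F) G hU hz.ne fun x hx =>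
          mul_nonpos_of_nonpos_of_nonneg hz.le (pairQuad_nonneg_of_proj_eq_zero hx))
        (exists_bvp_eq_of_im_neg G hU hz rfl fun x hx => pairQuad_nonneg_of_proj_eq_zero hx)
      exact ⟨R, fun _ => ⟨h1, h2⟩⟩
    · exact ⟨0, fun h => absurd h hz⟩
  choose Y hY using h
  exact ⟨Y, hY⟩

variable {G}

theorem inner_sub_inner_of_eq_smul_add {V : Type*} [NormedAddCommGroup V] [InnerProductSpace ℂ V]
    {u w f : V} {ζ c : ℂ} (hf : f = ζ • u + c • w) :
    (inner ℂ u f - inner ℂ f u : ℂ) =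
      Complex.I * ((2 * (ζ.im * ‖u‖ ^ 2 + (c * inner ℂ u w).im) : ℝ) : ℂ) := by
  have h : (inner ℂ u f : ℂ) = ζ * ((‖u‖ ^ 2 : ℝ) : ℂ) + c * inner ℂ u w := by
    rw [hf, inner_add_right, inner_smul_right, inner_smul_right, inner_self_eq_norm_sq_to_K]
    push_cast
    rfl
  rw [← inner_conj_symm f u, Complex.sub_conj, h, Complex.add_im, Complex.im_mul_ofReal]
  push_cast
  ring

theorem mul_norm_le_of_dissipative {V : Type*} [NormedAddCommGroup V] [InnerProductSpace ℂ V]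
    {u w : V} {r : ℝ} {c : ℂ} (h : 0 ≤ 2 * (r * ‖u‖ ^ 2 + (c * inner ℂ u w).im)) :
    -r * ‖u‖ ≤ ‖c‖ * ‖w‖ := by
  have h1 : (c * inner ℂ u w).im ≤ ‖c‖ * (‖u‖ * ‖w‖) :=
    (Complex.im_le_norm _).trans (by
      rw [norm_mul]
      exact mul_le_mul_of_nonneg_left (norm_inner_le_norm _ _) (norm_nonneg _))
  rcases (norm_nonneg u).eq_or_lt with h0 | h0
  · rw [← h0, mul_zero]
    positivity
  · refine le_of_mul_le_mul_right ?_ h0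
    linarith

theorem _root_.LinearMap.map_smul_sub_smul {V W : Type*} [AddCommGroup V] [Module ℂ V]
    [AddCommGroup W] [Module ℂ W] (T : V →ₗ[ℂ] W) (c d : ℂ) (x y : V) :
    T (c • x - d • y) = c • T (x - y) + (c - d) • T y := by
  rw [map_sub, map_sub, map_smul, map_smul, smul_sub, sub_smul, sub_add_sub_cancel]

theorem _root_.Submodule.mk_sub_mem_of_mk_smul_mem {V : Type*} [AddCommGroup V] [Module ℂ V]
    {D : Submodule ℂ V} {T : Submodule ℂ (V × V)} {y w : D} {c d : ℂ}
    (hy : ((y : V), c • (y : V)) ∈ T) (hw : ((w : V), d • (w : V)) ∈ T) :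
    (((y - w : D) : V), ((c • y - d • w : D) : V)) ∈ T :=
  T.sub_mem hy hw

/-- The difference of the solutions for `ζ` and `z` with equal boundary values is of order `ζ - z`:
Green's identity for this difference contains no boundary term of the wrong sign. -/
theorem norm_cls_sub_le (hU : IsJUnitary U) {z ζ : ℂ} {y w : S.domMax}
    (hy : y ∈ S.solSpace ζ) (hw : w ∈ S.solSpace z) (hh : hvec U G y = hvec U G w)
    (hp : projFst F (endPair G y) = projFst F (endPair G w)) :
    -ζ.im * ‖cls (y - w)‖ ≤ ‖ζ - z‖ * ‖cls w‖ := by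
  have hfu : (((y - w : S.domMax) : ℝ → HBold H K), ((ζ • y - z • w : S.domMax) : ℝ → HBold H K))
      ∈ S.tmax := 
    Submodule.mk_sub_mem_of_mk_smul_mem (mem_tmax_of_mem_solSpace hy) (mem_tmax_of_mem_solSpace hw)
  have hf : cls (ζ • y - z • w) = ζ • cls (y - w) + (ζ - z) • cls w :=
    cls.map_smul_sub_smul ζ z y w
  have h1 := green G hfu hfu
  have hh0 : hvec U G (y - w) = 0 := by rw [map_sub, hh, sub_self]
  have hp0 : projFst F (endPair G (y - w)) = 0 := by rw [map_sub, map_sub, hp, sub_self]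
  rw [bracket_sub_inner_J G hU, hh0, inner_zero_left, inner_zero_right, add_zero, sub_zero,
    pairForm_self, ← inner_cls_cls, ← inner_cls_cls, inner_sub_inner_of_eq_smul_add hf] at h1
  have h2 := Complex.ofReal_injective (mul_left_cancel₀ Complex.I_ne_zero h1)
  exact mul_norm_le_of_dissipative (h2 ▸ pairQuad_nonneg_of_proj_eq_zero hp0)

theorem tendsto_cls_of_isBvpSolution (hU : IsJUnitary U) (hz : z.im < 0)
    {Y : ℂ → HZero H K × F →ₗ[ℂ] S.domMax}
    (hY : ∀ z, z.im < 0 → IsBvpSolution S U G (projFst F) z (Y z)) (x : HZero H K × F) :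
    Tendsto (fun ζ => cls (Y ζ x)) (𝓝 z) (𝓝 (cls (Y z x))) := by
  rw [tendsto_iff_norm_sub_tendsto_zero]
  have h1 : Tendsto (fun ζ : ℂ => ‖ζ - z‖ * ‖cls (Y z x)‖ / (-ζ.im)) (𝓝 z) (𝓝 0) := by
    have : ContinuousAt (fun ζ : ℂ => ‖ζ - z‖ * ‖cls (Y z x)‖ / (-ζ.im)) z :=
      ContinuousAt.div (by fun_prop) (Complex.continuous_im.neg.continuousAt)
        (neg_ne_zero.2 hz.ne)
    simpa [ContinuousAt] using this
  refine squeeze_zero' (Eventually.of_forall fun _ => norm_nonneg _) ?_ h1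
  filter_upwards [(isOpen_lt Complex.continuous_im continuous_const).mem_nhds hz] with ζ hζ
  rw [le_div_iff₀ (neg_pos.2 hζ), mul_comm, ← map_sub]
  exact norm_cls_sub_le hU ((hY ζ hζ).mem x) ((hY z hz).mem x)
    (((hY ζ hζ).hvec_eq x).trans ((hY z hz).hvec_eq x).symm)
    (((hY ζ hζ).map_endPair x).trans ((hY z hz).map_endPair x).symm)

/-- Green's identity for two solutions with equal boundary values and a solution of the dual
problem. -/
theorem sub_mul_inner_cls (hU : IsJUnitary U) {z ζ : ℂ} {y y' w : S.domMax}
    (hy : y ∈ S.solSpace ζ) (hy' : y' ∈ S.solSpace z) (hw : w ∈ S.solSpace ((starRingEnd ℂ) ζ))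
    (hh : hvec U G y = hvec U G y') (h0 : G.Γ₀ y = G.Γ₀ y') :
    (ζ - z) * inner ℂ (cls w) (cls y') =
      inner ℂ (hvec U G w) (mvec U G y - mvec U G y') -
        inner ℂ (projFst F (endPair G w)) (G.Γ₁ y - G.Γ₁ y') := by
  have h1 := green_solSpace G hU hy hw
  have h2 := green_solSpace G hU hy' hw
  rw [Complex.conj_conj, sub_self, zero_mul, hh] at h1
  rw [Complex.conj_conj, ← inner_cls_cls] at h2
  have h3 : pairForm (endPair G y) (endPair G w) - pairForm (endPair G y') (endPair G w) =
      -inner ℂ (projFst F (endPair G w)) (G.Γ₁ y - G.Γ₁ y') := by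
    rw [← pairForm_sub_left, ← map_sub, endPair_apply, pairForm, map_sub, h0, sub_self,
      inner_zero_right, map_zero, inner_zero_right, mul_zero, zero_sub, add_zero, map_sub]
    exact congrArg _ (Submodule.inner_orthogonalProjectionOnto_eq_of_mem_right _ _).symm
  rw [inner_sub_right]
  linear_combination (-1 : ℂ) * h2 + h1 + h3

/-- The difference quotients of these matrix elements are inner products of solutions in `L²_Δ(I)`,
which converge since the solutions of the dual problem depend continuously on the parameter. -/
theorem differentiableAt_matrixElement (hU : IsJUnitary U) (hz : 0 < z.im)
    {Y : ℂ → HZero H K × E →ₗ[ℂ] S.domMax}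
    (hY : ∀ z, 0 < z.im → IsBvpSolution S U G (LinearMap.fst ℂ E F) z (Y z))
    (ξ : HZero H K × E) (η : HZero H K × F) :
    DifferentiableAt ℂ (fun ζ => (inner ℂ η.1 (mvec U G (Y ζ ξ)) : ℂ) -
      inner ℂ η.2 (G.Γ₁ (Y ζ ξ))) z := by
  obtain ⟨W, hW⟩ := exists_isBvpSolution_projFst G hU
  have hz' : ((starRingEnd ℂ) z).im < 0 := by simpa using hz
  refine HasDerivAt.differentiableAt
    (f' := inner ℂ (cls (W ((starRingEnd ℂ) z) η)) (cls (Y z ξ))) ?_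
  rw [hasDerivAt_iff_tendsto_slope]
  have h1 : Tendsto (fun ζ => (inner ℂ (cls (W ((starRingEnd ℂ) ζ) η)) (cls (Y z ξ)) : ℂ)) (𝓝 z)
      (𝓝 (inner ℂ (cls (W ((starRingEnd ℂ) z) η)) (cls (Y z ξ)))) :=
    ((tendsto_cls_of_isBvpSolution hU hz' hW η).comp
      (Complex.continuous_conj.tendsto z)).inner tendsto_const_nhds
  refine (h1.mono_left nhdsWithin_le_nhds).congr' ?_
  filter_upwards [self_mem_nhdsWithin, nhdsWithin_le_nhds
    ((isOpen_lt continuous_const Complex.continuous_im).mem_nhds hz)] with ζ hne hζ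
  have hζ' : ((starRingEnd ℂ) ζ).im < 0 := by
    rw [Complex.conj_im]; exact neg_neg_of_pos hζ
  have key := sub_mul_inner_cls hU ((hY ζ hζ).mem ξ) ((hY z hz).mem ξ) ((hW _ hζ').mem η)
    (((hY ζ hζ).hvec_eq ξ).trans ((hY z hz).hvec_eq ξ).symm)
    (((hY ζ hζ).map_endPair ξ).trans ((hY z hz).map_endPair ξ).symm)
  rw [(hW _ hζ').hvec_eq, (hW _ hζ').map_endPair, inner_sub_right, inner_sub_right] at key
  have hne' : ζ - z ≠ 0 := sub_ne_zero.2 hne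
  rw [slope_def_field, eq_div_iff hne', mul_comm, key]
  ring

/-- In the upper half-plane, the problem for `τ` is reduced to that with prescribed `Γ_{0b} y` by
means of the operators `C₀(z) + C₁(z) Q(z)`, where `Q(z)` is the operator `Γ_{0b} y ↦ Γ_{1b} y` of
the latter problem. -/
theorem differentiableAt_mTau_of_im_pos (hU : IsJUnitary U) (hz : 0 < z.im) :
    DifferentiableAt ℂ (mTau S U G τ) z := by
  obtain ⟨Y, hY⟩ := exists_isBvpSolution_fst G hU
  let ι₁ : HZero H K →ₗ[ℂ] HZero H K × E := LinearMap.inl ℂ _ _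
  let ι₂ : E →ₗ[ℂ] HZero H K × E := LinearMap.inr ℂ _ _
  let M (ζ : ℂ) : HZero H K →L[ℂ] HZero H K :=
    LinearMap.toContinuousLinearMap (mvec U G ∘ₗ Y ζ ∘ₗ ι₁)
  let N (ζ : ℂ) : E →L[ℂ] HZero H K := LinearMap.toContinuousLinearMap (mvec U G ∘ₗ Y ζ ∘ₗ ι₂)
  let P (ζ : ℂ) : HZero H K →L[ℂ] F := LinearMap.toContinuousLinearMap (G.Γ₁ ∘ₗ Y ζ ∘ₗ ι₁)
  let Q (ζ : ℂ) : E →L[ℂ] F := LinearMap.toContinuousLinearMap (G.Γ₁ ∘ₗ Y ζ ∘ₗ ι₂)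
  have d1 : ∀ (ξ : HZero H K × E) (h : HZero H K),
      DifferentiableAt ℂ (fun ζ => (inner ℂ h (mvec U G (Y ζ ξ)) : ℂ)) z := by
    intro ξ h
    simpa using differentiableAt_matrixElement hU hz hY ξ (h, 0)
  have d2 : ∀ (ξ : HZero H K × E) (f : F),
      DifferentiableAt ℂ (fun ζ => (inner ℂ f (G.Γ₁ (Y ζ ξ)) : ℂ)) z := by
    intro ξ f
    simpa using (differentiableAt_matrixElement hU hz hY ξ (0, f)).neg
  have dM : DifferentiableAt ℂ M z := differentiableAt_of_matrixElements fun v w => d1 _ w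
  have dN : DifferentiableAt ℂ N z := differentiableAt_of_matrixElements fun v w => d1 _ w
  have dP : DifferentiableAt ℂ P z := differentiableAt_of_matrixElements fun v w => d2 _ w
  have dQ : DifferentiableAt ℂ Q z := differentiableAt_of_matrixElements fun v w => d2 _ w
  have hopen : {ζ : ℂ | 0 < ζ.im} ∈ 𝓝 z :=
    (isOpen_lt continuous_const Complex.continuous_im).mem_nhds hz
  have dC₀ := τ.holo_C₀.differentiableAt hopen
  have dC₁ := τ.holo_C₁.differentiableAt hopen
  let R (ζ : ℂ) : E →L[ℂ] E := τ.C₀ ζ + τ.C₁ ζ ∘L Q ζ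
  have dR : DifferentiableAt ℂ R z := dC₀.add (dC₁.clm_comp dQ)
  have hR : ∀ ζ : ℂ, 0 < ζ.im → IsUnit (R ζ) := by
    intro ζ hζ
    refine isUnit_of_injective fun e he => ?_
    have h0 : G.Γ₀ (Y ζ (0, e)) = e := (hY ζ hζ).map_endPair (0, e)
    have h1 : Y ζ (0, e) = 0 := by
      refine eq_zero_of_mem_weylSpace G τ hU hζ.ne' _ ⟨(hY ζ hζ).mem _, ?_⟩
        ((hY ζ hζ).hvec_eq (0, e))
      change endPair G (Y ζ (0, e)) ∈ τ.bc ζ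
      rw [BoundaryParameter.bc_of_im_pos hζ]
      change τ.C₀ ζ (G.Γ₀ (Y ζ (0, e))) + τ.C₁ ζ (G.Γ₁ (Y ζ (0, e))) = 0
      rw [h0]
      exact he
    rw [← h0, h1, map_zero]
  -- `Y ζ {h, e}` satisfies the condition `τ` if and only if `R(ζ) e = -C₁(ζ) P(ζ) h`
  have hm : ∀ ζ : ℂ, 0 < ζ.im →
      mTau S U G τ ζ = M ζ - N ζ ∘L (Ring.inverse (R ζ) ∘L (τ.C₁ ζ ∘L P ζ)) := by
    intro ζ hζ
    refine ContinuousLinearMap.ext fun h => ?_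
    set e : E := -(Ring.inverse (R ζ) (τ.C₁ ζ (P ζ h))) with he
    have hRe : R ζ e = -(τ.C₁ ζ (P ζ h)) := by
      rw [he, map_neg]
      exact congrArg Neg.neg (DFunLike.congr_fun (Ring.mul_inverse_cancel _ (hR ζ hζ)) _)
    have hsplit : Y ζ (h, e) = Y ζ (ι₁ h) + Y ζ (ι₂ e) := by
      rw [← map_add]
      change Y ζ (h, e) = Y ζ (h + 0, 0 + e)
      rw [add_zero, zero_add]
    have h0 : G.Γ₀ (Y ζ (h, e)) = e := (hY ζ hζ).map_endPair (h, e)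
    have hYe : Y ζ (h, e) = weylSol G τ hU ζ h := by
      refine eq_weylSol G τ hU hζ.ne' ⟨(hY ζ hζ).mem _, ?_⟩ ((hY ζ hζ).hvec_eq (h, e))
      change endPair G (Y ζ (h, e)) ∈ τ.bc ζ
      rw [BoundaryParameter.bc_of_im_pos hζ]
      change τ.C₀ ζ (G.Γ₀ (Y ζ (h, e))) + τ.C₁ ζ (G.Γ₁ (Y ζ (h, e))) = 0
      rw [h0, hsplit, map_add, map_add]
      have h3 : τ.C₀ ζ e + τ.C₁ ζ (Q ζ e) = -(τ.C₁ ζ (P ζ h)) := hRe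
      change τ.C₀ ζ e + (τ.C₁ ζ (P ζ h) + τ.C₁ ζ (Q ζ e)) = 0
      rw [add_left_comm, h3, add_neg_cancel]
    rw [mTau_apply G hU hζ.ne', ← hYe, hsplit, map_add]
    change M ζ h + N ζ e = M ζ h - N ζ _
    rw [he, map_neg, ← sub_eq_add_neg]
    rfl
  have dInv : DifferentiableAt ℂ (fun ζ => Ring.inverse (R ζ)) z :=
    (differentiableAt_inverse (hR z hz)).comp z dR
  refine (dM.sub (dN.clm_comp (dInv.clm_comp (dC₁.clm_comp dP)))).congr_of_eventuallyEq ?_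
  filter_upwards [hopen] with ζ hζ
  exact hm ζ hζ

theorem differentiableAt_mTau (hU : IsJUnitary U) (hz : z.im ≠ 0) :
    DifferentiableAt ℂ (mTau S U G τ) z := by
  rcases hz.lt_or_gt with hz' | hz'
  · -- in the lower half-plane, `m_τ(z) = m_τ(z̄)*`
    refine differentiableAt_of_matrixElements fun v w => ?_
    have h1 : DifferentiableAt ℂ (fun ζ => (inner ℂ v (mTau S U G τ ζ w) : ℂ))
        ((starRingEnd ℂ) z) := by
      have := differentiableAt_mTau_of_im_pos (G := G) (τ := τ) hU
        (z := (starRingEnd ℂ) z) (by simpa using hz')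
      exact ((innerSL ℂ v) ∘L ContinuousLinearMap.apply ℂ _ w).differentiableAt.comp _ this
    have h2 := h1.conj_conj
    rw [Complex.conj_conj] at h2
    refine h2.congr_of_eventuallyEq ?_
    filter_upwards [(isOpen_ne_fun Complex.continuous_im continuous_const).mem_nhds hz] with ζ hζ
    have hζ' : ((starRingEnd ℂ) ζ).im ≠ 0 := by simpa using hζ
    have h3 := adjoint_mTau (z := (starRingEnd ℂ) ζ) (τ := τ) G hU hζ'
    rw [Complex.conj_conj] at h3
    rw [← h3, ContinuousLinearMap.adjoint_inner_right]
    exact (inner_conj_symm _ _).symm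
  · exact differentiableAt_mTau_of_im_pos hU hz'

end SymmetricSystem

end SymmSys

open SymmSys SymmSys.SymmetricSystem in
theorem proposition5p6
    {H K E : Type*}
    [NormedAddCommGroup H] [InnerProductSpace ℂ H] [FiniteDimensional ℂ H]
    [NormedAddCommGroup K] [InnerProductSpace ℂ K] [FiniteDimensional ℂ K]
    [NormedAddCommGroup E] [InnerProductSpace ℂ E] [FiniteDimensional ℂ E]
    (S : SymmSys.SymmetricSystem H K) (hdef : S.defMinus ≤ S.defPlus)
    (U : SymmSys.HBold H K →L[ℂ] SymmSys.HBold H K) (hU : SymmSys.IsJUnitary U)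
    (F : Submodule ℂ E) (G : SymmSys.BoundaryMap S F) (τ : SymmSys.BoundaryParameter F) :
    (∀ z : ℂ, z.im ≠ 0 →
      SymmSys.IsVTau S U G τ z (SymmSys.vTau S U G τ z) ∧
      ∀ w, SymmSys.IsVTau S U G τ z w → Set.EqOn w (SymmSys.vTau S U G τ z) S.I) ∧
    SymmSys.IsNevanlinna (SymmSys.mTau S U G τ) ∧
    (∀ z : ℂ, 0 < z.im → SymmSys.MIneq S U G τ z) ∧
    (S.defPlus = S.defMinus → ∀ z : ℂ, z.im ≠ 0 → SymmSys.MIneq S U G τ z) :=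
  ⟨fun _ hz => ⟨isVTau_vTau G hU hz, fun _ hw => eqOn_of_isVTau G hU hz hw (isVTau_vTau G hU hz)⟩,
    ⟨fun _ hz => (differentiableAt_mTau hU hz).differentiableWithinAt,
      fun _ hz => ⟨im_smul_imaginaryPart_mTau_nonneg G hU hz, adjoint_mTau G hU hz⟩⟩,
    fun _ hz => mIneq G hU hz.ne', fun _ _ hz => mIneq G hU hz⟩
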